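/- Let $X$ be a noetherian scheme. Write $\mathbf{D}(\operatorname{Qcoh} X)$ for the derived category of the abelian category of quasi-coherent sheaves on $X$, $\mathbf{D}^b_{\mathrm{coh}}(X)$ for its objects with bounded cohomology and coherent cohomology sheaves, and $\mathbf{K}(\operatorname{Inj}\text{-}X)$ for the homotopy category of (unbounded) complexes of injective objects of $\operatorname{Qcoh}(X)$. Notation. For an object $G$ of a triangulated category $\mathsf{T}$ with small coproducts and $-\infty\le a\le b\le\infty$, let $G[a,b]=\{\Sigma^{-i}G : i\in\mathbb{Z},\ a\le i\le b\}$. Let $\operatorname{Coprod}_1(G[a,b])$ be the class of all small coproducts of objects of $G[a,b]$, and let $\operatorname{Coprod}_{n+1}(G[a,b])$ be the class of objects $B$ admitting a triangle $A\to B\to C\to\Sigma A$ with $A\in\operatorname{Coprod}_1(G[a,b])$ and $C\in\operatorname{Coprod}_n(G[a,b])$. Let $\overline{\langle G\rangle}{}^{[a,b]}_n$ be the closure of $\operatorname{Coprod}_n(G[a,b])$ under direct summands, and $\overline{\langle G\rangle}_n=\overline{\langle G\rangle}{}^{(-\infty,\infty)}_n$. A co-t-structure on $\mathsf{T}$ is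 a pair $(\mathsf{U},\mathsf{V})$ of strictly full subcategories closed under direct summands such that $\Sigma^{-1}\mathsf{U}\subseteq\mathsf{U}$, $\Sigma\mathsf{V}\subseteq\mathsf{V}$, $\operatorname{Hom}(\mathsf{U},\Sigma\mathsf{V})=0$, and every $t\in\mathsf{T}$ admits a triangle $u\to t\to v\to\Sigma u$ with $u\in\mathsf{U}$ and $v\in\Sigma\mathsf{V}$. A compact generator of $\mathsf{T}$ is a compact object $H$ such that every $Y\in\mathsf{T}$ with $\operatorname{Hom}(\Sigma^nH,Y)=0$ for all $n\in\mathbb{Z}$ is zero. A triangulated category $\mathsf{T}$ with small coproducts is co-approximable via the co-t-structure $(\mathsf{U},\mathsf{V})$ if there are a compact generator $H$ and an integer $A>0$ such that 1. $\Sigma^{-A}H\in\mathsf{U}$; 2. $\operatorname{Hom}(\Sigma^AH,F)=0$ for all $F\in\mathsf{U}$; 3. every $F\in\mathsf{U}$ admits a triangle $E\to F\to D\to\Sigma E$ with $D\in\Sigma^{-1}\mathsf{U}$ and $E\in\overline{\langle H\rangle}{}^{[-A,A]}_A$; and it is co-approximable if it is so via some co-t-structure. Theorem. Assume that there are an object $G\in\mathbf{D}^b_{\mathrm{coh}}(X)$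 and a positive integer $N$ such that $\mathbf{D}(\operatorname{Qcoh} X)=\overline{\langle G\rangle}_N$. Then $\mathbf{K}(\operatorname{Inj}\text{-}X)$ has small coproducts and is co-approximable. More precisely, let $\mathbf{K}(\operatorname{Inj}\text{-}X)^{\ge 0}$ (respectively $\mathbf{K}(\operatorname{Inj}\text{-}X)^{\le 0}$) consist of the objects isomorphic to a complex of injectives concentrated in degrees $\ge 0$ (respectively $\le 0$). Then $(\mathbf{K}(\operatorname{Inj}\text{-}X)^{\ge 0},\mathbf{K}(\operatorname{Inj}\text{-}X)^{\le 0})$ is a co-t-structure, and $\mathbf{K}(\operatorname{Inj}\text{-}X)$ is co-approximable via it. -/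

import Mathlib

universe w u v₁ v₂

open CategoryTheory Limits AlgebraicGeometry Opposite TopologicalSpace ZeroObject Pretriangulated

/-! ### Generation, compact generators and co-t-structures in triangulated categories -/

namespace CoApprox

section

variable {T : Type v₁} [Category.{v₂} T] [HasZeroObject T] [HasShift T ℤ] [Preadditive T]
  [∀ n : ℤ, (shiftFunctor T n).Additive] [Pretriangulated T]

/-- `G[S]`: the objects isomorphic to `Σ^{-i} G` for some `i ∈ S`. -/
def shiftsIn (G : T) (S : Set ℤ) : ObjectProperty T :=
  fun Y => ∃ i ∈ S, Nonempty (Y ≅ G⟦-i⟧)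

/-- `Add(P)`: all (existing) coproducts of `w`-small families of objects of `P`. -/
def bigAdd (P : ObjectProperty T) : ObjectProperty T :=
  fun Y => ∃ I : Type w, P.colimitsOfShape (Discrete I) Y

/-- `Coprod_n(P)`: `Coprod_1(P) = Add(P)` and `Coprod_{n+1}(P) = Coprod_1(P) ⋆ Coprod_n(P)`,
where `A ⋆ C` consists of the objects `B` in a triangle `a → B → c → Σa` with `a ∈ A`, `c ∈ C`.
By convention `Coprod_0(P)` consists of the zero objects. -/
def bigCoprod (P : ObjectProperty T) : ℕ → ObjectProperty T
  | 0 => fun Y => IsZero Y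
  | n + 1 => (bigAdd.{w} P).extensionProductIter n

/-- The closure of `Coprod_n(G[S])` under direct summands; for `S = [a, b]` this is the category
usually written `⟨G⟩̄_n^{[a,b]}`, and for `S = ℤ` it is `⟨G⟩̄_n`. -/
def bigGen (G : T) (S : Set ℤ) (n : ℕ) : ObjectProperty T :=
  (bigCoprod.{w} (shiftsIn G S) n).retractClosure

/-- `G` is compact: `Hom(G, -)` preserves `w`-small coproducts. -/
def IsCompactObj (G : T) : Prop :=
  ∀ I : Type w, PreservesColimitsOfShape (Discrete I) (preadditiveCoyoneda.obj (op G))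

/-- `G` is a compact generator: it is compact, and an object which receives only zero morphisms
from all the shifts of `G` is zero. -/
structure IsCompactGenerator (G : T) : Prop where
  compact : IsCompactObj.{w} G
  isZero (Y : T) (h : ∀ (n : ℤ) (f : G⟦n⟧ ⟶ Y), f = 0) : IsZero Y

/-- `(U, V)` is a co-t-structure (weight structure), with `U = T^{≥ 0}` and `V = T^{≤ 0}`. -/
structure IsCoTStructure (U V : ObjectProperty T) : Prop where
  left_retracts : U.IsStableUnderRetracts
  right_retracts : V.IsStableUnderRetracts
  left_shift (Y : T) : U Y → U (Y⟦(-1 : ℤ)⟧)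
  right_shift (Y : T) : V Y → V (Y⟦(1 : ℤ)⟧)
  hom_eq_zero (Y Z : T) (f : Y ⟶ Z⟦(1 : ℤ)⟧) : U Y → V Z → f = 0
  exists_triangle (Y : T) : ∃ (A B : T) (f : A ⟶ Y) (g : Y ⟶ B⟦(1 : ℤ)⟧)
    (h : B⟦(1 : ℤ)⟧ ⟶ A⟦(1 : ℤ)⟧),
    Triangle.mk f g h ∈ distTriang T ∧ U A ∧ V B

/-- The triangulated category `T` (which is required to have `w`-small coproducts) is
co-approximable by means of the co-t-structure `(U, V)`. -/
structure IsCoapproximableVia (U V : ObjectProperty T) : Prop where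
  hasCoproducts : HasCoproducts.{w} T
  isCoTStructure : IsCoTStructure U V
  exists_generator : ∃ (G : T) (A : ℕ), IsCompactGenerator.{w} G ∧ 0 < A ∧
    U (G⟦-(A : ℤ)⟧) ∧
    (∀ (F : T) (f : G⟦(A : ℤ)⟧ ⟶ F), U F → f = 0) ∧
    (∀ F : T, U F → ∃ (E D : T) (f : E ⟶ F) (g : F ⟶ D) (h : D ⟶ E⟦(1 : ℤ)⟧),
      Triangle.mk f g h ∈ distTriang T ∧ U (D⟦(1 : ℤ)⟧) ∧
        bigGen.{w} G (Set.Icc (-(A : ℤ)) A) A E)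

variable (T) in
/-- `T` is co-approximable. -/
def IsCoapproximable : Prop :=
  ∃ U V : ObjectProperty T, IsCoapproximableVia.{w} U V

end

end CoApprox

/-! ### Quasi-coherent sheaves form an abelian category, and the category `K(Inj-X)` -/

namespace AlgebraicGeometry.Scheme

/-- The quasi-coherent sheaves among all sheaves of `𝒪_X`-modules. -/
def isQCoh (X : Scheme.{u}) : ObjectProperty X.Modules := fun M => M.IsQuasicoherent

lemma isQCoh.of_iso {X : Scheme.{u}} {M N : X.Modules} (e : M ≅ N) (h : X.isQCoh M) : X.isQCoh N :=
  (SheafOfModules.isQuasicoherent X.ringCatSheaf).prop_of_iso e h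

instance (X : Scheme.{u}) : (isQCoh X).IsClosedUnderIsomorphisms where
  of_iso e h := isQCoh.of_iso e h

instance {X Y : Scheme.{u}} (f : X ⟶ Y) [IsOpenImmersion f] :
    PreservesLimits (Modules.restrictFunctor f) := by
  have : PreservesLimits ((Functor.whiskeringLeft X.Opensᵒᵖ (Y.Opens)ᵒᵖ Ab.{u}).obj f.opensFunctor.op) := by
    constructor
    intro J _
    infer_instance
  have : PreservesLimits (Modules.restrictFunctor f ⋙ Modules.toPresheaf X) :=
    comp_preservesLimits (Modules.toPresheaf Y) ((Functor.whiskeringLeft X.Opensᵒᵖ (Y.Opens)ᵒᵖ Ab.{u}).obj f.opensFunctor.op)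
  have : ReflectsLimits (Modules.toPresheaf X) := reflectsLimits_of_reflectsIsomorphisms
  exact preservesLimits_of_reflects_of_preserves _ (Modules.toPresheaf X)

lemma isQCoh_of_affine {X : Scheme.{u}} (M : X.Modules)
    (h : ∀ U : X.Opens, IsAffineOpen U →
      Nonempty (M.restrict U.ι).Presentation) : X.isQCoh M := by
  refine SheafOfModules.QuasicoherentData.isQuasicoherent.{u} (M := M)
    { I := X.affineOpens, X := fun U => U.1, coversTop := ?_, presentation := fun U => ?_ }
  · rw [Opens.coversTop_iff]
    exact iSup_affineOpens_eq_top _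
  · have P := (h U.1 U.2).some
    let E : SheafOfModules (X.ringCatSheaf.over U.1) ≌
      SheafOfModules (U.1 : Scheme.{u}).ringCatSheaf := Modules.overEquiv U.1
    have : PreservesColimitsOfSize.{u, u} E.inverse :=
      E.symm.toAdjunction.leftAdjoint_preservesColimits
    let P' := SheafOfModules.Presentation.map P E.inverse (E.unitIso.app _)
    exact SheafOfModules.Presentation.ofIsIso.{u, u, u} (E.inverse.mapIso ((Modules.overFunctorEquiv U.1).symm.app M) ≪≫ (E.unitIso.app _).symm).hom P'

lemma exists_iso_tilde {R : CommRingCat.{u}} (M : (Spec R).Modules) (hM : (Spec R).isQCoh M) :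
    ∃ A : ModuleCat.{u} R, Nonempty ((tilde.functor R).obj A ≅ M) := by
  have h : (tilde.functor R).essImage M := by
    rw [essImage_tilde]; exact hM
  exact h

lemma isQCoh_cokernel_Spec {R : CommRingCat.{u}} {M N : (Spec R).Modules} (f : M ⟶ N)
    (hM : (Spec R).isQCoh M) (hN : (Spec R).isQCoh N) : (Spec R).isQCoh (cokernel f) := by
  obtain ⟨A, ⟨a⟩⟩ := exists_iso_tilde M hM
  obtain ⟨B, ⟨b⟩⟩ := exists_iso_tilde N hN
  let g := (tilde.functor R).preimage (a.hom ≫ f ≫ b.inv)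
  have hg : (tilde.functor R).map g = a.hom ≫ f ≫ b.inv := Functor.map_preimage _ _
  let iso : cokernel ((tilde.functor R).map g) ≅ cokernel f :=
    cokernel.mapIso _ _ a b (by rw [hg]; simp)
  exact isQCoh.of_iso (PreservesCokernel.iso (tilde.functor R) g ≪≫ iso)
    (inferInstanceAs (tilde (cokernel g)).IsQuasicoherent)

lemma kernel_app_exact {X : Scheme.{u}} {M N : X.Modules} (φ : M ⟶ N) (U : X.Opens) :
    (∀ x : Γ(kernel φ, U), (kernel.ι φ).app U x = 0 → x = 0) ∧
    ∀ y : Γ(M, U), φ.app U y = 0 → ∃ x : Γ(kernel φ, U), (kernel.ι φ).app U x = y := by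
  let F : X.Modules ⥤ Ab.{u} := Modules.toPresheaf X ⋙ (CategoryTheory.evaluation _ _).obj (op U)
  have : F.PreservesZeroMorphisms := ⟨fun _ _ => rfl⟩
  have h1 : PreservesLimits ((CategoryTheory.evaluation X.Opensᵒᵖ Ab.{u}).obj (op U)) :=
    ⟨inferInstance⟩
  have h2 : PreservesLimits F := comp_preservesLimits _ _
  have hl := KernelFork.mapIsLimit _ (kernelIsKernel φ) F
  have hw : F.map (kernel.ι φ) ≫ F.map φ = 0 := by rw [← F.map_comp]; simp
  constructor
  · have hmono : Mono (F.map (kernel.ι φ)) := Fork.IsLimit.mono hl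
    rw [AddCommGrpCat.mono_iff_injective] at hmono
    intro x hx
    exact hmono (hx.trans (map_zero (F.map (kernel.ι φ)).hom).symm)
  · have hex := ShortComplex.exact_of_f_is_kernel (ShortComplex.mk _ _ hw) hl
    rw [ShortComplex.ab_exact_iff] at hex
    exact hex

lemma isQCoh_Spec_iff {R : CommRingCat.{u}} (M : (Spec R).Modules) :
    (Spec R).isQCoh M ↔ ∀ (r : R) (U : (Spec R).Opens), U = PrimeSpectrum.basicOpen r →
      (∀ x : Γ(M, U), ∃ (n : ℕ) (y : Γ(M, ⊤)), r ^ n • x = M.presheaf.map U.leTop.op y) ∧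
      (∀ y : Γ(M, ⊤), M.presheaf.map U.leTop.op y = 0 → ∃ n : ℕ, r ^ n • y = 0) := by
  refine ((isQuasicoherent_iff_isIso_fromTildeΓ M).trans
    (isIso_fromTildeΓ_iff_isLocalizing M)).trans ⟨?_, ?_⟩
  · rintro h r _ rfl
    have h1 : IsLocalizedModule.Away r _ := h r
    refine ⟨h1.surj _ _, fun y hy => ?_⟩
    obtain ⟨⟨_, m, rfl⟩, hm⟩ := (IsLocalizedModule.eq_zero_iff (.powers r)
      ((modulesSpecToSheaf.obj M).obj.map (PrimeSpectrum.basicOpen r).leTop.op).hom).mp hy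
    exact ⟨m, hm⟩
  · intro h r
    refine IsLocalizedModule.Away.mk_of_addCommGroup ?_ (h r _ rfl).1 (h r _ rfl).2
    exact Scheme.Modules.isUnit_algebraMap_end_of_le_basicOpen r le_rfl

lemma isQCoh_kernel_Spec {R : CommRingCat.{u}} {M N : (Spec R).Modules} (φ : M ⟶ N)
    (hM : (Spec R).isQCoh M) (hN : (Spec R).isQCoh N) : (Spec R).isQCoh (kernel φ) := by
  have nat {A B : (Spec R).Modules} (ψ : A ⟶ B) {U V : (Spec R).Opens} (i : U ⟶ V)
      (x : Γ(A, V)) : ψ.app U (A.presheaf.map i.op x) = B.presheaf.map i.op (ψ.app V x) :=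
    congr($(ψ.mapPresheaf.naturality i.op) x)
  have lin {A B : (Spec R).Modules} (ψ : A ⟶ B) (U : (Spec R).Opens) (r : R)
      (x : Γ(A, U)) : ψ.app U (r • x) = r • ψ.app U x := by
    rw [Modules.smul_Spec_def, Modules.smul_Spec_def, Modules.Hom.app_smul]
  rw [isQCoh_Spec_iff] at hM hN ⊢
  intro r U hU
  constructor
  · intro x
    obtain ⟨n, y, hy⟩ := (hM r U hU).1 ((kernel.ι φ).app _ x)
    have hz : N.presheaf.map U.leTop.op (φ.app _ y) = 0 := by
      have : φ.app U ((kernel.ι φ).app _ x) = 0 :=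
        congr(Modules.Hom.app $(kernel.condition φ) U x)
      rw [← nat, ← hy, lin, this, smul_zero]
    obtain ⟨m, hm⟩ := (hN r U hU).2 _ hz
    obtain ⟨z, hz⟩ := (kernel_app_exact φ ⊤).2 (r ^ m • y) (by rw [lin]; exact hm)
    refine ⟨m + n, z, ?_⟩
    rw [← sub_eq_zero]
    apply (kernel_app_exact φ _).1
    rw [map_sub, sub_eq_zero, lin, nat, hz, Modules.map_smul_Spec, pow_add, mul_smul, hy]
  · intro x hx
    have : M.presheaf.map U.leTop.op ((kernel.ι φ).app _ x) = 0 := by rw [← nat, hx, map_zero]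
    obtain ⟨m, hm⟩ := (hM r U hU).2 _ this
    refine ⟨m, (kernel_app_exact φ _).1 _ ?_⟩
    rw [lin]; exact hm


lemma nonempty_presentation_of_iso {X : Scheme.{u}} {M N : X.Modules} (e : M ≅ N)
    (h : Nonempty (SheafOfModules.Presentation M)) : Nonempty (SheafOfModules.Presentation N) := by
  have : IsIso (C := SheafOfModules X.ringCatSheaf) e.hom :=
    ⟨e.inv, e.hom_inv_id, e.inv_hom_id⟩
  exact ⟨SheafOfModules.Presentation.ofIsIso.{u, u, u} e.hom h.some⟩

lemma isQCoh_of_restrict_fromSpec {X : Scheme.{u}} (M : X.Modules)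
    (h : ∀ (U : X.Opens) (hU : IsAffineOpen U),
      (Spec Γ(X, U)).isQCoh ((Modules.restrictFunctor hU.fromSpec).obj M)) : X.isQCoh M := by
  refine isQCoh_of_affine M fun U hU => ?_
  obtain ⟨A, ⟨a⟩⟩ := exists_iso_tilde _ (h U hU)
  have P : (tilde A).Presentation :=
    presentationTilde.{u} A .univ (by simp) _ (Submodule.span_eq _)
  have P' : SheafOfModules.Presentation (M.restrict hU.fromSpec) :=
    (nonempty_presentation_of_iso a ⟨P⟩).some
  have e : (M.restrict hU.fromSpec).restrict hU.isoSpec.hom ≅ M.restrict U.ι :=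
    ((Modules.restrictFunctorComp hU.isoSpec.hom hU.fromSpec).app M).symm ≪≫
      (Modules.restrictFunctorCongr (by simp)).app M
  exact nonempty_presentation_of_iso e ⟨Modules.presentationRestrict hU.isoSpec.hom P'⟩

lemma isQCoh_restrict {X Y : Scheme.{u}} (f : X ⟶ Y) [IsOpenImmersion f] {M : Y.Modules}
    (hM : Y.isQCoh M) : X.isQCoh ((Modules.restrictFunctor f).obj M) :=
  have : M.IsQuasicoherent := hM
  Modules.isQuasicoherent_restrictFunctor f M

instance {X Y : Scheme.{u}} (f : X ⟶ Y) [IsOpenImmersion f] :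
    (Modules.restrictFunctor f).PreservesZeroMorphisms := ⟨fun _ _ => rfl⟩

instance (X : Scheme.{u}) : (isQCoh X).IsClosedUnderKernels where
  kernels_le := by
    rintro _ ⟨φ, k, hk, hφ⟩
    refine isQCoh.of_iso (IsLimit.conePointUniqueUpToIso (kernelIsKernel φ) hk) ?_
    refine isQCoh_of_restrict_fromSpec _ fun U hU => ?_
    exact isQCoh.of_iso (PreservesKernel.iso (Modules.restrictFunctor hU.fromSpec) φ).symm
      (isQCoh_kernel_Spec _ (isQCoh_restrict _ hφ.1) (isQCoh_restrict _ hφ.2))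

instance (X : Scheme.{u}) : (isQCoh X).IsClosedUnderCokernels where
  cokernels_le := by
    rintro _ ⟨φ, k, hk, hφ⟩
    refine isQCoh.of_iso (IsColimit.coconePointUniqueUpToIso (cokernelIsCokernel φ) hk) ?_
    refine isQCoh_of_restrict_fromSpec _ fun U hU => ?_
    exact isQCoh.of_iso (PreservesCokernel.iso (Modules.restrictFunctor hU.fromSpec) φ).symm
      (isQCoh_cokernel_Spec _ (isQCoh_restrict _ hφ.1) (isQCoh_restrict _ hφ.2))

instance (X : Scheme.{u}) : (isQCoh X).ContainsZero where
  exists_zero := by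
    refine ⟨_, isZero_zero X.Modules, isQCoh_of_restrict_fromSpec _ fun U hU => ?_⟩
    have h1 : IsZero ((Modules.restrictFunctor hU.fromSpec).obj (0 : X.Modules)) :=
      Functor.map_isZero _ (isZero_zero _)
    have h2 : IsZero ((tilde.functor Γ(X, U)).obj (0 : ModuleCat _)) :=
      Functor.map_isZero _ (isZero_zero _)
    exact isQCoh.of_iso (h2.iso h1)
      (inferInstanceAs (tilde (0 : ModuleCat Γ(X, U))).IsQuasicoherent)

lemma isQCoh_prod_Spec {R : CommRingCat.{u}} {M N : (Spec R).Modules}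
    (hM : (Spec R).isQCoh M) (hN : (Spec R).isQCoh N) : (Spec R).isQCoh (M ⨯ N) := by
  obtain ⟨A, ⟨a⟩⟩ := exists_iso_tilde M hM
  obtain ⟨B, ⟨b⟩⟩ := exists_iso_tilde N hN
  have := preservesBinaryBiproducts_of_preservesBinaryCoproducts (tilde.functor R)
  have := preservesBinaryProducts_of_preservesBinaryBiproducts (tilde.functor R)
  exact isQCoh.of_iso (PreservesLimitPair.iso (tilde.functor R) A B ≪≫ prod.mapIso a b)
    (inferInstanceAs (tilde (A ⨯ B)).IsQuasicoherent)

instance (X : Scheme.{u}) : (isQCoh X).IsClosedUnderBinaryProducts where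
  limitsOfShape_le := by
    rintro M ⟨p⟩
    let e : p.diag.obj ⟨.left⟩ ⨯ p.diag.obj ⟨.right⟩ ≅ M :=
      HasLimit.isoOfNatIso (diagramIsoPair p.diag).symm ≪≫
        IsLimit.conePointUniqueUpToIso (limit.isLimit _) p.isLimit
    refine isQCoh.of_iso e (isQCoh_of_restrict_fromSpec _ fun U hU => ?_)
    have : PreservesLimitsOfSize.{0, 0} (Modules.restrictFunctor hU.fromSpec) :=
      preservesLimitsOfSize_shrink _
    exact isQCoh.of_iso (PreservesLimitPair.iso (Modules.restrictFunctor hU.fromSpec) _ _).symm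
      (isQCoh_prod_Spec (isQCoh_restrict _ (p.prop_diag_obj _))
        (isQCoh_restrict _ (p.prop_diag_obj _)))

instance (X : Scheme.{u}) : (isQCoh X).IsClosedUnderFiniteProducts := .mk'

/-- The abelian category `Qcoh(X)` of quasi-coherent sheaves on `X`. -/
abbrev QCoh (X : Scheme.{u}) : Type (u + 1) := (isQCoh X).FullSubcategory

/-- `G ∈ D(Qcoh X)` lies in `D^b_coh(X)`: it has bounded cohomology, and all its cohomology sheaves
are coherent. On a locally noetherian scheme, a quasi-coherent sheaf is coherent if and only if it
is of finite type. -/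
def IsBoundedCoherent {X : Scheme.{u}} [HasDerivedCategory.{w} X.QCoh]
    (G : DerivedCategory X.QCoh) : Prop :=
  (∃ a b : ℤ, G.IsGE a ∧ G.IsLE b) ∧
    ∀ n : ℤ, ((DerivedCategory.homologyFunctor X.QCoh n).obj G).obj.IsFiniteType

/-- `K(Inj-X)`: the homotopy category of (unbounded) complexes of injective objects
of `Qcoh(X)`. -/
abbrev KInj (X : Scheme.{u}) : Type (u + 1) :=
  HomotopyCategory (InjectiveObject X.QCoh) (ComplexShape.up ℤ)

/-- `K(Inj-X)^{≥ 0}`: the objects of `K(Inj-X)` isomorphic (that is, homotopy equivalent) to a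
complex of injectives concentrated in degrees `≥ 0`. -/
def kInjGE (X : Scheme.{u}) : ObjectProperty X.KInj :=
  fun K => ∃ L : CochainComplex (InjectiveObject X.QCoh) ℤ, L.IsStrictlyGE 0 ∧
    Nonempty (K ≅ (HomotopyCategory.quotient _ _).obj L)

/-- `K(Inj-X)^{≤ 0}`: the objects of `K(Inj-X)` isomorphic (that is, homotopy equivalent) to a
complex of injectives concentrated in degrees `≤ 0`. -/
def kInjLE (X : Scheme.{u}) : ObjectProperty X.KInj :=
  fun K => ∃ L : CochainComplex (InjectiveObject X.QCoh) ℤ, L.IsStrictlyLE 0 ∧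
    Nonempty (K ≅ (HomotopyCategory.quotient _ _).obj L)

end AlgebraicGeometry.Scheme

/-! The functor from `K(Inj-X)` to `D(Qcoh X)` loses unbounded acyclic complexes, but a bounded
below complex of injectives is K-injective, so morphisms into it are computed in the derived
category (`kInjToD_map_bijective`). Let `H` be an injective resolution of `G`. The plan is to carry
generation by `G` over to `H`, which works as long as everything in sight is uniformly bounded
below.

Uniformity comes from the cohomological boundedness of `G`. Let `M` have cohomology in a fixed
interval and be a summand of an `N`-step extension of coproducts of shifts of `G`. Shifts too far to
the right receive no map from `M`, and shifts too far to the left have no map to `M`. Hence `M` is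
already a summand of such an extension with shifts in an interval that does not depend on `M`
(`exists_Icc_bigGen`). These extensions lift to `K(Inj-X)` (`bigGen_of_bigGen_kInjToD`). For `F` in
degrees `≥ 0`, take for `E` an injective resolution of the zeroth cohomology of `F`: the cone of `E
→ F` is homotopy equivalent to a complex in degrees `≥ 1` (`exists_approximation`), and `E` is built
from a bounded range of shifts of `H`.

For compact generation one needs maps into unbounded complexes `Y`. Brutally truncating `Y` shows
that a bounded below acyclic complex has no nonzero map to `Y`, so maps from an injective resolution
of `P` to `Y` are homotopy classes of maps `P → Y` (`precomp_bijective`). For `P` a coherent sheaf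
in one degree, such a map is a map of sheaves into one term of `Y`, hence meets finitely many
summands of a coproduct; dévissage then gives compactness of `H`. For `P` a sheaf of cycles of `Y`,
vanishing of these maps produces a contraction of `Y`, and resolutions of arbitrary sheaves are
generated by `H`.

The co-t-structure is given by brutal truncation. Closure under retracts follows from a description
by orthogonality, proved by splitting an explicit null-homotopic idempotent. The geometric input is
that `Qcoh X` has enough injectives and exact coproducts, that its injectives are stable under
coproducts, and that finite type sheaves map to finite subsums; it is obtained from finite affine
covers and the adjunction between sections over an affine open and direct image. -/

namespace CoApprox

/-! ### Morphisms to coproducts with finite support -/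

section FiniteSupport

variable {C : Type v₁} [Category.{v₂} C] [Preadditive C]

/-- The projection of a coproduct onto one of its summands. -/
noncomputable def cofanProj {I : Type*} {Y : I → C} {c : Cofan Y} (hc : IsColimit c) (i : I) :
    c.pt ⟶ Y i :=
  open Classical in
  Cofan.IsColimit.desc hc (fun j => if h : j = i then eqToHom (by rw [h]) else 0)

@[simp]
lemma inj_cofanProj {I : Type*} {Y : I → C} {c : Cofan Y} (hc : IsColimit c) (i : I) :
    c.inj i ≫ cofanProj hc i = 𝟙 _ := by
  simp [cofanProj]

lemma inj_cofanProj_of_ne {I : Type*} {Y : I → C} {c : Cofan Y} (hc : IsColimit c) {i j : I}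
    (h : j ≠ i) : c.inj j ≫ cofanProj hc i = 0 := by
  simp [cofanProj, h]

/-- The idempotent endomorphism of a coproduct which projects onto finitely many summands. -/
noncomputable def cofanTrunc {I : Type*} {Y : I → C} {c : Cofan Y} (hc : IsColimit c)
    (S : Finset I) : c.pt ⟶ c.pt :=
  ∑ i ∈ S, cofanProj hc i ≫ c.inj i

lemma inj_cofanTrunc_of_mem {I : Type*} {Y : I → C} {c : Cofan Y} (hc : IsColimit c)
    {S : Finset I} {i : I} (hi : i ∈ S) : c.inj i ≫ cofanTrunc hc S = c.inj i := by
  rw [cofanTrunc, Preadditive.comp_sum, Finset.sum_eq_single i]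
  · rw [← Category.assoc, inj_cofanProj, Category.id_comp]
  · intro j _ hj
    rw [← Category.assoc, inj_cofanProj_of_ne hc hj.symm, zero_comp]
  · exact fun h => (h hi).elim

lemma cofanTrunc_comp_of_subset {I : Type*} {Y : I → C} {c : Cofan Y} (hc : IsColimit c)
    {S S' : Finset I} (h : S ⊆ S') : cofanTrunc hc S ≫ cofanTrunc hc S' = cofanTrunc hc S := by
  rw [cofanTrunc, Preadditive.sum_comp]
  refine Finset.sum_congr rfl fun i hi => ?_
  rw [Category.assoc, inj_cofanTrunc_of_mem hc (h hi)]

lemma cofanTrunc_proj_of_notMem {I : Type*} {Y : I → C} {c : Cofan Y} (hc : IsColimit c)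
    {S : Finset I} {i : I} (hi : i ∉ S) : cofanTrunc hc S ≫ cofanProj hc i = 0 := by
  rw [cofanTrunc, Preadditive.sum_comp]
  refine Finset.sum_eq_zero fun j hj => ?_
  rw [Category.assoc, inj_cofanProj_of_ne hc (ne_of_mem_of_not_mem hj hi), comp_zero]

lemma comp_cofanTrunc_of_subset {I : Type*} {Y : I → C} {c : Cofan Y} (hc : IsColimit c)
    {G : C} {f : G ⟶ c.pt} {S S' : Finset I} (h : S ⊆ S') (hf : f ≫ cofanTrunc hc S = f) :
    f ≫ cofanTrunc hc S' = f := by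
  rw [← hf, Category.assoc, cofanTrunc_comp_of_subset hc h]

/-- Every morphism from `G` to a coproduct of a `w`-small family factors through finitely many
summands. -/
def IsFinitelySupported (G : C) : Prop :=
  ∀ (I : Type w) (Y : I → C) (c : Cofan Y) (hc : IsColimit c) (f : G ⟶ c.pt),
    ∃ S : Finset I, f ≫ cofanTrunc hc S = f

lemma IsFinitelySupported.of_retract {G G' : C} (h : IsFinitelySupported.{w} G)
    (r : Retract G' G) : IsFinitelySupported.{w} G' := by
  intro I Y c hc f
  obtain ⟨S, hS⟩ := h I Y c hc (r.r ≫ f)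
  refine ⟨S, ?_⟩
  rw [← cancel_epi r.r, ← Category.assoc, hS]

lemma IsFinitelySupported.of_iso {G G' : C} (h : IsFinitelySupported.{w} G)
    (e : G ≅ G') : IsFinitelySupported.{w} G' :=
  h.of_retract ⟨e.inv, e.hom, by simp⟩

lemma IsFinitelySupported.of_isZero {G : C} (h : IsZero G) : IsFinitelySupported.{w} G :=
  fun _ _ _ _ _ => ⟨∅, h.eq_of_src _ _⟩

/-- This is the universal property of the direct sum of the groups `Hom(G, Y i)`: the map is `f ↦ ∑
φ i (f ≫ proj i)`, a finite sum because `f` has finite support. -/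
lemma IsFinitelySupported.exists_unique_addMonoidHom {G : C} (h : IsFinitelySupported.{w} G)
    {I : Type w} {Y : I → C} {c : Cofan Y} (hc : IsColimit c) {A : Type*} [AddCommGroup A]
    (φ : ∀ i, (G ⟶ Y i) →+ A) :
    ∃ ψ : (G ⟶ c.pt) →+ A, (∀ i g, ψ (g ≫ c.inj i) = φ i g) ∧
      ∀ ψ' : (G ⟶ c.pt) →+ A, (∀ i g, ψ' (g ≫ c.inj i) = φ i g) → ψ' = ψ := by
  have hsub {f : G ⟶ c.pt} {S : Finset I} (hS : f ≫ cofanTrunc hc S = f) :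
      (Function.support fun i => φ i (f ≫ cofanProj hc i)) ⊆ S := by
    intro i hi
    by_contra hiS
    refine hi ?_
    change φ i (f ≫ cofanProj hc i) = 0
    rw [← hS, Category.assoc, cofanTrunc_proj_of_notMem hc hiS, comp_zero, map_zero]
  have hfin (f : G ⟶ c.pt) : (Function.support fun i => φ i (f ≫ cofanProj hc i)).Finite := by
    obtain ⟨S, hS⟩ := h I Y c hc f
    exact S.finite_toSet.subset (hsub hS)
  refine ⟨{ toFun f := ∑ᶠ i, φ i (f ≫ cofanProj hc i)
            map_zero' := by simp
            map_add' f g := ?_ }, fun i g => ?_, fun ψ' hψ' => ?_⟩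
  · rw [← finsum_add_distrib (hfin f) (hfin g)]
    simp
  · change ∑ᶠ j, φ j ((g ≫ c.inj i) ≫ cofanProj hc j) = φ i g
    rw [finsum_eq_single _ i]
    · rw [Category.assoc, inj_cofanProj]; exact congrArg _ (Category.comp_id g)
    · intro j hj
      rw [Category.assoc, inj_cofanProj_of_ne hc hj.symm, comp_zero, map_zero]
  · ext f
    change ψ' f = ∑ᶠ i, φ i (f ≫ cofanProj hc i)
    obtain ⟨S, hS⟩ := h I Y c hc f
    rw [finsum_eq_sum_of_support_subset _ (hsub hS)]
    conv_lhs => rw [← hS]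
    rw [cofanTrunc, Preadditive.comp_sum, map_sum]
    refine Finset.sum_congr rfl fun i _ => ?_
    rw [← hψ', Category.assoc]

end FiniteSupport

section

variable {T : Type v₁} [Category.{v₂} T] [HasZeroObject T] [HasShift T ℤ] [Preadditive T]
  [∀ n : ℤ, (shiftFunctor T n).Additive] [Pretriangulated T]

/-- Once `S` supports the restriction of `f` to the first vertex, the remainder of `f` outside `S`
factors through the third vertex, where a second finite set supports it. The union of the two sets
supports `f`. -/
lemma IsFinitelySupported.of_distTriang (τ : Triangle T) (hτ : τ ∈ distTriang T)
    (h₁ : IsFinitelySupported.{w} τ.obj₁) (h₃ : IsFinitelySupported.{w} τ.obj₃) :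
    IsFinitelySupported.{w} τ.obj₂ := by
  classical
  intro I Y c hc f
  obtain ⟨S, hS⟩ := h₁ I Y c hc (τ.mor₁ ≫ f)
  obtain ⟨g, hg⟩ := Triangle.yoneda_exact₂ τ hτ (f - f ≫ cofanTrunc hc S) (by
    rw [Preadditive.comp_sub, ← Category.assoc, hS, sub_self])
  obtain ⟨S', hS'⟩ := h₃ I Y c hc g
  refine ⟨S ∪ S', ?_⟩
  have hf : f = f ≫ cofanTrunc hc S + τ.mor₂ ≫ g := by rw [← hg]; abel
  have e₁ : (f ≫ cofanTrunc hc S) ≫ cofanTrunc hc (S ∪ S') = f ≫ cofanTrunc hc S := by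
    rw [Category.assoc, cofanTrunc_comp_of_subset hc Finset.subset_union_left]
  have e₂ : (τ.mor₂ ≫ g) ≫ cofanTrunc hc (S ∪ S') = τ.mor₂ ≫ g := by
    rw [Category.assoc, comp_cofanTrunc_of_subset hc Finset.subset_union_right hS']
  nth_rw 1 [hf]
  rw [Preadditive.add_comp, e₁, e₂, ← hf]

/-- A finitely supported object is compact. -/
lemma IsFinitelySupported.isCompactObj {G : T} (h : IsFinitelySupported.{w} G) :
    IsCompactObj.{w} G := by
  intro I
  refine ⟨fun {F} => ⟨fun {c} hc => ?_⟩⟩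
  let c' : Cofan (fun i => F.obj ⟨i⟩) := Cofan.mk c.pt (fun i => c.ι.app ⟨i⟩)
  have hc' : IsColimit c' := by
    refine Cofan.IsColimit.mk _ (fun s => hc.desc ⟨s.pt, Discrete.natTrans fun i => s.inj i.as⟩)
      (fun s j => hc.fac _ _) (fun s m hm => hc.hom_ext fun j => ?_)
    rw [hc.fac]
    exact hm j.as
  let φ (s : Cocone (F ⋙ preadditiveCoyoneda.obj (op G))) (i : I) : (G ⟶ F.obj ⟨i⟩) →+ s.pt :=
    (s.ι.app ⟨i⟩).hom
  choose ψ hψ hψ' using fun s => h.exists_unique_addMonoidHom hc' (φ s)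
  refine ⟨{ desc s := AddCommGrpCat.ofHom (Y := s.pt) (ψ s)
            fac s j := ?_
            uniq s m hm := ?_ }⟩
  · ext f
    exact hψ s j.as f
  · ext f
    exact congr($(hψ' s m.hom fun i g => congr($(hm ⟨i⟩) g)) f)

end

end CoApprox

namespace CoApprox

open Triangulated

section

variable {T : Type v₁} [Category.{v₂} T] [HasZeroObject T] [HasShift T ℤ] [Preadditive T]
  [∀ n : ℤ, (shiftFunctor T n).Additive] [Pretriangulated T]

/-! ### Coproducts of shifts of an object -/

lemma bigAdd_of_isColimit {P : ObjectProperty T} {I : Type w} {Y : I → T} {c : Cofan Y}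
    (hc : IsColimit c) (hY : ∀ i, P (Y i)) : bigAdd.{w} P c.pt :=
  ⟨I, ⟨{ diag := Discrete.functor Y, ι := c.ι, isColimit := hc, prop_diag_obj := fun i => hY i.as }⟩⟩

/-- Zero is the empty coproduct; it allows an iterated extension to be padded by trivial steps, so
that `n` may be enlarged. -/
instance (P : ObjectProperty T) : (bigAdd.{w} P).ContainsZero where
  exists_zero :=
    ⟨0, isZero_zero T, bigAdd_of_isColimit (I := PEmpty) (Y := fun _ => 0)
      (c := Cofan.mk 0 fun _ => 0) (Cofan.IsColimit.mk _ (fun _ => 0) (fun _ j => j.elim)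
        fun _ _ _ => (isZero_zero T).eq_of_src _ _) fun i => i.elim⟩

lemma exists_cofan_of_bigAdd {G : T} {S : Set ℤ} {B : T} (h : bigAdd.{w} (shiftsIn G S) B) :
    ∃ (I : Type w) (n : I → ℤ) (_ : ∀ i, n i ∈ S) (ι : ∀ i, G⟦-n i⟧ ⟶ B),
      Nonempty (IsColimit (Cofan.mk B ι)) := by
  obtain ⟨I, ⟨p⟩⟩ := h
  choose n hn e using fun i : I => p.prop_diag_obj ⟨i⟩
  let e' (i : I) := (e i).some
  refine ⟨I, n, hn, fun i => (e' i).inv ≫ p.ι.app ⟨i⟩, ⟨?_⟩⟩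
  refine Cofan.IsColimit.mk _
    (fun s => p.isColimit.desc ⟨s.pt, Discrete.natTrans fun i => (e' i.as).hom ≫ s.inj i.as⟩)
    (fun s j => ?_) (fun s m hm => p.isColimit.hom_ext fun j => ?_)
  · have := p.isColimit.fac ⟨s.pt, Discrete.natTrans fun i => (e' i.as).hom ≫ s.inj i.as⟩ ⟨j⟩
    simp [this]
  · rw [p.isColimit.fac]
    have := hm j.as
    simp [← this]

lemma shiftsIn_mono (G : T) {S S' : Set ℤ} (h : S ⊆ S') : shiftsIn G S ≤ shiftsIn G S' :=
  fun _ ⟨i, hi, e⟩ => ⟨i, h hi, e⟩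

lemma bigAdd_mono {P Q : ObjectProperty T} (h : P ≤ Q) : bigAdd.{w} P ≤ bigAdd.{w} Q :=
  fun _ ⟨I, hI⟩ => ⟨I, ObjectProperty.colimitsOfShape_monotone _ h _ hI⟩

lemma bigGen_mono (G : T) {S S' : Set ℤ} (h : S ⊆ S') {n m : ℕ} (hn : 0 < n) (hnm : n ≤ m) :
    bigGen.{w} G S n ≤ bigGen.{w} G S' m := by
  obtain ⟨n, rfl⟩ := Nat.exists_eq_succ_of_ne_zero hn.ne'
  obtain ⟨m, rfl⟩ := Nat.exists_eq_succ_of_ne_zero (hn.trans_le hnm).ne'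
  refine ObjectProperty.monotone_retractClosure ?_
  exact (ObjectProperty.monotone_extensionProductIter (bigAdd_mono (shiftsIn_mono G h)) n).trans
    (ObjectProperty.monotone'_extensionProductIter _ (by omega))

/-- A coproduct of shifts of `G` is the direct sum of the part with shifts in a given set and
of the part with the other shifts. -/
lemma exists_splitting_of_bigAdd [HasCoproducts.{w} T] {G : T} {S : Set ℤ} (S' : Set ℤ) {B : T}
    (h : bigAdd.{w} (shiftsIn G S) B) :
    ∃ (B₁ B₂ : T) (i₁ : B₁ ⟶ B) (p₁ : B ⟶ B₁) (i₂ : B₂ ⟶ B) (p₂ : B ⟶ B₂),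
      bigAdd.{w} (shiftsIn G (S ∩ S')) B₁ ∧ bigAdd.{w} (shiftsIn G (S \ S')) B₂ ∧
      i₁ ≫ p₁ = 𝟙 _ ∧ i₂ ≫ p₂ = 𝟙 _ ∧ p₁ ≫ i₁ + p₂ ≫ i₂ = 𝟙 _ := by
  classical
  obtain ⟨I, n, hn, ι, ⟨hι⟩⟩ := exists_cofan_of_bigAdd h
  -- Inclusion and projection of the subsum indexed by `Q`. The idempotents for `n x ∈ S'` and for
  -- its negation add up to the identity.
  have key (Q : I → Prop) : ∃ (i : (∐ fun x : {x // Q x} => G⟦-n x⟧) ⟶ B)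
      (p : B ⟶ ∐ fun x : {x // Q x} => G⟦-n x⟧), i ≫ p = 𝟙 _ ∧
        (∀ x, Q x → ι x ≫ p ≫ i = ι x) ∧ (∀ x, ¬ Q x → ι x ≫ p ≫ i = 0) := by
    let p : B ⟶ ∐ fun x : {x // Q x} => G⟦-n x⟧ := Cofan.IsColimit.desc hι
      (fun x => if hx : Q x then Sigma.ι (fun x : {x // Q x} => G⟦-n x⟧) ⟨x, hx⟩ else 0)
    have hp (x : I) : ι x ≫ p = if hx : Q x then
        Sigma.ι (fun x : {x // Q x} => G⟦-n x⟧) ⟨x, hx⟩ else 0 := Cofan.IsColimit.fac hι _ x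
    refine ⟨Sigma.desc fun x => ι x, p, ?_, fun x hx => ?_, fun x hx => ?_⟩
    · refine Sigma.hom_ext _ _ fun ⟨x, hx⟩ => ?_
      rw [Sigma.ι_desc_assoc, hp, dif_pos hx, Category.comp_id]
    · rw [← Category.assoc, hp, dif_pos hx, Sigma.ι_desc]
    · rw [← Category.assoc, hp, dif_neg hx, zero_comp]
  obtain ⟨i₁, p₁, h₁, h₁', h₁''⟩ := key (fun x => n x ∈ S')
  obtain ⟨i₂, p₂, h₂, h₂', h₂''⟩ := key (fun x => n x ∉ S')
  refine ⟨_, _, i₁, p₁, i₂, p₂,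
    bigAdd_of_isColimit (coproductIsCoproduct _) fun x => ⟨_, ⟨hn _, x.2⟩, ⟨Iso.refl _⟩⟩,
    bigAdd_of_isColimit (coproductIsCoproduct _) fun x => ⟨_, ⟨hn _, x.2⟩, ⟨Iso.refl _⟩⟩,
    h₁, h₂, Cofan.IsColimit.hom_ext hι _ _ fun x => ?_⟩
  change ι x ≫ _ = ι x ≫ _
  rw [Preadditive.comp_add, Category.comp_id]
  by_cases hx : n x ∈ S'
  · rw [h₁' x hx, h₂'' x (not_not.2 hx), add_zero]
  · rw [h₁'' x hx, h₂' x hx, zero_add]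

/-! ### Truncating the set of shifts by means of a t-structure -/

variable (t : TStructure T)

/-- The coproducts of `≥ n` objects are `≥ n`. -/
def CoproductStableGE : Prop :=
  ∀ (n : ℤ) ⦃I : Type w⦄ ⦃Y : I → T⦄ ⦃c : Cofan Y⦄ (_ : IsColimit c)
    (_ : ∀ i, t.IsGE (Y i) n), t.IsGE c.pt n

variable {t} {G : T} {a b : ℤ}

/-- Being `≤ n` is a left orthogonality condition, hence automatically stable under coproducts; the
`≥ n` side has to be assumed. -/
lemma isLE_of_isColimit {n : ℤ} {I : Type w} {Y : I → T} {c : Cofan Y} (hc : IsColimit c)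
    (hY : ∀ i, t.IsLE (Y i) n) : t.IsLE c.pt n := by
  rw [t.isLE_iff_orthogonal n (n + 1) rfl]
  intro Z f hZ
  refine Cofan.IsColimit.hom_ext hc _ _ fun i => ?_
  have := hY i
  rw [t.zero (c.inj i ≫ f) n (n + 1), comp_zero]

lemma isLE_of_extensionProductIter (hb : t.IsLE G b) {S : Set ℤ} {k : ℤ} (hS : ∀ i ∈ S, i ≤ k)
    (n : ℕ) {B : T} (hB : (bigAdd.{w} (shiftsIn G S)).extensionProductIter n B) :
    t.IsLE B (b + k) := by
  have h₀ {B : T} (hB : bigAdd.{w} (shiftsIn G S) B) : t.IsLE B (b + k) := by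
    obtain ⟨I, m, hm, ι, ⟨hι⟩⟩ := exists_cofan_of_bigAdd hB
    refine isLE_of_isColimit hι fun i => ?_
    have := t.isLE_shift G b (-m i) (b + m i)
    exact t.isLE_of_le _ (b + m i) _ (by have := hS _ (hm i); lia)
  induction n generalizing B with
  | zero => exact h₀ hB
  | succ n ih =>
    rw [ObjectProperty.extensionProductIter_succ] at hB
    obtain ⟨A, C, f, g, h, hτ, hA, hC⟩ := hB
    exact t.isLE₂ _ hτ _ (h₀ hA) (ih hC)

lemma isGE_of_extensionProductIter (ht : CoproductStableGE.{w} t) (ha : t.IsGE G a)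
    {S : Set ℤ} {k : ℤ} (hS : ∀ i ∈ S, k ≤ i)
    (n : ℕ) {B : T} (hB : (bigAdd.{w} (shiftsIn G S)).extensionProductIter n B) :
    t.IsGE B (a + k) := by
  have h₀ {B : T} (hB : bigAdd.{w} (shiftsIn G S) B) : t.IsGE B (a + k) := by
    obtain ⟨I, m, hm, ι, ⟨hι⟩⟩ := exists_cofan_of_bigAdd hB
    refine ht (a + k) hι fun i => ?_
    have := t.isGE_shift G a (-m i) (a + m i)
    exact t.isGE_of_ge _ _ (a + m i) (by have := hS _ (hm i); lia)
  induction n generalizing B with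
  | zero => exact h₀ hB
  | succ n ih =>
    rw [ObjectProperty.extensionProductIter_succ] at hB
    obtain ⟨A, C, f, g, h, hτ, hA, hC⟩ := hB
    exact t.isGE₂ _ hτ _ (h₀ hA) (ih hC)

/-- A morphism from an object `≤ m` to an iterated extension of coproducts of shifts of `G`
factors through such an extension which involves only shifts `Σ^{-i} G` with `i ≤ k`. -/
lemma exists_factorization_of_isLE [HasCoproducts.{w} T] (ht : CoproductStableGE.{w} t)
    (ha : t.IsGE G a) (hb : t.IsLE G b) (n : ℕ) (m : ℤ) :
    ∃ k : ℤ, ∀ (S : Set ℤ) (B : T) (_ : (bigAdd.{w} (shiftsIn G S)).extensionProductIter n B)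
      (M : T) (_ : t.IsLE M m) (f : M ⟶ B), ∃ (B' : T) (l : M ⟶ B') (v : B' ⟶ B),
        (bigAdd.{w} (shiftsIn G (S ∩ Set.Iic k))).extensionProductIter n B' ∧ l ≫ v = f := by
  have hdiff (S : Set ℤ) (k : ℤ) {A : T} (hA : bigAdd.{w} (shiftsIn G (S \ Set.Iic k)) A) :
      t.IsGE A (a + (k + 1)) :=
    isGE_of_extensionProductIter ht ha (fun i hi => by simpa using hi.2) 0 hA
  induction n with
  | zero =>
    -- A shift with `i > m - a` is `≥ m + 1`, so it receives no map from an object `≤ m`.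
    refine ⟨m - a, fun S B hB M hM f => ?_⟩
    obtain ⟨B₁, B₂, i₁, p₁, i₂, p₂, h₁, h₂, -, -, e⟩ :=
      exists_splitting_of_bigAdd (Set.Iic (m - a)) hB
    refine ⟨B₁, f ≫ p₁, i₁, h₁, ?_⟩
    have := hdiff _ _ h₂
    have hz : f ≫ p₂ = 0 := t.zero _ m (a + (m - a + 1))
    have := f ≫= e
    rw [Preadditive.comp_add, reassoc_of% hz, zero_comp, add_zero, Category.comp_id] at this
    rw [Category.assoc, this]
  | succ n ih =>
    obtain ⟨k₁, hk₁⟩ := ih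
    -- The three bounds keep the shifts used for `C'`, kill the maps from `M` to the discarded part
    -- `A₂` of `A`, and kill the maps from `C'` (which is `≤ b + k₁`) to `A₂⟦1⟧` (which is `≥ a +
    -- k`).
    let k := max k₁ (max (m - a) (b + k₁ - a + 1))
    have hkk : k₁ ≤ k := le_max_left _ _
    have hk₂ : m - a ≤ k := (le_max_left _ _).trans (le_max_right _ _)
    have hk₃ : b + k₁ - a + 1 ≤ k := (le_max_right _ _).trans (le_max_right _ _)
    refine ⟨k, fun S B hB M hM f => ?_⟩
    rw [ObjectProperty.extensionProductIter_succ] at hB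
    obtain ⟨A, C, α, β, h, hτ, hA, hC⟩ := hB
    obtain ⟨C', f', u, hC', hu⟩ := hk₁ S C hC M hM (f ≫ β)
    have hC'LE : t.IsLE C' (b + k₁) := isLE_of_extensionProductIter hb (fun i hi => hi.2) n hC'
    obtain ⟨A₁, A₂, i₁, p₁, i₂, p₂, h₁, h₂, -, -, e⟩ := exists_splitting_of_bigAdd (Set.Iic k) hA
    have hA₂ := hdiff _ _ h₂
    have hA₂' : t.IsGE (A₂⟦(1 : ℤ)⟧) (a + k) := t.isGE_shift A₂ (a + (k + 1)) 1 (a + k)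
    -- The restriction to `C'` of the connecting map has no component in `A₂⟦1⟧`, so it is the
    -- connecting map of an extension `B'` of `C'` by `A₁` which maps to `B`.
    let h' : C' ⟶ A₁⟦(1 : ℤ)⟧ := u ≫ h ≫ p₁⟦1⟧'
    have hh' : u ≫ h = h' ≫ i₁⟦1⟧' := by
      have hz : (u ≫ h) ≫ p₂⟦(1 : ℤ)⟧' = 0 := t.zero _ (b + k₁) (a + k)
      have := (u ≫ h) ≫= ((shiftFunctor T (1 : ℤ)).congr_map e)
      rw [Functor.map_add, Functor.map_comp, Functor.map_comp, Preadditive.comp_add,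
        ← Category.assoc _ (p₂⟦(1 : ℤ)⟧'), hz, zero_comp, add_zero, CategoryTheory.Functor.map_id, Category.comp_id] at this
      simpa [h'] using this.symm
    obtain ⟨B', α', β', hτ'⟩ := distinguished_cocone_triangle₂ h'
    obtain ⟨v, hv₁, hv₂⟩ : ∃ v : B' ⟶ B, α' ≫ v = i₁ ≫ α ∧ β' ≫ u = v ≫ β :=
      complete_distinguished_triangle_morphism₂ _ _ hτ' hτ i₁ u hh'.symm
    obtain ⟨l, hl⟩ : ∃ l : M ⟶ B', f' = l ≫ β' := Triangle.coyoneda_exact₃ _ hτ' f' (by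
      have hz : β ≫ h = 0 := comp_distTriang_mor_zero₂₃ _ hτ
      change f' ≫ u ≫ h ≫ p₁⟦1⟧' = 0
      rw [reassoc_of% hu, reassoc_of% hz, zero_comp, comp_zero])
    -- The lift `l` is only correct modulo `A`. The error `d` has no component in `A₂`, so it can be
    -- absorbed into `B'` through `A₁`.
    obtain ⟨d, hd⟩ : ∃ d : M ⟶ A, f - l ≫ v = d ≫ α :=
        Triangle.coyoneda_exact₂ _ hτ (f - l ≫ v) (by
      change (f - l ≫ v) ≫ β = 0
      rw [Preadditive.sub_comp, Category.assoc, ← hv₂, ← Category.assoc, ← hl, hu, sub_self])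
    have hd' : d = d ≫ p₁ ≫ i₁ := by
      have hz : d ≫ p₂ = 0 := t.zero _ m (a + (k + 1))
      have := d ≫= e
      rw [Preadditive.comp_add, reassoc_of% hz, zero_comp, add_zero, Category.comp_id] at this
      exact this.symm
    refine ⟨B', l + d ≫ p₁ ≫ α', v, ?_, ?_⟩
    · rw [ObjectProperty.extensionProductIter_succ]
      refine ⟨_, _, _, _, _, hτ', h₁, ?_⟩
      exact ObjectProperty.monotone_extensionProductIter (bigAdd_mono (shiftsIn_mono G
        (Set.inter_subset_inter_right _ (Set.Iic_subset_Iic.2 hkk)))) n _ hC'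
    · rw [Preadditive.add_comp, Category.assoc, Category.assoc, hv₁,
        ← Category.assoc p₁, ← Category.assoc d, ← hd', ← hd]
      abel

/-- A morphism from an iterated extension of coproducts of shifts of `G` to an object `≥ m`
factors through such an extension which involves only shifts `Σ^{-i} G` with `k ≤ i`. -/
lemma exists_factorization_of_isGE [IsTriangulated T] [HasCoproducts.{w} T]
    (ht : CoproductStableGE.{w} t)
    (ha : t.IsGE G a) (hb : t.IsLE G b) (n : ℕ) (m : ℤ) :
    ∃ k : ℤ, ∀ (S : Set ℤ) (B : T) (_ : (bigAdd.{w} (shiftsIn G S)).extensionProductIter n B)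
      (M : T) (_ : t.IsGE M m) (f : B ⟶ M), ∃ (B' : T) (v : B ⟶ B') (l : B' ⟶ M),
        (bigAdd.{w} (shiftsIn G (S ∩ Set.Ici k))).extensionProductIter n B' ∧ v ≫ l = f := by
  have hdiff (S : Set ℤ) (k : ℤ) {A : T} (hA : bigAdd.{w} (shiftsIn G (S \ Set.Ici k)) A) :
      t.IsLE A (b + (k - 1)) :=
    isLE_of_extensionProductIter hb (fun i hi => by
      have := hi.2
      simp only [Set.mem_Ici, not_le] at this
      lia) 0 hA
  induction n with
  | zero =>
    refine ⟨m - b, fun S B hB M hM f => ?_⟩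
    obtain ⟨B₁, B₂, i₁, p₁, i₂, p₂, h₁, h₂, -, -, e⟩ :=
      exists_splitting_of_bigAdd (Set.Ici (m - b)) hB
    refine ⟨B₁, p₁, i₁ ≫ f, h₁, ?_⟩
    have := hdiff _ _ h₂
    have hz : i₂ ≫ f = 0 := t.zero _ (b + (m - b - 1)) m
    have := e =≫ f
    rw [Preadditive.add_comp, Category.assoc, Category.assoc, hz, comp_zero, add_zero,
      Category.id_comp] at this
    exact this
  | succ n ih =>
    obtain ⟨k₁, hk₁⟩ := ih
    -- Here `C₂` is `≤ b + k - 1`; the last two bounds kill its maps to `M` and to `A'⟦1⟧`, which is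
    -- `≥ a + k₁ - 1`.
    let k := min k₁ (min (m - b) (a + k₁ - b - 1))
    have hkk : k ≤ k₁ := min_le_left _ _
    have hk₂ : k ≤ m - b := (min_le_right _ _).trans (min_le_left _ _)
    have hk₃ : k ≤ a + k₁ - b - 1 := (min_le_right _ _).trans (min_le_right _ _)
    refine ⟨k, fun S B hB M hM f => ?_⟩
    -- The single coproduct must now be the quotient of the extension, not the subobject. This
    -- rebracketing rests on the octahedral axiom.
    rw [ObjectProperty.extensionProductIter_succ'] at hB
    obtain ⟨A, C, α, β, h, hτ, hA, hC⟩ := hB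
    obtain ⟨A', u, f', hA', hu⟩ := hk₁ S A hA M hM (α ≫ f)
    have hA'GE : t.IsGE A' (a + k₁) :=
      isGE_of_extensionProductIter ht ha (fun i hi => hi.2) n hA'
    have hA'GE' : t.IsGE (A'⟦(1 : ℤ)⟧) (a + k₁ - 1) := t.isGE_shift A' (a + k₁) 1 (a + k₁ - 1)
    obtain ⟨C₁, C₂, i₁, p₁, i₂, p₂, h₁, h₂, -, -, e⟩ := exists_splitting_of_bigAdd (Set.Ici k) hC
    have hC₂ := hdiff _ _ h₂
    let h' : C₁ ⟶ A'⟦(1 : ℤ)⟧ := i₁ ≫ h ≫ u⟦1⟧'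
    have hh' : h ≫ u⟦1⟧' = p₁ ≫ h' := by
      have hz : i₂ ≫ h ≫ u⟦(1 : ℤ)⟧' = 0 := t.zero _ (b + (k - 1)) (a + k₁ - 1)
      have := e =≫ (h ≫ u⟦(1 : ℤ)⟧')
      rw [Preadditive.add_comp, Category.assoc, Category.assoc, hz, comp_zero, add_zero,
        Category.id_comp] at this
      exact this.symm
    obtain ⟨B', α', β', hτ'⟩ := distinguished_cocone_triangle₂ h'
    obtain ⟨v, hv₁, hv₂⟩ : ∃ v : B ⟶ B', α ≫ v = u ≫ α' ∧ β ≫ p₁ = v ≫ β' :=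
      complete_distinguished_triangle_morphism₂ _ _ hτ hτ' u p₁ hh'
    -- Mapping to the contractible triangle `M → M → 0` extends `f'` along `α'`; the obstruction `h'
    -- ≫ f'⟦1⟧'` vanishes because `h ≫ α⟦1⟧'` does.
    obtain ⟨l, hl, -⟩ : ∃ l : B' ⟶ M, α' ≫ l = f' ≫ 𝟙 M ∧ β' ≫ 0 = l ≫ (0 : M ⟶ 0) :=
      complete_distinguished_triangle_morphism₂ _ _ hτ'
      (contractible_distinguished M) f' 0 (by
        have hz : h ≫ α⟦(1 : ℤ)⟧' = 0 := comp_distTriang_mor_zero₃₁ _ hτ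
        change h' ≫ f'⟦1⟧' = 0 ≫ 0
        rw [zero_comp, Category.assoc, Category.assoc, ← Functor.map_comp, hu, Functor.map_comp,
          reassoc_of% hz, zero_comp, comp_zero])
    rw [Category.comp_id] at hl
    obtain ⟨d, hd⟩ : ∃ d : C ⟶ M, f - v ≫ l = β ≫ d :=
        Triangle.yoneda_exact₂ _ hτ (f - v ≫ l) (by
      change α ≫ (f - v ≫ l) = 0
      rw [Preadditive.comp_sub, ← Category.assoc α, hv₁, Category.assoc, hl, hu, sub_self])
    have hd' : d = p₁ ≫ i₁ ≫ d := by
      have hz : i₂ ≫ d = 0 := t.zero _ (b + (k - 1)) m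
      have := e =≫ d
      rw [Preadditive.add_comp, Category.assoc, Category.assoc, hz, comp_zero, add_zero,
        Category.id_comp] at this
      exact this.symm
    refine ⟨B', v, l + β' ≫ i₁ ≫ d, ?_, ?_⟩
    · rw [ObjectProperty.extensionProductIter_succ']
      refine ⟨_, _, _, _, _, hτ', ?_, h₁⟩
      exact ObjectProperty.monotone_extensionProductIter (bigAdd_mono (shiftsIn_mono G
        (Set.inter_subset_inter_right _ (Set.Ici_subset_Ici.2 hkk)))) n _ hA'
    · rw [Preadditive.comp_add, ← Category.assoc v, ← hv₂, Category.assoc, ← hd', ← hd]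
      abel

/-- If `G` is bounded, the objects of `⟨G⟩̄_n` with amplitude in a given interval are obtained by
means of the shifts of `G` in a bounded interval. -/
lemma exists_Icc_bigGen [IsTriangulated T] [HasCoproducts.{w} T]
    (ht : CoproductStableGE.{w} t)
    (ha : t.IsGE G a) (hb : t.IsLE G b) {n : ℕ} (hn : 0 < n) (m m' : ℤ) :
    ∃ l k : ℤ, ∀ (M : T) (_ : t.IsGE M m) (_ : t.IsLE M m') (_ : bigGen.{w} G Set.univ n M),
      bigGen.{w} G (Set.Icc l k) n M := by
  obtain ⟨n, rfl⟩ := Nat.exists_eq_succ_of_ne_zero hn.ne'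
  obtain ⟨k, hk⟩ := exists_factorization_of_isLE ht ha hb n m'
  obtain ⟨l, hl⟩ := exists_factorization_of_isGE ht ha hb n m
  refine ⟨l, k, fun M h h' ⟨B, hB, ⟨r⟩⟩ => ?_⟩
  -- The section `M → B` is factored first, which bounds the shifts above. Then the retraction
  -- restricted to `B₁` is factored, which bounds them below without leaving the first range.
  obtain ⟨B₁, f₁, g₁, hB₁, e₁⟩ := hk _ B hB M h' r.i
  obtain ⟨B₂, f₂, g₂, hB₂, e₂⟩ := hl _ B₁ hB₁ M h (g₁ ≫ r.r)
  refine ⟨B₂, ?_, ⟨⟨f₁ ≫ f₂, g₂, by rw [Category.assoc, e₂, reassoc_of% e₁, r.retract]⟩⟩⟩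
  refine ObjectProperty.monotone_extensionProductIter (bigAdd_mono (shiftsIn_mono G ?_)) n _ hB₂
  intro i hi
  exact ⟨hi.2, hi.1.2⟩

end

end CoApprox

namespace CoApprox

/-! ### Coproducts of quasi-isomorphisms -/

section

variable {C : Type v₁} [Category.{v₂} C]

/-- The short complex of functors on a discrete category attached to a family of
short complexes. -/
def familyShortComplex [HasZeroMorphisms C] {I : Type w} (S : I → ShortComplex C) :
    ShortComplex (Discrete I ⥤ C) where
  X₁ := Discrete.functor fun i => (S i).X₁
  X₂ := Discrete.functor fun i => (S i).X₂
  X₃ := Discrete.functor fun i => (S i).X₃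
  f := Discrete.natTrans fun i => (S i.as).f
  g := Discrete.natTrans fun i => (S i.as).g
  zero := by ext; simp

/-- The morphism of short complexes of functors attached to a family of morphisms of
short complexes. -/
def familyShortComplexMap [HasZeroMorphisms C] {I : Type w} {S S' : I → ShortComplex C}
    (φ : ∀ i, S i ⟶ S' i) : familyShortComplex S ⟶ familyShortComplex S' where
  τ₁ := Discrete.natTrans fun i => (φ i.as).τ₁
  τ₂ := Discrete.natTrans fun i => (φ i.as).τ₂
  τ₃ := Discrete.natTrans fun i => (φ i.as).τ₃
  comm₁₂ := by ext i; exact (φ i.as).comm₁₂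
  comm₂₃ := by ext i; exact (φ i.as).comm₂₃

variable [Abelian C]

/-- Homology in a functor category is computed pointwise, since evaluation preserves homology. -/
lemma quasiIso_familyShortComplexMap {I : Type w} {S S' : I → ShortComplex C}
    (φ : ∀ i, S i ⟶ S' i) (hφ : ∀ i, ShortComplex.QuasiIso (φ i)) :
    ShortComplex.QuasiIso (familyShortComplexMap φ) := by
  have γ : ShortComplex.LeftHomologyMapData (familyShortComplexMap φ)
    (familyShortComplex S).leftHomologyData (familyShortComplex S').leftHomologyData := default
  rw [γ.quasiIso_iff, NatTrans.isIso_iff_isIso_app]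
  rintro ⟨i⟩
  let F : (Discrete I ⥤ C) ⥤ C := (CategoryTheory.evaluation (Discrete I) C).obj ⟨i⟩
  have : F.PreservesHomology := inferInstance
  have h := (γ.map F).quasiIso_iff
  rw [ShortComplex.LeftHomologyMapData.map_φH] at h
  exact h.1 (hφ i)

/-- Coproducts of quasi-isomorphisms of short complexes are quasi-isomorphisms. -/
lemma quasiIso_of_isColimit_shortComplex {I : Type w} [HasColimitsOfShape (Discrete I) C]
    [HasExactColimitsOfShape (Discrete I) C]
    {S S' : I → ShortComplex C} (φ : ∀ i, S i ⟶ S' i) (hφ : ∀ i, ShortComplex.QuasiIso (φ i))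
    {A A' : ShortComplex C} (j : ∀ i, S i ⟶ A) (j' : ∀ i, S' i ⟶ A')
    (h₁ : IsColimit (Cofan.mk A.X₁ fun i => (j i).τ₁))
    (h₂ : IsColimit (Cofan.mk A.X₂ fun i => (j i).τ₂))
    (h₃ : IsColimit (Cofan.mk A.X₃ fun i => (j i).τ₃))
    (h₁' : IsColimit (Cofan.mk A'.X₁ fun i => (j' i).τ₁))
    (h₂' : IsColimit (Cofan.mk A'.X₂ fun i => (j' i).τ₂))
    (h₃' : IsColimit (Cofan.mk A'.X₃ fun i => (j' i).τ₃))
    (ψ : A ⟶ A') (hψ : ∀ i, j i ≫ ψ = φ i ≫ j' i) : ShortComplex.QuasiIso ψ := by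
  -- Exactness of coproducts makes `colim` preserve homology, hence quasi-isomorphisms. What remains
  -- is to identify its values with the given colimits.
  have : PreservesFiniteLimits (colim (J := Discrete I) (C := C)) :=
    HasExactColimitsOfShape.preservesFiniteLimits
  let F : (Discrete I ⥤ C) ⥤ C := colim
  have : F.PreservesHomology := inferInstance
  have := quasiIso_familyShortComplexMap φ hφ
  have hq : ShortComplex.QuasiIso (F.mapShortComplex.map (familyShortComplexMap φ)) :=
    inferInstance
  have hF {X Y : Discrete I ⥤ C} (α : X ⟶ Y) (i : Discrete I) :
      colimit.ι X i ≫ F.map α = α.app i ≫ colimit.ι Y i := ι_colimMap α i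
  have key {S : I → ShortComplex C} {A : ShortComplex C} (j : ∀ i, S i ⟶ A)
    (h₁ : IsColimit (Cofan.mk A.X₁ fun i => (j i).τ₁))
    (h₂ : IsColimit (Cofan.mk A.X₂ fun i => (j i).τ₂))
    (h₃ : IsColimit (Cofan.mk A.X₃ fun i => (j i).τ₃)) :
      ∃ (e₁ : F.obj (familyShortComplex S).X₁ ≅ A.X₁)
        (e₂ : F.obj (familyShortComplex S).X₂ ≅ A.X₂)
        (e₃ : F.obj (familyShortComplex S).X₃ ≅ A.X₃),
        e₁.hom ≫ A.f = F.map (familyShortComplex S).f ≫ e₂.hom ∧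
        e₂.hom ≫ A.g = F.map (familyShortComplex S).g ≫ e₃.hom ∧
        (∀ i, colimit.ι (familyShortComplex S).X₁ ⟨i⟩ ≫ e₁.hom = (j i).τ₁) ∧
        (∀ i, colimit.ι (familyShortComplex S).X₂ ⟨i⟩ ≫ e₂.hom = (j i).τ₂) ∧
        (∀ i, colimit.ι (familyShortComplex S).X₃ ⟨i⟩ ≫ e₃.hom = (j i).τ₃) := by
    let e₁ : F.obj (familyShortComplex S).X₁ ≅ A.X₁ :=
      IsColimit.coconePointUniqueUpToIso (colimit.isColimit _) h₁
    let e₂ : F.obj (familyShortComplex S).X₂ ≅ A.X₂ :=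
      IsColimit.coconePointUniqueUpToIso (colimit.isColimit _) h₂
    let e₃ : F.obj (familyShortComplex S).X₃ ≅ A.X₃ :=
      IsColimit.coconePointUniqueUpToIso (colimit.isColimit _) h₃
    have he₁ (i) : colimit.ι (familyShortComplex S).X₁ ⟨i⟩ ≫ e₁.hom = (j i).τ₁ :=
      IsColimit.comp_coconePointUniqueUpToIso_hom (colimit.isColimit _) h₁ _
    have he₂ (i) : colimit.ι (familyShortComplex S).X₂ ⟨i⟩ ≫ e₂.hom = (j i).τ₂ :=
      IsColimit.comp_coconePointUniqueUpToIso_hom (colimit.isColimit _) h₂ _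
    have he₃ (i) : colimit.ι (familyShortComplex S).X₃ ⟨i⟩ ≫ e₃.hom = (j i).τ₃ :=
      IsColimit.comp_coconePointUniqueUpToIso_hom (colimit.isColimit _) h₃ _
    refine ⟨e₁, e₂, e₃, ?_, ?_, he₁, he₂, he₃⟩
    · refine colimit.hom_ext fun ⟨i⟩ => ?_
      rw [reassoc_of% he₁ i, reassoc_of% hF, he₂]
      exact (j i).comm₁₂
    · refine colimit.hom_ext fun ⟨i⟩ => ?_
      rw [reassoc_of% he₂ i, reassoc_of% hF, he₃]
      exact (j i).comm₂₃
  obtain ⟨e₁, e₂, e₃, hf, hg, he₁, he₂, he₃⟩ := key j h₁ h₂ h₃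
  obtain ⟨e₁', e₂', e₃', hf', hg', he₁', he₂', he₃'⟩ := key j' h₁' h₂' h₃'
  let e : F.mapShortComplex.obj (familyShortComplex S) ≅ A :=
    ShortComplex.isoMk e₁ e₂ e₃ hf hg
  let e' : F.mapShortComplex.obj (familyShortComplex S') ≅ A' :=
    ShortComplex.isoMk e₁' e₂' e₃' hf' hg'
  have hcomm : F.mapShortComplex.map (familyShortComplexMap φ) ≫ e'.hom = e.hom ≫ ψ := by
    ext
    · refine colimit.hom_ext fun ⟨i⟩ => ?_
      change _ ≫ F.map (familyShortComplexMap φ).τ₁ ≫ e₁'.hom = _ ≫ e₁.hom ≫ ψ.τ₁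
      rw [reassoc_of% he₁ i, reassoc_of% hF, he₁']
      exact congr(($(hψ i)).τ₁).symm
    · refine colimit.hom_ext fun ⟨i⟩ => ?_
      change _ ≫ F.map (familyShortComplexMap φ).τ₂ ≫ e₂'.hom = _ ≫ e₂.hom ≫ ψ.τ₂
      rw [reassoc_of% he₂ i, reassoc_of% hF, he₂']
      exact congr(($(hψ i)).τ₂).symm
    · refine colimit.hom_ext fun ⟨i⟩ => ?_
      change _ ≫ F.map (familyShortComplexMap φ).τ₃ ≫ e₃'.hom = _ ≫ e₃.hom ≫ ψ.τ₃
      rw [reassoc_of% he₃ i, reassoc_of% hF, he₃']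
      exact congr(($(hψ i)).τ₃).symm
  have : ψ = e.inv ≫ F.mapShortComplex.map (familyShortComplexMap φ) ≫ e'.hom := by
    rw [hcomm, Iso.inv_hom_id_assoc]
  rw [this]
  infer_instance

end

section

variable {C : Type v₁} [Category.{v₂} C] {ι : Type*} {c : ComplexShape ι}

/-- A coproduct of complexes is a coproduct in each degree. -/
noncomputable def isColimitCofanX [HasZeroMorphisms C] {I : Type w}
    [HasColimitsOfShape (Discrete I) C]
    {Y : I → HomologicalComplex C c} {s : Cofan Y} (hs : IsColimit s) (n : ι) :
    IsColimit (Cofan.mk (s.pt.X n) fun i => (s.inj i).f n) :=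
  isColimitCofanMkObjOfIsColimit (HomologicalComplex.eval C c n) Y s.inj
    (IsColimit.ofIsoColimit hs (Cofan.ext (Iso.refl _) (by simp)))

/-- Coproducts of quasi-isomorphisms are quasi-isomorphisms if coproducts are exact. -/
lemma quasiIso_of_isColimit [Abelian C] {I : Type w} [HasColimitsOfShape (Discrete I) C]
    [HasExactColimitsOfShape (Discrete I) C]
    {Y Y' : I → HomologicalComplex C c} (φ : ∀ i, Y i ⟶ Y' i) (hφ : ∀ i, QuasiIso (φ i))
    {s : Cofan Y} (hs : IsColimit s) {s' : Cofan Y'} (hs' : IsColimit s')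
    (ψ : s.pt ⟶ s'.pt) (hψ : ∀ i, s.inj i ≫ ψ = φ i ≫ s'.inj i) : QuasiIso ψ where
  quasiIsoAt n := by
    rw [quasiIsoAt_iff]
    exact quasiIso_of_isColimit_shortComplex
      (fun i => (HomologicalComplex.shortComplexFunctor C c n).map (φ i))
      (fun i => (quasiIsoAt_iff _ _).1 inferInstance)
      (fun i => (HomologicalComplex.shortComplexFunctor C c n).map (s.inj i))
      (fun i => (HomologicalComplex.shortComplexFunctor C c n).map (s'.inj i))
      (isColimitCofanX hs _) (isColimitCofanX hs _) (isColimitCofanX hs _)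
      (isColimitCofanX hs' _) (isColimitCofanX hs' _) (isColimitCofanX hs' _) _
      (fun i => by rw [← Functor.map_comp, hψ, Functor.map_comp])

/-- A morphism from a coproduct of complexes is homotopic to zero if its restriction to each
summand is. -/
lemma homotopy_zero_of_isColimit [Preadditive C] {I : Type w}
    [HasColimitsOfShape (Discrete I) C]
    {Y : I → HomologicalComplex C c} {s : Cofan Y} (hs : IsColimit s)
    {Z : HomologicalComplex C c} (f : s.pt ⟶ Z)
    (h : ∀ i, Nonempty (Homotopy (s.inj i ≫ f) 0)) : Nonempty (Homotopy f 0) := by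
  let h' (i : I) := (h i).some
  -- Chosen null homotopies on the summands glue, because each term of the coproduct is a coproduct
  -- of terms.
  let k (p q : ι) : s.pt.X p ⟶ Z.X q :=
    Cofan.IsColimit.desc (isColimitCofanX hs p) fun i => (h' i).hom p q
  have hk (i : I) (p q : ι) : (s.inj i).f p ≫ k p q = (h' i).hom p q :=
    Cofan.IsColimit.fac (isColimitCofanX hs p) _ i
  refine ⟨{ hom := k, zero := fun p q hpq => ?_, comm := fun p => ?_ }⟩
  · refine Cofan.IsColimit.hom_ext (isColimitCofanX hs p) _ _ fun i => ?_
    change (s.inj i).f p ≫ k p q = (s.inj i).f p ≫ 0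
    rw [hk, comp_zero, (h' i).zero p q hpq]
  · refine Cofan.IsColimit.hom_ext (isColimitCofanX hs p) _ _ fun i => ?_
    change (s.inj i).f p ≫ f.f p = (s.inj i).f p ≫ _
    have e := (h' i).comm p
    rw [HomologicalComplex.comp_f] at e
    rw [e, Preadditive.comp_add, Preadditive.comp_add, ← dNext_comp_left, ← prevD_comp_left]
    simp only [hk, HomologicalComplex.zero_f, comp_zero]

/-- The quotient functor to the homotopy category preserves coproducts. -/
lemma nonempty_isColimit_quotient [Preadditive C] {I : Type w}
    [HasColimitsOfShape (Discrete I) C]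
    {Y : I → HomologicalComplex C c} {s : Cofan Y} (hs : IsColimit s) :
    Nonempty (IsColimit (Cofan.mk ((HomotopyCategory.quotient C c).obj s.pt)
      fun i => (HomotopyCategory.quotient C c).map (s.inj i))) := by
  let q := HomotopyCategory.quotient C c
  have hex (Z : HomotopyCategory C c) (f : ∀ i, q.obj (Y i) ⟶ Z) :
      ∃ g : q.obj s.pt ⟶ Z, ∀ i, q.map (s.inj i) ≫ g = f i := by
    obtain ⟨Z, rfl⟩ := HomotopyCategory.quotient_obj_surjective Z
    choose f' hf' using fun i => q.map_surjective (f i)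
    refine ⟨q.map (Cofan.IsColimit.desc hs f'), fun i => ?_⟩
    rw [← Functor.map_comp, Cofan.IsColimit.fac, hf']
  have huniq (Z : HomotopyCategory C c) (f g : q.obj s.pt ⟶ Z)
      (hfg : ∀ i, q.map (s.inj i) ≫ f = q.map (s.inj i) ≫ g) : f = g := by
    obtain ⟨Z, rfl⟩ := HomotopyCategory.quotient_obj_surjective Z
    obtain ⟨h, hh⟩ := q.map_surjective (f - g)
    obtain ⟨H⟩ := homotopy_zero_of_isColimit hs h fun i =>
      ⟨HomotopyCategory.homotopyOfEq _ _ (by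
        change q.map _ = q.map _
        rw [Functor.map_comp, hh, Preadditive.comp_sub, hfg, sub_self, Functor.map_zero])⟩
    have := HomotopyCategory.eq_of_homotopy _ _ H
    rw [← sub_eq_zero, ← hh]
    exact this.trans (Functor.map_zero _ _ _)
  choose d hd using fun t : Cofan fun i => q.obj (Y i) => hex t.pt t.inj
  exact ⟨Cofan.IsColimit.mk _ d (fun t i => hd t i)
    fun t m hm => huniq _ _ _ fun i => (hm i).trans (hd t i).symm⟩

lemma hasCoproducts_homotopyCategory [Preadditive C] [HasCoproducts.{w} C] :
    HasCoproducts.{w} (HomotopyCategory C c) := by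
  have key {I : Type w} (Y : I → HomotopyCategory C c) :
      ∃ s : Cofan Y, Nonempty (IsColimit s) := by
    choose Y' hY' using fun i => HomotopyCategory.quotient_obj_surjective (Y i)
    obtain rfl : (fun i => (HomotopyCategory.quotient C c).obj (Y' i)) = Y := funext hY'
    exact ⟨_, nonempty_isColimit_quotient (coproductIsCoproduct Y')⟩
  exact hasCoproducts_of_colimit_cofans (fun Y => (key Y).choose)
    (fun Y => (key Y).choose_spec.some)

end

end CoApprox

namespace CoApprox

/-! ### Coproducts in the derived category -/

section

open DerivedCategory

variable {C : Type v₁} [Category.{v₂} C] [Abelian C] [HasDerivedCategory.{u} C]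

/-- By calculus of fractions in the homotopy category, a map that dies in the localization is killed
by precomposition with some quasi-isomorphism. -/
lemma exists_quasiIso_homotopy_zero {K L : CochainComplex C ℤ} (f : K ⟶ L) (hf : Q.map f = 0) :
    ∃ (K' : CochainComplex C ℤ) (s : K' ⟶ K), QuasiIso s ∧ Nonempty (Homotopy (s ≫ f) 0) := by
  let q := HomotopyCategory.quotient C (ComplexShape.up ℤ)
  have hf' : Qh.map (q.map f) = Qh.map (q.map 0) := by
    rw [q.map_zero, Functor.map_zero]
    exact hf
  rw [MorphismProperty.map_eq_iff_precomp Qh (HomotopyCategory.quasiIso C _)] at hf'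
  obtain ⟨K', s, hs, e⟩ := hf'
  obtain ⟨K', rfl⟩ := HomotopyCategory.quotient_obj_surjective K'
  obtain ⟨s, rfl⟩ := q.map_surjective s
  refine ⟨K', s, ?_, ⟨HomotopyCategory.homotopyOfEq _ _ ?_⟩⟩
  · rwa [HomotopyCategory.quotient_map_mem_quasiIso_iff] at hs
  · change q.map _ = q.map 0
    rw [q.map_comp, e, q.map_zero, comp_zero]
    exact (q.map_zero _ _).symm

/-- The localization functor to the derived category preserves coproducts if these are exact. -/
lemma nonempty_isColimit_Q {I : Type w} [HasColimitsOfShape (Discrete I) C]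
    [HasExactColimitsOfShape (Discrete I) C]
    {Y : I → CochainComplex C ℤ} {s : Cofan Y} (hs : IsColimit s) :
    Nonempty (IsColimit (Cofan.mk (Q.obj s.pt) fun i => Q.map (s.inj i))) := by
  have key {X : I → CochainComplex C ℤ} (t : ∀ i, X i ⟶ Y i) (ht : ∀ i, QuasiIso (t i)) :
      ∃ σ : (∐ X) ⟶ s.pt, QuasiIso σ ∧ ∀ i, Sigma.ι X i ≫ σ = t i ≫ s.inj i := by
    refine ⟨Sigma.desc fun i => t i ≫ s.inj i, ?_, by simp⟩
    exact quasiIso_of_isColimit t ht (coproductIsCoproduct X) hs _ fun i =>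
      Sigma.ι_desc _ _
  have hex (Z : DerivedCategory C) (f : ∀ i, Q.obj (Y i) ⟶ Z) :
      ∃ g : Q.obj s.pt ⟶ Z, ∀ i, Q.map (s.inj i) ≫ g = f i := by
    let e := Q.objObjPreimageIso Z
    -- Each component is a roof through a quasi-isomorphism `t i`; the coproduct of the `t i` is
    -- again one, so the roofs combine into a single roof.
    choose X t ht g hg using fun i => right_fac (f i ≫ e.inv)
    have ht' (i : I) : QuasiIso (t i) := (isIso_Q_map_iff_quasiIso _ _).1 (ht i)
    obtain ⟨σ, hσ, hσ'⟩ := key t ht'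
    refine ⟨inv (Q.map σ) ≫ Q.map (Sigma.desc g) ≫ e.hom, fun i => ?_⟩
    have h₁ : Q.map (s.inj i) ≫ inv (Q.map σ) = inv (Q.map (t i)) ≫ Q.map (Sigma.ι X i) := by
      rw [IsIso.comp_inv_eq, Category.assoc, ← Functor.map_comp, hσ', Functor.map_comp,
        IsIso.inv_hom_id_assoc]
    rw [reassoc_of% h₁, ← Functor.map_comp_assoc, Sigma.ι_desc, ← reassoc_of% hg i,
      Iso.inv_hom_id, Category.comp_id]
  have huniq (Z : DerivedCategory C) (f : Q.obj s.pt ⟶ Z)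
      (hf : ∀ i, Q.map (s.inj i) ≫ f = 0) : f = 0 := by
    let e := Q.objObjPreimageIso Z
    obtain ⟨Z', g, t, ht, hg⟩ := left_fac (f ≫ e.inv)
    have h₁ (i : I) : Q.map (s.inj i ≫ g) = 0 := by
      rw [← cancel_mono (inv (Q.map t)), Functor.map_comp, Category.assoc, ← hg,
        reassoc_of% hf i, zero_comp, zero_comp]
    -- Uniqueness uses the same trick: the quasi-isomorphisms which kill the components combine into
    -- one which kills `g`.
    choose X σ hσ H using fun i => exists_quasiIso_homotopy_zero _ (h₁ i)
    obtain ⟨τ, hτ, hτ'⟩ := key σ hσ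
    obtain ⟨H'⟩ := homotopy_zero_of_isColimit (coproductIsCoproduct X) (τ ≫ g) fun i => by
      refine ⟨Homotopy.trans (.ofEq ?_) (H i).some⟩
      exact (Category.assoc _ _ _).symm.trans ((congr($(hτ' i) ≫ g)).trans (Category.assoc _ _ _))
    have h₂ : Q.map (τ ≫ g) = 0 := by
      have := Qh.congr_map (HomotopyCategory.eq_of_homotopy _ _ H')
      rw [Functor.map_zero, Functor.map_zero] at this
      exact this
    have h₃ : Q.map g = 0 := by
      rw [← cancel_epi (Q.map τ), ← Functor.map_comp, h₂, comp_zero]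
    rw [← cancel_mono e.inv, hg, h₃, zero_comp, zero_comp]
  choose d hd using fun t : Cofan fun i => Q.obj (Y i) => hex t.pt t.inj
  refine ⟨Cofan.IsColimit.mk _ d (fun t i => hd t i) fun t m hm => ?_⟩
  rw [← sub_eq_zero]
  refine huniq _ _ fun i => ?_
  rw [Preadditive.comp_sub, sub_eq_zero]
  exact (hm i).trans (hd t i).symm

variable (C) [HasCoproducts.{w} C] [∀ I : Type w, HasExactColimitsOfShape (Discrete I) C]

lemma hasCoproducts_derivedCategory : HasCoproducts.{w} (DerivedCategory C) := by
  have key {I : Type w} (Y : I → DerivedCategory C) :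
      ∃ s : Cofan Y, Nonempty (IsColimit s) := by
    obtain ⟨h⟩ := nonempty_isColimit_Q (coproductIsCoproduct fun i => Q.objPreimage (Y i))
    let e (i : I) : Q.obj (Q.objPreimage (Y i)) ≅ Y i := Q.objObjPreimageIso (Y i)
    have : HasCoproduct fun i => Q.obj (Q.objPreimage (Y i)) := ⟨_, h⟩
    have : HasCoproduct Y := hasCoproduct_of_equiv_of_iso (fun i => Q.obj (Q.objPreimage (Y i))) _ (Equiv.refl I) fun i => (e i).symm
    exact ⟨_, ⟨coproductIsCoproduct Y⟩⟩
  exact hasCoproducts_of_colimit_cofans (fun Y => (key Y).choose)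
    (fun Y => (key Y).choose_spec.some)

variable {C} in
lemma isStrictlyGE_of_isColimit {D : Type*} [Category D] [HasZeroMorphisms D] {I : Type w}
    [HasColimitsOfShape (Discrete I) D] {n : ℤ}
    {Y : I → CochainComplex D ℤ} (hY : ∀ i, (Y i).IsStrictlyGE n) {s : Cofan Y}
    (hs : IsColimit s) : s.pt.IsStrictlyGE n := by
  rw [CochainComplex.isStrictlyGE_iff]
  intro p hp
  rw [IsZero.iff_id_eq_zero]
  refine Cofan.IsColimit.hom_ext (isColimitCofanX hs p) _ _ fun i => ?_
  exact ((Y i).isZero_of_isStrictlyGE n p hp).eq_of_src _ _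

/-- Each object is represented by a complex strictly in degrees `≥ n`, and since coproducts are
exact, those in the derived category are computed on complexes. -/
lemma coproductStableGE_derivedCategory :
    CoproductStableGE.{w} (TStructure.t (C := C)) := by
  intro n I Y c hc hY
  choose K hK e using fun i =>
    have := hY i; exists_iso_Q_obj_of_isGE (Y i) n
  obtain ⟨h⟩ := nonempty_isColimit_Q (coproductIsCoproduct K)
  have : (∐ K).IsStrictlyGE n := isStrictlyGE_of_isColimit hK (coproductIsCoproduct K)
  have e' : Q.obj (∐ K) ≅ c.pt := IsColimit.coconePointsIsoOfNatIso h hc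
    (Discrete.natIso fun i => (e i.as).some.symm)
  exact TStructure.t.isGE_of_iso e' n

end

end CoApprox

namespace CoApprox

/-! ### The co-t-structure on the homotopy category of an idempotent complete category -/

section

variable {A : Type v₁} [Category.{v₂} A] [Preadditive A] [HasZeroObject A]

/-- The brutal truncation of a cochain complex, as a degreewise split short exact sequence. -/
lemma exists_brutal_truncation (K : CochainComplex A ℤ) (m n : ℤ) (hmn : m + 1 = n) :
    ∃ (L M : CochainComplex A ℤ) (f : L ⟶ K) (g : K ⟶ M) (r : ∀ p, K.X p ⟶ L.X p)
      (s : ∀ p, M.X p ⟶ K.X p), (∀ p, f.f p ≫ r p = 𝟙 _) ∧ (∀ p, s p ≫ g.f p = 𝟙 _) ∧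
      (∀ p, r p ≫ f.f p + g.f p ≫ s p = 𝟙 _) ∧ f ≫ g = 0 ∧
      L.IsStrictlyGE n ∧ M.IsStrictlyLE m := by
  have key (p : ℤ) : ∃ (X Y : A) (f : X ⟶ K.X p) (g : K.X p ⟶ Y) (r : K.X p ⟶ X)
      (s : Y ⟶ K.X p), f ≫ r = 𝟙 _ ∧ s ≫ g = 𝟙 _ ∧ r ≫ f + g ≫ s = 𝟙 _ ∧ f ≫ g = 0 ∧
      (p < n → IsZero X) ∧ (n ≤ p → IsZero Y) := by
    by_cases hp : p < n
    · exact ⟨0, K.X p, 0, 𝟙 _, 0, 𝟙 _, by simp, by simp, by simp, by simp,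
        fun _ => isZero_zero _, fun h => by lia⟩
    · exact ⟨K.X p, 0, 𝟙 _, 0, 𝟙 _, 0, by simp, by simp, by simp, by simp,
        fun h => by lia, fun _ => isZero_zero _⟩
  choose X Y f g r s fr sg rf fg hX hY using key
  -- The differential raises degrees, so the terms in degrees `≥ n` form a subcomplex; the
  -- differentials of both truncations are well defined for this reason.
  have hfdg (p q : ℤ) (hpq : (ComplexShape.up ℤ).Rel p q) : f p ≫ K.d p q ≫ g q = 0 := by
    have hpq' : p + 1 = q := hpq
    by_cases hp : p < n
    · exact (hX p hp).eq_of_src _ _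
    · exact (hY q (by lia)).eq_of_tgt _ _
  have hfd (p q : ℤ) (hpq : (ComplexShape.up ℤ).Rel p q) :
      (f p ≫ K.d p q ≫ r q) ≫ f q = f p ≫ K.d p q := by
    have : r q ≫ f q = 𝟙 _ - g q ≫ s q := by rw [← rf q]; abel
    simp only [Category.assoc, this, Preadditive.comp_sub, Category.comp_id]
    rw [← Category.assoc (K.d p q), ← Category.assoc (f p), hfdg p q hpq, zero_comp, sub_zero]
  have hdg (p q : ℤ) (hpq : (ComplexShape.up ℤ).Rel p q) :
      g p ≫ s p ≫ K.d p q ≫ g q = K.d p q ≫ g q := by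
    have : g p ≫ s p = 𝟙 _ - r p ≫ f p := by rw [← rf p]; abel
    rw [← Category.assoc (g p), this, Preadditive.sub_comp, Category.id_comp, Category.assoc,
      hfdg p q hpq, comp_zero, sub_zero]
  let L : CochainComplex A ℤ :=
    { X := X
      d := fun p q => f p ≫ K.d p q ≫ r q
      shape := fun p q h => by rw [K.shape _ _ h, zero_comp, comp_zero]
      d_comp_d' := fun p q t hpq hqt => by
        rw [← Category.assoc, hfd p q hpq, Category.assoc, K.d_comp_d_assoc, zero_comp,
          comp_zero] }
  let M : CochainComplex A ℤ :=
    { X := Y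
      d := fun p q => s p ≫ K.d p q ≫ g q
      shape := fun p q h => by rw [K.shape _ _ h, zero_comp, comp_zero]
      d_comp_d' := fun p q t hpq hqt => by
        rw [Category.assoc, Category.assoc, hdg q t hqt, K.d_comp_d_assoc, zero_comp,
          comp_zero] }
  refine ⟨L, M, { f := f, comm' := fun p q hpq => (hfd p q hpq).symm },
    { f := g, comm' := hdg }, r, s, fr, sg, rf, ?_, ?_, ?_⟩
  · ext p
    exact fg p
  · rw [CochainComplex.isStrictlyGE_iff]
    exact fun p hp => hX p hp
  · rw [CochainComplex.isStrictlyLE_iff]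
    exact fun p hp => hY p (by lia)

/-- The objects of the homotopy category which are homotopy equivalent to a complex in
degrees `≥ n`. -/
def homotopyGE (A : Type v₁) [Category.{v₂} A] [Preadditive A] [HasZeroObject A] (n : ℤ) :
    ObjectProperty (HomotopyCategory A (ComplexShape.up ℤ)) :=
  fun K => ∃ L : CochainComplex A ℤ, L.IsStrictlyGE n ∧
    Nonempty (K ≅ (HomotopyCategory.quotient _ _).obj L)

/-- The objects of the homotopy category which are homotopy equivalent to a complex in
degrees `≤ n`. -/
def homotopyLE (A : Type v₁) [Category.{v₂} A] [Preadditive A] [HasZeroObject A] (n : ℤ) :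
    ObjectProperty (HomotopyCategory A (ComplexShape.up ℤ)) :=
  fun K => ∃ L : CochainComplex A ℤ, L.IsStrictlyLE n ∧
    Nonempty (K ≅ (HomotopyCategory.quotient _ _).obj L)

instance (n : ℤ) : (homotopyGE A n).IsClosedUnderIsomorphisms where
  of_iso e := fun ⟨L, hL, ⟨e'⟩⟩ => ⟨L, hL, ⟨e.symm ≪≫ e'⟩⟩

lemma homotopyGE_quotient (K : CochainComplex A ℤ) (n : ℤ) [K.IsStrictlyGE n] :
    homotopyGE A n ((HomotopyCategory.quotient _ _).obj K) :=
  ⟨K, inferInstance, ⟨Iso.refl _⟩⟩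

lemma homotopyLE_quotient (K : CochainComplex A ℤ) (n : ℤ) [K.IsStrictlyLE n] :
    homotopyLE A n ((HomotopyCategory.quotient _ _).obj K) :=
  ⟨K, inferInstance, ⟨Iso.refl _⟩⟩

lemma homotopyGE_mono {m n : ℤ} (hmn : m ≤ n) : homotopyGE A n ≤ homotopyGE A m := by
  rintro K ⟨L, hL, e⟩
  exact ⟨L, L.isStrictlyGE_of_ge m n hmn, e⟩

lemma homotopyLE_mono {m n : ℤ} (hmn : m ≤ n) : homotopyLE A m ≤ homotopyLE A n := by
  rintro K ⟨L, hL, e⟩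
  exact ⟨L, L.isStrictlyLE_of_le m n hmn, e⟩

lemma homotopyGE_shift {K : HomotopyCategory A (ComplexShape.up ℤ)} {n : ℤ}
    (hK : homotopyGE A n K) (a n' : ℤ) (h : a + n' = n) : homotopyGE A n' (K⟦a⟧) := by
  obtain ⟨L, hL, ⟨e⟩⟩ := hK
  exact ⟨L⟦a⟧, L.isStrictlyGE_shift n a n' h,
    ⟨(shiftFunctor _ a).mapIso e ≪≫
      (((HomotopyCategory.quotient A (ComplexShape.up ℤ)).commShiftIso a).app L).symm⟩⟩

lemma homotopyLE_shift {K : HomotopyCategory A (ComplexShape.up ℤ)} {n : ℤ}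
    (hK : homotopyLE A n K) (a n' : ℤ) (h : a + n' = n) : homotopyLE A n' (K⟦a⟧) := by
  obtain ⟨L, hL, ⟨e⟩⟩ := hK
  exact ⟨L⟦a⟧, L.isStrictlyLE_shift n a n' h,
    ⟨(shiftFunctor _ a).mapIso e ≪≫
      (((HomotopyCategory.quotient A (ComplexShape.up ℤ)).commShiftIso a).app L).symm⟩⟩

/-- In each degree the source or the target of a representing chain map vanishes. -/
lemma hom_eq_zero_of_homotopyGE_of_homotopyLE {K L : HomotopyCategory A (ComplexShape.up ℤ)}
    {m n : ℤ} (hmn : m < n) (hK : homotopyGE A n K) (hL : homotopyLE A m L) (f : K ⟶ L) :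
    f = 0 := by
  obtain ⟨K', hK', ⟨e⟩⟩ := hK
  obtain ⟨L', hL', ⟨e'⟩⟩ := hL
  obtain ⟨g, hg⟩ := (HomotopyCategory.quotient A (ComplexShape.up ℤ)).map_surjective
    (e.inv ≫ f ≫ e'.hom)
  have : g = 0 := by
    ext p
    by_cases hp : p < n
    · exact (K'.isZero_of_isStrictlyGE n p hp).eq_of_src _ _
    · exact (L'.isZero_of_isStrictlyLE m p (by lia)).eq_of_tgt _ _
  rw [this, Functor.map_zero] at hg
  rw [← cancel_epi e.inv, ← cancel_mono e'.hom, Category.assoc, ← hg]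
  simp

/-- The complex split off by an idempotent endomorphism which is homotopic to the identity is
homotopy equivalent to the given complex. -/
lemma exists_iso_of_idempotent [IsIdempotentComplete A] {K : CochainComplex A ℤ} (t : K ⟶ K)
    (ht : t ≫ t = t) (h : Homotopy t (𝟙 K)) :
    ∃ L : CochainComplex A ℤ, Nonempty ((HomotopyCategory.quotient _ _).obj K ≅
      (HomotopyCategory.quotient _ _).obj L) ∧ ∀ p, t.f p = 0 → IsZero (L.X p) := by
  obtain ⟨L, i, e, h₁, h₂⟩ := IsIdempotentComplete.idempotents_split K t ht
  refine ⟨L, ⟨⟨(HomotopyCategory.quotient _ _).map e, (HomotopyCategory.quotient _ _).map i,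
    ?_, ?_⟩⟩, fun p hp => ?_⟩
  · rw [← Functor.map_comp, h₂, HomotopyCategory.eq_of_homotopy _ _ h,
      CategoryTheory.Functor.map_id]
  · rw [← Functor.map_comp, h₁, CategoryTheory.Functor.map_id]
  · rw [IsZero.iff_id_eq_zero]
    have h₃ : i.f p ≫ e.f p = 𝟙 _ := by rw [← HomologicalComplex.comp_f, h₁]; rfl
    have h₄ : e.f p ≫ i.f p = 0 := by rw [← HomologicalComplex.comp_f, h₂, hp]
    have h₅ : (i.f p ≫ e.f p) ≫ (i.f p ≫ e.f p) = 0 := by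
      rw [Category.assoc, ← Category.assoc (e.f p), h₄, zero_comp, comp_zero]
    rw [h₃, Category.comp_id] at h₅
    exact h₅

/-- A variant of `exists_iso_of_idempotent` for an idempotent homotopic to zero. -/
lemma exists_iso_of_idempotent_of_nullHomotopic [IsIdempotentComplete A]
    {K : CochainComplex A ℤ} (N : K ⟶ K) (hN : N ≫ N = N) (h : Homotopy N 0) :
    ∃ L : CochainComplex A ℤ, Nonempty ((HomotopyCategory.quotient _ _).obj K ≅
      (HomotopyCategory.quotient _ _).obj L) ∧ ∀ p, N.f p = 𝟙 _ → IsZero (L.X p) := by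
  obtain ⟨L, e, hL⟩ := exists_iso_of_idempotent (𝟙 K - N)
    (by simp [hN])
    (Homotopy.equivSubZero.symm ((Homotopy.ofEq (by abel)).trans h)).symm
  exact ⟨L, e, fun p hp => hL p (by rw [HomologicalComplex.sub_f_apply, hp,
    HomologicalComplex.id_f, sub_self])⟩

/-- Only the quotient map `g : K → M` onto the brutal truncation is tested. A null homotopy of `g`,
followed by the degreewise section, is a degree `-1` map `h` on `K`. The chain map `N = dh + hd` is
the identity below degree `n`, zero above degree `n`, and idempotent in degree `n`. Splitting off
the complement of `N` removes all terms below `n` and stays within the homotopy class. Together with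
the vanishing of such morphisms, this describes `≥ n` by orthogonality, which yields stability under
retracts and extensions. -/
lemma homotopyGE_of_hom_eq_zero [IsIdempotentComplete A]
    (K : HomotopyCategory A (ComplexShape.up ℤ)) (m n : ℤ) (hmn : m + 1 = n)
    (hK : ∀ (L : HomotopyCategory A (ComplexShape.up ℤ)) (f : K ⟶ L), homotopyLE A m L → f = 0) :
    homotopyGE A n K := by
  obtain ⟨K, rfl⟩ := HomotopyCategory.quotient_obj_surjective K
  obtain ⟨L, M, f, g, r, s, _, sg, rf, _, _, _⟩ := exists_brutal_truncation K m n hmn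
  have hg := hK _ ((HomotopyCategory.quotient _ _).map g) (homotopyLE_quotient M m)
  rw [← Functor.map_zero (HomotopyCategory.quotient _ _)] at hg
  let k := HomotopyCategory.homotopyOfEq _ _ hg
  let h (p q : ℤ) : K.X p ⟶ K.X q := k.hom p q ≫ s q
  let N : K ⟶ K := Homotopy.nullHomotopicMap h
  have hk (p : ℤ) : g.f p = K.d p (p + 1) ≫ k.hom (p + 1) p +
      k.hom p (p - 1) ≫ M.d (p - 1) p := by
    have := k.comm p
    rwa [dNext_eq k.hom (show (ComplexShape.up ℤ).Rel p (p + 1) from rfl),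
      prevD_eq k.hom (show (ComplexShape.up ℤ).Rel (p - 1) p from sub_add_cancel p 1),
      HomologicalComplex.zero_f, add_zero] at this
  have hN (p : ℤ) : N.f p = K.d p (p + 1) ≫ h (p + 1) p + h p (p - 1) ≫ K.d (p - 1) p :=
    Homotopy.nullHomotopicMap_f (sub_add_cancel p 1) rfl h
  have hs (p : ℤ) (hp : n ≤ p) : s p = 0 :=
    (M.isZero_of_isStrictlyLE m p (by lia)).eq_of_src _ _
  have hN_lt (p : ℤ) (hp : p < n) : N.f p = 𝟙 _ := by
    have hgg : N.f p ≫ g.f p = g.f p := by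
      conv_rhs => rw [hk p]
      simp only [hN, h, Preadditive.add_comp, Category.assoc, sg, Category.comp_id, ← g.comm]
      rw [← Category.assoc (s _), sg, Category.id_comp]
    have gs : g.f p ≫ s p = 𝟙 _ := by
      rw [← rf p, (L.isZero_of_isStrictlyGE n p hp).eq_of_src (f.f p) 0, comp_zero, zero_add]
    rw [← Category.comp_id (N.f p), ← gs, reassoc_of% hgg]
  -- For `p > n` the remaining factor `h p (p - 1)` vanishes as well. For `p = n`, commuting `N`
  -- past the differential reduces idempotence to `N = 1` in degree `n - 1`.
  have hN_ge (p : ℤ) (hp : n ≤ p) : N.f p = h p (p - 1) ≫ K.d (p - 1) p := by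
    rw [hN]
    simp only [h, hs p hp, comp_zero, zero_add]
  obtain ⟨L', e, hL'⟩ := exists_iso_of_idempotent_of_nullHomotopic N (by
    ext p
    rw [HomologicalComplex.comp_f]
    by_cases hp : p < n
    · rw [hN_lt p hp, Category.comp_id]
    · rw [hN_ge p (by lia), Category.assoc]
      by_cases hp' : p - 1 < n
      · rw [← hN_ge p (by lia), ← N.comm, hN_lt _ hp', Category.id_comp, hN_ge p (by lia)]
      · simp only [h, hs (p - 1) (by lia), comp_zero, zero_comp])
    (Homotopy.nullHomotopy h fun p q hpq => by
      simp only [h, k.zero p q hpq, zero_comp])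
  refine ⟨L', ?_, e⟩
  rw [CochainComplex.isStrictlyGE_iff]
  exact fun p hp => hL' p (hN_lt p hp)

/-- Dual argument: the inclusion of the brutal truncation in degrees `≥ n` is null-homotopic, and
the resulting idempotent is the identity above degree `m` and zero below it. -/
lemma homotopyLE_of_hom_eq_zero [IsIdempotentComplete A]
    (K : HomotopyCategory A (ComplexShape.up ℤ)) (m n : ℤ) (hmn : m + 1 = n)
    (hK : ∀ (L : HomotopyCategory A (ComplexShape.up ℤ)) (f : L ⟶ K), homotopyGE A n L → f = 0) :
    homotopyLE A m K := by
  obtain ⟨K, rfl⟩ := HomotopyCategory.quotient_obj_surjective K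
  obtain ⟨L, M, f, g, r, s, fr, _, rf, _, _, _⟩ := exists_brutal_truncation K m n hmn
  have hf := hK _ ((HomotopyCategory.quotient _ _).map f) (homotopyGE_quotient L n)
  rw [← Functor.map_zero (HomotopyCategory.quotient _ _)] at hf
  let k := HomotopyCategory.homotopyOfEq _ _ hf
  let h (p q : ℤ) : K.X p ⟶ K.X q := r p ≫ k.hom p q
  let N : K ⟶ K := Homotopy.nullHomotopicMap h
  have hk (p : ℤ) : f.f p = L.d p (p + 1) ≫ k.hom (p + 1) p +
      k.hom p (p - 1) ≫ K.d (p - 1) p := by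
    have := k.comm p
    rwa [dNext_eq k.hom (show (ComplexShape.up ℤ).Rel p (p + 1) from rfl),
      prevD_eq k.hom (show (ComplexShape.up ℤ).Rel (p - 1) p from sub_add_cancel p 1),
      HomologicalComplex.zero_f, add_zero] at this
  have hN (p : ℤ) : N.f p = K.d p (p + 1) ≫ h (p + 1) p + h p (p - 1) ≫ K.d (p - 1) p :=
    Homotopy.nullHomotopicMap_f (sub_add_cancel p 1) rfl h
  have hr (p : ℤ) (hp : p ≤ m) : r p = 0 :=
    (L.isZero_of_isStrictlyGE n p (by lia)).eq_of_tgt _ _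
  have hN_gt (p : ℤ) (hp : m < p) : N.f p = 𝟙 _ := by
    have hff : f.f p ≫ N.f p = f.f p := by
      conv_rhs => rw [hk p]
      simp only [hN, h, Preadditive.comp_add]
      rw [f.comm_assoc, reassoc_of% fr, Category.assoc, reassoc_of% fr]
    have rf' : r p ≫ f.f p = 𝟙 _ := by
      rw [← rf p, (M.isZero_of_isStrictlyLE m p hp).eq_of_tgt (g.f p) 0, zero_comp, add_zero]
    rw [← Category.id_comp (N.f p), ← rf', Category.assoc, hff]
  have hN_le (p : ℤ) (hp : p ≤ m) : N.f p = K.d p (p + 1) ≫ h (p + 1) p := by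
    rw [hN]
    simp only [h, hr p hp, zero_comp, add_zero]
  obtain ⟨L', e, hL'⟩ := exists_iso_of_idempotent_of_nullHomotopic N (by
    ext p
    rw [HomologicalComplex.comp_f]
    by_cases hp : m < p
    · rw [hN_gt p hp, Category.comp_id]
    · rw [hN_le p (by lia)]
      by_cases hp' : m < p + 1
      · rw [← Category.assoc, ← hN_le p (by lia), N.comm, hN_gt _ hp', Category.comp_id,
          hN_le p (by lia)]
      · simp only [h, hr (p + 1) (by lia), comp_zero, zero_comp])
    (Homotopy.nullHomotopy h fun p q hpq => by
      simp only [h, k.zero p q hpq, comp_zero])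
  refine ⟨L', ?_, e⟩
  rw [CochainComplex.isStrictlyLE_iff]
  exact fun p hp => hL' p (hN_gt p hp)

lemma distinguished_of_degreewise_split [HasBinaryBiproducts A] {K L M : CochainComplex A ℤ}
    (f : L ⟶ K) (g : K ⟶ M) (r : ∀ p, K.X p ⟶ L.X p) (s : ∀ p, M.X p ⟶ K.X p)
    (fr : ∀ p, f.f p ≫ r p = 𝟙 _) (sg : ∀ p, s p ≫ g.f p = 𝟙 _)
    (rf : ∀ p, r p ≫ f.f p + g.f p ≫ s p = 𝟙 _) (fg : f ≫ g = 0) :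
    ∃ h, Triangle.mk ((HomotopyCategory.quotient A (ComplexShape.up ℤ)).map f)
      ((HomotopyCategory.quotient A (ComplexShape.up ℤ)).map g) h ∈
        distTriang (HomotopyCategory A (ComplexShape.up ℤ)) := by
  let S := ShortComplex.mk f g fg
  let σ (p : ℤ) : (S.map (HomologicalComplex.eval A _ p)).Splitting :=
    { r := r p, s := s p, f_r := fr p, s_g := sg p, id := rf p }
  exact ⟨_, (HomotopyCategory.distinguished_iff_iso_trianglehOfDegreewiseSplit _).2
    ⟨S, σ, ⟨Iso.refl _⟩⟩⟩

/-- The brutal truncations define a co-t-structure on the homotopy category of an idempotent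
complete additive category. -/
theorem isCoTStructure_homotopyCategory [HasBinaryBiproducts A] [IsIdempotentComplete A] :
    IsCoTStructure (homotopyGE A 0) (homotopyLE A 0) where
  left_retracts := ⟨fun {X Y} ρ hY => homotopyGE_of_hom_eq_zero X (-1) 0 (by simp)
    fun L f hL => by
      rw [← Category.id_comp f, ← ρ.retract, Category.assoc,
        hom_eq_zero_of_homotopyGE_of_homotopyLE (by simp) hY hL (ρ.r ≫ f), comp_zero]⟩
  right_retracts := ⟨fun {X Y} ρ hY => homotopyLE_of_hom_eq_zero X 0 1 (by simp)
    fun L f hL => by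
      rw [← Category.comp_id f, ← ρ.retract, ← Category.assoc,
        hom_eq_zero_of_homotopyGE_of_homotopyLE (by simp) hL hY (f ≫ ρ.i), zero_comp]⟩
  left_shift Y hY := homotopyGE_mono (by simp) _ (homotopyGE_shift hY (-1) 1 (by simp))
  right_shift Y hY := homotopyLE_mono (by simp) _ (homotopyLE_shift hY 1 (-1) (by simp))
  hom_eq_zero Y Z f hY hZ := hom_eq_zero_of_homotopyGE_of_homotopyLE (by simp) hY
    (homotopyLE_shift hZ 1 (-1) (by simp)) f
  exists_triangle K := by
    obtain ⟨K, rfl⟩ := HomotopyCategory.quotient_obj_surjective K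
    obtain ⟨L, M, f, g, r, s, fr, sg, rf, fg, hL, hM⟩ :=
      exists_brutal_truncation K (-1) 0 (by simp)
    obtain ⟨h, hT⟩ := distinguished_of_degreewise_split f g r s fr sg rf fg
    let q := HomotopyCategory.quotient A (ComplexShape.up ℤ)
    -- The third vertex must have the form `ΣB` with `B` in degrees `≤ 0`: cutting between `-1` and
    -- `0`, take `B = Σ⁻¹M`.
    let e : (q.obj M)⟦(-1 : ℤ)⟧⟦(1 : ℤ)⟧ ≅ q.obj M := (shiftEquiv _ (1 : ℤ)).counitIso.app _
    refine ⟨q.obj L, (q.obj M)⟦(-1 : ℤ)⟧, q.map f, q.map g ≫ e.inv, e.hom ≫ h, ?_,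
      homotopyGE_quotient L 0, homotopyLE_shift (homotopyLE_quotient M (-1)) _ _ (by simp)⟩
    exact isomorphic_distinguished _ hT _ (Triangle.isoMk _ _ (Iso.refl _) (Iso.refl _) e
      ((Category.comp_id _).trans (Category.id_comp _).symm)
      ((Category.assoc _ _ _).trans ((congr(q.map g ≫ $(e.inv_hom_id))).trans
        ((Category.comp_id _).trans (Category.id_comp _).symm)))
      ((congr((e.hom ≫ h) ≫ $((shiftFunctor (HomotopyCategory A _) (1 : ℤ)).map_id _))).trans
        (Category.comp_id _)))

end

end CoApprox

namespace CoApprox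

/-! ### From complexes of injectives to the derived category -/

section

open DerivedCategory

/-- A retract of an injective is injective, so idempotents split as in `C`. -/
instance {C : Type v₁} [Category.{v₂} C] [Abelian C] :
    IsIdempotentComplete (InjectiveObject C) where
  idempotents_split X p hp := by
    obtain ⟨Y, i, e, h₁, h₂⟩ := IsIdempotentComplete.idempotents_split X.obj p.hom
      (congr(($hp).hom))
    have : Injective Y := Retract.injective ⟨i, e, h₁⟩
    exact ⟨⟨Y, this⟩, ⟨i⟩, ⟨e⟩, by ext; exact h₁, by ext; exact h₂⟩

lemma exists_factor_of_comp_eq_zero {T : Type v₁} [Category.{v₂} T] [HasZeroObject T]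
    [HasShift T ℤ] [Preadditive T] [∀ n : ℤ, (shiftFunctor T n).Additive] [Pretriangulated T]
    {X Y Z W : T} {f : X ⟶ Y} {g : Y ⟶ Z} {h : Z ⟶ X⟦(1 : ℤ)⟧}
    (hT : Triangle.mk f g h ∈ distTriang T) (k : Y ⟶ W) (hk : f ≫ k = 0) :
    ∃ l : Z ⟶ W, k = g ≫ l :=
  Triangle.yoneda_exact₂ _ hT k hk

lemma exists_lift_of_comp_eq_zero {T : Type v₁} [Category.{v₂} T] [HasZeroObject T]
    [HasShift T ℤ] [Preadditive T] [∀ n : ℤ, (shiftFunctor T n).Additive] [Pretriangulated T]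
    {X Y Z W : T} {f : X ⟶ Y} {g : Y ⟶ Z} {h : Z ⟶ X⟦(1 : ℤ)⟧}
    (hT : Triangle.mk f g h ∈ distTriang T) (k : W ⟶ Y) (hk : k ≫ g = 0) :
    ∃ l : W ⟶ X, k = l ≫ f :=
  Triangle.coyoneda_exact₂ _ hT k hk

lemma homotopyGE_of_distTriang {A : Type v₁} [Category.{v₂} A] [Preadditive A] [HasZeroObject A]
    [HasBinaryBiproducts A] [IsIdempotentComplete A] {n : ℤ}
    (T : Triangle (HomotopyCategory A (ComplexShape.up ℤ))) (hT : T ∈ distTriang _)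
    (h₁ : homotopyGE A n T.obj₁) (h₃ : homotopyGE A n T.obj₃) : homotopyGE A n T.obj₂ := by
  refine homotopyGE_of_hom_eq_zero _ (n - 1) n (by simp) fun L f hL => ?_
  obtain ⟨g, rfl⟩ := Triangle.yoneda_exact₂ T hT f
    (hom_eq_zero_of_homotopyGE_of_homotopyLE (by simp) h₁ hL _)
  rw [hom_eq_zero_of_homotopyGE_of_homotopyLE (by simp) h₃ hL g, comp_zero]

variable {C : Type v₁} [Category.{v₂} C] [Abelian C]

variable (C) in
/-- The inclusion of the homotopy category of complexes of injectives. -/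
noncomputable abbrev kInjToK : HomotopyCategory (InjectiveObject C) (ComplexShape.up ℤ) ⥤
    HomotopyCategory C (ComplexShape.up ℤ) :=
  (InjectiveObject.ι C).mapHomotopyCategory (ComplexShape.up ℤ)

lemma homotopyGE_kInjToK {K : HomotopyCategory (InjectiveObject C) (ComplexShape.up ℤ)} {n : ℤ}
    (hK : homotopyGE _ n K) : homotopyGE C n ((kInjToK C).obj K) := by
  obtain ⟨L, hL, ⟨e⟩⟩ := hK
  exact ⟨((InjectiveObject.ι C).mapHomologicalComplex _).obj L,
    (CochainComplex.isStrictlyGE_mapHomologicalComplex_obj_iff _ _ _).2 hL,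
    ⟨(kInjToK C).mapIso e⟩⟩

lemma homotopyLE_kInjToK {K : HomotopyCategory (InjectiveObject C) (ComplexShape.up ℤ)} {n : ℤ}
    (hK : homotopyLE _ n K) : homotopyLE C n ((kInjToK C).obj K) := by
  obtain ⟨L, hL, ⟨e⟩⟩ := hK
  exact ⟨((InjectiveObject.ι C).mapHomologicalComplex _).obj L,
    (CochainComplex.isStrictlyLE_mapHomologicalComplex_obj_iff _ _ _).2 hL,
    ⟨(kInjToK C).mapIso e⟩⟩

variable [HasDerivedCategory.{u} C]

variable (C) in
/-- The canonical functor from the homotopy category of complexes of injectives to the derived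
category. -/
noncomputable abbrev kInjToD : HomotopyCategory (InjectiveObject C) (ComplexShape.up ℤ) ⥤
    DerivedCategory C :=
  kInjToK C ⋙ Qh

/-- Bounded below complexes of injectives are K-injective. No boundedness of the source is needed.
-/
lemma Qh_map_bijective_of_homotopyGE (K : HomotopyCategory C (ComplexShape.up ℤ))
    {L : HomotopyCategory (InjectiveObject C) (ComplexShape.up ℤ)} {n : ℤ}
    (hL : homotopyGE _ n L) :
    Function.Bijective (Qh.map : (K ⟶ (kInjToK C).obj L) → _) := by
  obtain ⟨L', hL', ⟨e⟩⟩ := hL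
  let L₀ := ((InjectiveObject.ι C).mapHomologicalComplex (ComplexShape.up ℤ)).obj L'
  have : CochainComplex.IsStrictlyGE L₀ n :=
    (CochainComplex.isStrictlyGE_mapHomologicalComplex_obj_iff _ _ _).2 hL'
  have (p : ℤ) : Injective (L₀.X p) := (L'.X p).2
  have : CochainComplex.IsKInjective L₀ := CochainComplex.isKInjective_of_injective L₀ n
  have := CochainComplex.IsKInjective.Qh_map_bijective K L₀
  let e' : (kInjToK C).obj L ≅ (HomotopyCategory.quotient _ _).obj L₀ := (kInjToK C).mapIso e
  constructor
  · intro f g hfg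
    rw [← cancel_mono e'.hom]
    apply this.injective
    rw [Functor.map_comp, Functor.map_comp, hfg]
  · intro f
    obtain ⟨g, hg⟩ := this.surjective (f ≫ Qh.map e'.hom)
    refine ⟨g ≫ e'.inv, ?_⟩
    rw [Functor.map_comp, hg, Category.assoc, ← Functor.map_comp, e'.hom_inv_id,
      CategoryTheory.Functor.map_id, Category.comp_id]

lemma kInjToD_map_bijective (K : HomotopyCategory (InjectiveObject C) (ComplexShape.up ℤ))
    {L : HomotopyCategory (InjectiveObject C) (ComplexShape.up ℤ)} {n : ℤ}
    (hL : homotopyGE _ n L) :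
    Function.Bijective ((kInjToD C).map : (K ⟶ L) → _) :=
  (Qh_map_bijective_of_homotopyGE _ hL).comp
    ((Functor.FullyFaithful.ofFullyFaithful (kInjToK C)).map_bijective K L)

lemma exists_iso_of_kInjToD_iso
    {K L : HomotopyCategory (InjectiveObject C) (ComplexShape.up ℤ)} {m n : ℤ}
    (hK : homotopyGE _ m K) (hL : homotopyGE _ n L)
    (e : (kInjToD C).obj K ≅ (kInjToD C).obj L) : ∃ e' : K ≅ L, (kInjToD C).map e'.hom = e.hom := by
  obtain ⟨f, hf⟩ := (kInjToD_map_bijective K hL).surjective e.hom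
  obtain ⟨g, hg⟩ := (kInjToD_map_bijective L hK).surjective e.inv
  refine ⟨⟨f, g, (kInjToD_map_bijective K hK).injective ?_,
    (kInjToD_map_bijective L hL).injective ?_⟩, hf⟩
  · rw [Functor.map_comp, hf, hg, e.hom_inv_id, CategoryTheory.Functor.map_id]
  · rw [Functor.map_comp, hf, hg, e.inv_hom_id, CategoryTheory.Functor.map_id]

lemma exists_kInjToD_iso [EnoughInjectives C] (X : DerivedCategory C) (n : ℤ)
    (hX : X.IsGE n) : ∃ L : HomotopyCategory (InjectiveObject C) (ComplexShape.up ℤ),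
      homotopyGE _ n L ∧ Nonempty ((kInjToD C).obj L ≅ X) := by
  obtain ⟨K, hK, ⟨e⟩⟩ := exists_iso_Q_obj_of_isGE X n
  obtain ⟨L, hL, i, hi⟩ := CochainComplex.Plus.exists_quasiIso_injective ⟨K, n, hK⟩ n
  have : QuasiIso i.hom := hi
  exact ⟨(HomotopyCategory.quotient _ _).obj L.obj, homotopyGE_quotient _ _,
    ⟨(asIso (Q.map i.hom)).symm ≪≫ e.symm⟩⟩

lemma isGE_Qh_obj {K : HomotopyCategory C (ComplexShape.up ℤ)} {n : ℤ}
    (hK : homotopyGE _ n K) : (Qh.obj K).IsGE n := by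
  obtain ⟨L, hL, ⟨e⟩⟩ := hK
  have : (Q.obj L).IsGE n := (isGE_Q_obj_iff L n).2 inferInstance
  exact TStructure.t.isGE_of_iso (show Q.obj L ≅ Qh.obj K from (Qh.mapIso e).symm) n

lemma isGE_kInjToD_obj {K : HomotopyCategory (InjectiveObject C) (ComplexShape.up ℤ)} {n : ℤ}
    (hK : homotopyGE _ n K) : ((kInjToD C).obj K).IsGE n :=
  isGE_Qh_obj (homotopyGE_kInjToK hK)

/-- A bounded below complex of injectives is determined by its image in the derived category, and
that image has a resolution starting in degree `n`. The a priori bound `m` matters: unbounded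
acyclic complexes of injectives need not be contractible. -/
lemma homotopyGE_of_isGE [EnoughInjectives C]
    {K : HomotopyCategory (InjectiveObject C) (ComplexShape.up ℤ)} {m : ℤ}
    (hK : homotopyGE _ m K) (n : ℤ) (h : ((kInjToD C).obj K).IsGE n) : homotopyGE _ n K := by
  obtain ⟨L, hL, ⟨e⟩⟩ := exists_kInjToD_iso _ n h
  obtain ⟨e', -⟩ := exists_iso_of_kInjToD_iso hL hK e
  exact ObjectProperty.prop_of_iso _ e' hL

/-- A bounded below acyclic complex has no nonzero morphism up to homotopy to a complex of
injectives, even if the latter is unbounded. -/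
lemma hom_eq_zero_of_isZero_Qh {Z : HomotopyCategory C (ComplexShape.up ℤ)} {n : ℤ}
    (hZ : homotopyGE C n Z) (hZ' : IsZero (Qh.obj Z))
    {Y : HomotopyCategory (InjectiveObject C) (ComplexShape.up ℤ)}
    (f : Z ⟶ (kInjToK C).obj Y) : f = 0 := by
  obtain ⟨K, rfl⟩ := HomotopyCategory.quotient_obj_surjective Y
  -- The part of `Y` below degree `n` receives no map from `Z`, so `f` lifts to the bounded below
  -- part, which is K-injective.
  obtain ⟨L, M, i, g, r, s, fr, sg, rf, fg, hL, hM⟩ :=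
    exists_brutal_truncation K (n - 1) n (by simp)
  obtain ⟨h, hT⟩ := distinguished_of_degreewise_split i g r s fr sg rf fg
  have hT' := (kInjToK C).map_distinguished _ hT
  obtain ⟨φ, rfl⟩ := exists_lift_of_comp_eq_zero hT' f
    (hom_eq_zero_of_homotopyGE_of_homotopyLE (by simp) hZ
      (homotopyLE_kInjToK (homotopyLE_quotient M (n - 1))) _)
  have : φ = 0 := (Qh_map_bijective_of_homotopyGE Z (homotopyGE_quotient L n)).injective
    (hZ'.eq_of_src _ _)
  rw [this]
  exact zero_comp

/-- Morphisms from an injective resolution to a possibly unbounded complex of injectives. -/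
lemma precomp_bijective {P : HomotopyCategory C (ComplexShape.up ℤ)}
    {I : HomotopyCategory (InjectiveObject C) (ComplexShape.up ℤ)} {m n : ℤ}
    (hP : homotopyGE C m P) (hI : homotopyGE _ n I) (j : P ⟶ (kInjToK C).obj I)
    [IsIso (Qh.map j)] (Y : HomotopyCategory (InjectiveObject C) (ComplexShape.up ℤ)) :
    Function.Bijective fun f : I ⟶ Y => j ≫ (kInjToK C).map f := by
  -- The cone of `j` is acyclic and bounded below, so neither it nor its desuspension has nonzero
  -- maps to `Y`; these are the obstructions to injectivity and surjectivity.
  obtain ⟨Z, g, h, hT⟩ := distinguished_cocone_triangle j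
  have hZ : homotopyGE C (min (m - 1) n) Z := by
    refine homotopyGE_of_distTriang _ (rot_of_distTriang _ hT)
      (homotopyGE_mono (min_le_right _ _) _ (homotopyGE_kInjToK hI))
      (homotopyGE_mono (min_le_left _ _) _ (homotopyGE_shift hP 1 (m - 1) (by simp)))
  have hZ' : IsZero (Qh.obj Z) :=
    Triangle.isZero₃_of_isIso₁ _ (Qh.map_distinguished _ hT) (by assumption)
  have hZ₁ : homotopyGE C (1 + min (m - 1) n) (Z⟦(-1 : ℤ)⟧) := homotopyGE_shift hZ _ _ (by simp)
  have hZ₁' : IsZero (Qh.obj (Z⟦(-1 : ℤ)⟧)) :=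
    ((shiftFunctor _ (-1 : ℤ)).map_isZero hZ').of_iso ((Qh.commShiftIso (-1 : ℤ)).app Z)
  refine Function.Bijective.comp (g := fun f : (kInjToK C).obj I ⟶ (kInjToK C).obj Y => j ≫ f)
    ⟨fun f₁ f₂ hf => ?_, fun f => ?_⟩
    ((Functor.FullyFaithful.ofFullyFaithful (kInjToK C)).map_bijective I Y)
  · rw [← sub_eq_zero]
    obtain ⟨φ, hφ⟩ := exists_factor_of_comp_eq_zero hT (f₁ - f₂)
      ((Preadditive.comp_sub _ _ _).trans (sub_eq_zero.2 hf))
    rw [hφ, hom_eq_zero_of_isZero_Qh hZ hZ' φ, comp_zero]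
  · obtain ⟨φ, hφ⟩ := Triangle.yoneda_exact₂ _ (inv_rot_of_distTriang _ hT) f
      (hom_eq_zero_of_isZero_Qh hZ₁ hZ₁' _)
    exact ⟨φ, hφ.symm⟩

end

end CoApprox

namespace CoApprox

/-! ### Lifting generation from the derived category to complexes of injectives -/

section

open DerivedCategory

variable {C : Type v₁} [Category.{v₂} C] [Abelian C]
  [HasCoproducts.{w} C] [∀ I : Type w, (isInjective C).IsClosedUnderColimitsOfShape (Discrete I)]

instance : HasCoproducts.{w} (InjectiveObject C) := fun _ => inferInstance

lemma nonempty_isColimit_mapHomologicalComplex_injectiveObject {I : Type w}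
    {Y : I → CochainComplex (InjectiveObject C) ℤ} {s : Cofan Y} (hs : IsColimit s) :
    Nonempty (IsColimit (Cofan.mk
      (((InjectiveObject.ι C).mapHomologicalComplex (ComplexShape.up ℤ)).obj s.pt)
      fun i => ((InjectiveObject.ι C).mapHomologicalComplex (ComplexShape.up ℤ)).map
        (s.inj i))) := by
  refine ⟨HomologicalComplex.isColimitOfEval _ _ fun n => ?_⟩
  exact (isColimitMapCoconeCofanMkEquiv (HomologicalComplex.eval C (ComplexShape.up ℤ) n) _ _).symm
    (isColimitCofanMkObjOfIsColimit (InjectiveObject.ι C) _ _ (isColimitCofanX hs n))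

variable [HasDerivedCategory.{u} C] [∀ I : Type w, HasExactColimitsOfShape (Discrete I) C]

lemma nonempty_isColimit_kInjToD {I : Type w}
    {Y : I → CochainComplex (InjectiveObject C) ℤ} {s : Cofan Y} (hs : IsColimit s) :
    Nonempty (IsColimit (Cofan.mk
      ((kInjToD C).obj ((HomotopyCategory.quotient _ _).obj s.pt))
      fun i => (kInjToD C).map ((HomotopyCategory.quotient _ _).map (s.inj i)))) := by
  obtain ⟨h⟩ := nonempty_isColimit_mapHomologicalComplex_injectiveObject hs
  exact nonempty_isColimit_Q h

/-- The lower bound on the shifts keeps the coproduct of shifts of `H` bounded below. Its formation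
on complexes gives the coproduct both in the homotopy category and in the derived category. -/
lemma exists_lift_of_bigAdd {H : HomotopyCategory (InjectiveObject C) (ComplexShape.up ℤ)}
    {a l : ℤ} (hH : homotopyGE _ a H) {G : DerivedCategory C} (e : (kInjToD C).obj H ≅ G)
    {S : Set ℤ} (hS : ∀ i ∈ S, l ≤ i) {B : DerivedCategory C}
    (hB : bigAdd.{w} (shiftsIn G S) B) :
    ∃ B' : HomotopyCategory (InjectiveObject C) (ComplexShape.up ℤ), homotopyGE _ (a + l) B' ∧
      bigAdd.{w} (shiftsIn H S) B' ∧ Nonempty ((kInjToD C).obj B' ≅ B) := by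
  obtain ⟨I, n, hn, ι, ⟨hι⟩⟩ := exists_cofan_of_bigAdd hB
  choose K hK eK using fun i : I =>
    homotopyGE_mono (m := a + l) (by have := hS _ (hn i); lia) _
      (homotopyGE_shift hH (-n i) (a + n i) (by lia))
  let e₁ (i : I) := (eK i).some
  have hs := coproductIsCoproduct K
  obtain ⟨h₁⟩ := nonempty_isColimit_quotient hs
  obtain ⟨h₂⟩ := nonempty_isColimit_kInjToD hs
  refine ⟨(HomotopyCategory.quotient _ _).obj (∐ K), ?_, ?_, ⟨?_⟩⟩
  · have : CochainComplex.IsStrictlyGE (∐ K) (a + l) := isStrictlyGE_of_isColimit hK hs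
    exact homotopyGE_quotient _ _
  · exact bigAdd_of_isColimit h₁ fun i => ⟨n i, hn i, ⟨(e₁ i).symm⟩⟩
  · exact IsColimit.coconePointsIsoOfNatIso h₂ hι (Discrete.natIso fun i =>
      (kInjToD C).mapIso (e₁ i.as).symm ≪≫ ((kInjToD C).commShiftIso (-n i.as)).app H ≪≫
        (shiftFunctor _ (-n i.as)).mapIso e)

/-- The connecting map of each extension lifts because its target is bounded below; completing the
lift to a triangle gives the lifted extension. -/
lemma exists_lift_of_extensionProductIter
    {H : HomotopyCategory (InjectiveObject C) (ComplexShape.up ℤ)}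
    {a l : ℤ} (hH : homotopyGE _ a H) {G : DerivedCategory C} (e : (kInjToD C).obj H ≅ G)
    {S : Set ℤ} (hS : ∀ i ∈ S, l ≤ i) (n : ℕ) {B : DerivedCategory C}
    (hB : (bigAdd.{w} (shiftsIn G S)).extensionProductIter n B) :
    ∃ B' : HomotopyCategory (InjectiveObject C) (ComplexShape.up ℤ), homotopyGE _ (a + l) B' ∧
      (bigAdd.{w} (shiftsIn H S)).extensionProductIter n B' ∧
      Nonempty ((kInjToD C).obj B' ≅ B) := by
  induction n generalizing B with
  | zero => exact exists_lift_of_bigAdd hH e hS hB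
  | succ n ih =>
    rw [ObjectProperty.extensionProductIter_succ] at hB
    obtain ⟨X, Z, f, g, h, hT, hX, hZ⟩ := hB
    obtain ⟨X', hX₁, hX₂, ⟨eX⟩⟩ := exists_lift_of_bigAdd hH e hS hX
    obtain ⟨Z', hZ₁, hZ₂, ⟨eZ⟩⟩ := ih hZ
    let eX₁ : (kInjToD C).obj (X'⟦(1 : ℤ)⟧) ≅ X⟦(1 : ℤ)⟧ :=
      ((kInjToD C).commShiftIso (1 : ℤ)).app X' ≪≫ (shiftFunctor _ (1 : ℤ)).mapIso eX
    obtain ⟨h', hh'⟩ := (kInjToD_map_bijective Z'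
      (homotopyGE_shift hX₁ 1 (a + l - 1) (by lia))).surjective (eZ.hom ≫ h ≫ eX₁.inv)
    obtain ⟨B', f', g', hT'⟩ := distinguished_cocone_triangle₂ h'
    refine ⟨B', homotopyGE_of_distTriang _ hT' hX₁ hZ₁, ?_, ⟨?_⟩⟩
    · rw [ObjectProperty.extensionProductIter_succ]
      exact ⟨X', Z', f', g', h', hT', hX₂, hZ₂⟩
    · have hcomm : ((kInjToD C).map h' ≫ ((kInjToD C).commShiftIso (1 : ℤ)).hom.app X') ≫
          (shiftFunctor _ (1 : ℤ)).map eX.hom = eZ.hom ≫ h := by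
        rw [hh', Category.assoc]
        change (eZ.hom ≫ h ≫ eX₁.inv) ≫ eX₁.hom = _
        simp
      exact Triangle.π₂.mapIso (isoTriangleOfIso₁₃ _ _ ((kInjToD C).map_distinguished _ hT') hT
        eX eZ hcomm)

/-- Both the lifted extension and `M` are bounded below, so the two maps of a retract, and the
relation between them, lift too. -/
lemma bigGen_of_bigGen_kInjToD
    {H M : HomotopyCategory (InjectiveObject C) (ComplexShape.up ℤ)}
    {a l m : ℤ} (hH : homotopyGE _ a H) (hM : homotopyGE _ m M) {G : DerivedCategory C}
    (e : (kInjToD C).obj H ≅ G) {S : Set ℤ} (hS : ∀ i ∈ S, l ≤ i) {n : ℕ} (hn : 0 < n)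
    (h : bigGen.{w} G S n ((kInjToD C).obj M)) : bigGen.{w} H S n M := by
  obtain ⟨n, rfl⟩ := Nat.exists_eq_succ_of_ne_zero hn.ne'
  obtain ⟨B, hB, ⟨r⟩⟩ := h
  obtain ⟨B', hB₁, hB₂, ⟨eB⟩⟩ := exists_lift_of_extensionProductIter hH e hS n hB
  obtain ⟨i, hi⟩ := (kInjToD_map_bijective M hB₁).surjective (r.i ≫ eB.inv)
  obtain ⟨p, hp⟩ := (kInjToD_map_bijective B' hM).surjective (eB.hom ≫ r.r)
  refine ⟨B', hB₂, ⟨⟨i, p, (kInjToD_map_bijective M hM).injective ?_⟩⟩⟩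
  rw [Functor.map_comp, hi, hp, CategoryTheory.Functor.map_id, Category.assoc,
    eB.inv_hom_id_assoc, r.retract]

end

end CoApprox

namespace CoApprox

/-! ### Compact generation of the homotopy category of complexes of injectives -/

section

variable {C : Type v₁} [Category.{v₂} C] [Preadditive C]

lemma inj_cofanTrunc_of_notMem {I : Type*} {Y : I → C} {c : Cofan Y} (hc : IsColimit c)
    {S : Finset I} {i : I} (hi : i ∉ S) : c.inj i ≫ cofanTrunc hc S = 0 := by
  rw [cofanTrunc, Preadditive.comp_sum]
  refine Finset.sum_eq_zero fun j hj => ?_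
  rw [← Category.assoc, inj_cofanProj_of_ne hc (ne_of_mem_of_not_mem hj hi).symm, zero_comp]

lemma map_cofanTrunc {D : Type*} [Category D] [Preadditive D] (F : C ⥤ D) [F.Additive]
    {I : Type*} {Y : I → C} {c : Cofan Y} (hc : IsColimit c)
    (hc' : IsColimit (Cofan.mk (F.obj c.pt) fun i => F.map (c.inj i))) (S : Finset I) :
    F.map (cofanTrunc hc S) = cofanTrunc hc' S := by
  refine Cofan.IsColimit.hom_ext hc' _ _ fun i => ?_
  by_cases hi : i ∈ S
  · exact (F.map_comp _ _).symm.trans ((F.congr_map (inj_cofanTrunc_of_mem hc hi)).trans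
      (inj_cofanTrunc_of_mem hc' hi).symm)
  · exact (F.map_comp _ _).symm.trans ((F.congr_map (inj_cofanTrunc_of_notMem hc hi)).trans
      ((F.map_zero _ _).trans (inj_cofanTrunc_of_notMem hc' hi).symm))

lemma IsFinitelySupported.of_exists {G : C}
    (h : ∀ (I : Type w) (Y : I → C), ∃ (c : Cofan Y) (hc : IsColimit c), ∀ f : G ⟶ c.pt,
      ∃ S : Finset I, f ≫ cofanTrunc hc S = f) : IsFinitelySupported.{w} G := by
  intro I Y c' hc' f
  obtain ⟨c, hc, hf⟩ := h I Y
  let e : c.pt ≅ c'.pt := IsColimit.coconePointUniqueUpToIso hc hc'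
  have he (i : I) : c'.inj i ≫ e.inv = c.inj i :=
    IsColimit.comp_coconePointUniqueUpToIso_inv hc hc' ⟨i⟩
  obtain ⟨S, hS⟩ := hf (f ≫ e.inv)
  have hcomm : cofanTrunc hc' S ≫ e.inv = e.inv ≫ cofanTrunc hc S := by
    refine Cofan.IsColimit.hom_ext hc' _ _ fun i => ?_
    rw [reassoc_of% he i]
    by_cases hi : i ∈ S
    · rw [inj_cofanTrunc_of_mem hc hi, ← Category.assoc, inj_cofanTrunc_of_mem hc' hi, he]
    · rw [inj_cofanTrunc_of_notMem hc hi, ← Category.assoc, inj_cofanTrunc_of_notMem hc' hi,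
        zero_comp]
  refine ⟨S, ?_⟩
  rw [← cancel_mono e.inv, Category.assoc, hcomm, ← Category.assoc, hS]

end

section

variable {T : Type v₁} [Category.{v₂} T] [HasZeroObject T] [HasShift T ℤ] [Preadditive T]
  [∀ n : ℤ, (shiftFunctor T n).Additive] [Pretriangulated T]

lemma hom_shift_eq_zero {H Y : T} (h : ∀ (n : ℤ) (f : H⟦n⟧ ⟶ Y), f = 0) (i m : ℤ)
    (f : H⟦i⟧ ⟶ Y⟦m⟧) : f = 0 := by
  apply (shiftFunctor T (-m)).map_injective
  let e : (Y⟦m⟧)⟦-m⟧ ≅ Y := (shiftEquiv T m).unitIso.symm.app Y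
  rw [Functor.map_zero, ← cancel_epi ((shiftFunctorAdd T i (-m)).hom.app H), ← cancel_mono e.hom]
  exact (h _ _).trans (by simp)

/-- The objects generated by `H` have no nonzero morphisms to the objects which are right
orthogonal to the shifts of `H`. -/
lemma hom_eq_zero_of_bigGen {H Y : T} (h : ∀ (n : ℤ) (f : H⟦n⟧ ⟶ Y), f = 0) {S : Set ℤ} {n : ℕ}
    (hn : 0 < n) {X : T} (hX : bigGen.{w} H S n X) (m : ℤ) (f : X ⟶ Y⟦m⟧) : f = 0 := by
  obtain ⟨n, rfl⟩ := Nat.exists_eq_succ_of_ne_zero hn.ne'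
  have h₀ {B : T} (hB : bigAdd.{w} (shiftsIn H S) B) (g : B ⟶ Y⟦m⟧) : g = 0 := by
    obtain ⟨I, k, -, ι, ⟨hι⟩⟩ := exists_cofan_of_bigAdd hB
    exact Cofan.IsColimit.hom_ext hι _ _ fun i =>
      (hom_shift_eq_zero h _ _ _).trans (hom_shift_eq_zero h _ _ _).symm
  have h₁ (n : ℕ) {B : T} (hB : (bigAdd.{w} (shiftsIn H S)).extensionProductIter n B)
      (g : B ⟶ Y⟦m⟧) : g = 0 := by
    induction n generalizing B with
    | zero => exact h₀ hB g
    | succ n ih =>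
      rw [ObjectProperty.extensionProductIter_succ] at hB
      obtain ⟨A, Z, i, p, δ, hT, hA, hZ⟩ := hB
      obtain ⟨l, rfl⟩ := exists_factor_of_comp_eq_zero hT g (h₀ hA _)
      rw [ih hZ l, comp_zero]
  obtain ⟨B, hB, ⟨r⟩⟩ := hX
  rw [← Category.id_comp f, ← r.retract, Category.assoc, h₁ n hB (r.r ≫ f), comp_zero]

end

section

open DerivedCategory

variable {C : Type v₁} [Category.{v₂} C] [Abelian C]

/-- A complex is contractible if the inclusions of its cycles lift along the differential. -/
lemma nonempty_homotopy_id_zero (K : CochainComplex C ℤ)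
    (h : ∀ p q : ℤ, p + 1 = q → ∃ s : kernel (K.d q (q + 1)) ⟶ K.X p,
      s ≫ K.d p q = kernel.ι (K.d q (q + 1))) : Nonempty (Homotopy (𝟙 K) 0) := by
  choose h hh using h
  let a (p : ℤ) : K.X p ⟶ kernel (K.d (p + 1) (p + 1 + 1)) := kernel.lift _ (K.d p (p + 1)) (by simp)
  have ha (p : ℤ) : a p ≫ kernel.ι _ = K.d p (p + 1) := kernel.lift_ι _ _ _
  -- `a` is the differential with values in cycles and `h` is a section of it, so `1 - a h` retracts
  -- each term onto its cycles. The contraction is this retraction followed by `h`.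
  let b (p : ℤ) : K.X p ⟶ kernel (K.d p (p + 1)) :=
    kernel.lift _ (𝟙 _ - a p ≫ h p (p + 1) rfl) (by
      rw [Preadditive.sub_comp, Category.assoc, hh, ha, Category.id_comp, sub_self])
  have hb (p : ℤ) : b p ≫ kernel.ι _ = 𝟙 _ - a p ≫ h p (p + 1) rfl := kernel.lift_ι _ _ _
  have hdb (p : ℤ) : K.d p (p + 1) ≫ b (p + 1) = a p := by
    have hda : K.d p (p + 1) ≫ a (p + 1) = 0 := by
      rw [← cancel_mono (kernel.ι _), Category.assoc, ha, K.d_comp_d, zero_comp]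
    rw [← cancel_mono (kernel.ι _), Category.assoc, hb, ha, Preadditive.comp_sub, ← Category.assoc,
      hda, zero_comp, sub_zero, Category.comp_id]
  let s (p q : ℤ) (hqp : (ComplexShape.up ℤ).Rel q p) : K.X p ⟶ K.X q := b p ≫ h q p hqp
  refine ⟨(Homotopy.ofEq ?_).trans (Homotopy.nullHomotopy' s)⟩
  ext p
  rw [Homotopy.nullHomotopicMap'_f (k₂ := p - 1) (k₀ := p + 1) (sub_add_cancel p 1) rfl]
  simp only [s, Category.assoc, hh, hb, reassoc_of% hdb, HomologicalComplex.id_f]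
  abel

variable [HasDerivedCategory.{u} C]

/-- A complex of injectives which receives only trivial morphisms from bounded below complexes
of injectives is contractible. -/
lemma isZero_of_hom_eq_zero [EnoughInjectives C]
    (Y : HomotopyCategory (InjectiveObject C) (ComplexShape.up ℤ))
    (hY : ∀ (M : C) (n : ℤ) (X : HomotopyCategory (InjectiveObject C) (ComplexShape.up ℤ))
      (_ : homotopyGE _ n X) (_ : (kInjToD C).obj X ≅ (singleFunctor C n).obj M) (f : X ⟶ Y),
        f = 0) : IsZero Y := by
  obtain ⟨K, rfl⟩ := HomotopyCategory.quotient_obj_surjective Y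
  let K' : CochainComplex C ℤ :=
    ((InjectiveObject.ι C).mapHomologicalComplex (ComplexShape.up ℤ)).obj K
  obtain ⟨H⟩ := nonempty_homotopy_id_zero K' fun p q hpq => by
    let Z := kernel (K'.d q (q + 1))
    let P : CochainComplex C ℤ := (HomologicalComplex.single C (ComplexShape.up ℤ) q).obj Z
    -- The cycles in degree `q`, as a complex in that degree, map to `K'`. This map comes from a map
    -- out of their injective resolution, so it is null-homotopic, and the homotopy lifts the cycles
    -- through degree `p = q - 1`.
    let φ : P ⟶ K' := HomologicalComplex.mkHomFromSingle (kernel.ι (K'.d q (q + 1)))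
      (by rintro _ rfl; exact kernel.condition _)
    have hP : P.IsStrictlyGE q := inferInstanceAs
      (CochainComplex.IsStrictlyGE ((HomologicalComplex.single C (ComplexShape.up ℤ) q).obj Z) q)
    obtain ⟨L, hL, i, hi⟩ := CochainComplex.Plus.exists_quasiIso_injective ⟨P, q, hP⟩ q
    have : QuasiIso i.hom := hi
    let X := (HomotopyCategory.quotient _ (ComplexShape.up ℤ)).obj L.obj
    let j : (HomotopyCategory.quotient _ _).obj P ⟶ (kInjToK C).obj X :=
      (HomotopyCategory.quotient _ _).map i.hom
    have hj : IsIso (Qh.map j) := inferInstanceAs (IsIso (Q.map i.hom))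
    obtain ⟨f, hf⟩ := (precomp_bijective (homotopyGE_quotient P q) (homotopyGE_quotient L.obj q) j
      ((HomotopyCategory.quotient _ _).obj K)).surjective ((HomotopyCategory.quotient _ _).map φ)
    have hf₀ : f = 0 := hY Z q X (homotopyGE_quotient L.obj q)
      ((asIso (Q.map i.hom)).symm ≪≫ ((singleFunctorIsoCompQ C q).app Z).symm) f
    have hφ : (HomotopyCategory.quotient _ _).map φ = (HomotopyCategory.quotient _ _).map 0 := by
      have : j ≫ (kInjToK C).map f = 0 := by rw [hf₀, Functor.map_zero, comp_zero]
      exact hf.symm.trans (this.trans (Functor.map_zero _ _ _).symm)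
    let k := HomotopyCategory.homotopyOfEq _ _ hφ
    refine ⟨(HomologicalComplex.singleObjXSelf _ q Z).inv ≫ k.hom q p, ?_⟩
    have hk := k.comm q
    rw [dNext_eq k.hom (show (ComplexShape.up ℤ).Rel q (q + 1) from rfl),
      prevD_eq k.hom (show (ComplexShape.up ℤ).Rel p q from hpq),
      HomologicalComplex.zero_f, add_zero, HomologicalComplex.single_obj_d, zero_comp, zero_add,
      HomologicalComplex.mkHomFromSingle_f] at hk
    rw [Category.assoc, ← hk, Iso.inv_hom_id_assoc]
  have h₀ : IsZero ((kInjToK C).obj ((HomotopyCategory.quotient _ _).obj K)) := by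
    rw [IsZero.iff_id_eq_zero]
    have := HomotopyCategory.eq_of_homotopy _ _ H
    rw [CategoryTheory.Functor.map_id, Functor.map_zero] at this
    exact this
  rw [IsZero.iff_id_eq_zero]
  exact (kInjToK C).map_injective (h₀.eq_of_src _ _)

variable [HasCoproducts.{w} C]
  [∀ I : Type w, (isInjective C).IsClosedUnderColimitsOfShape (Discrete I)]

/-- Injective resolutions of finitely supported objects are finitely supported. -/
lemma isFinitelySupported_of_single {M : C} (hM : IsFinitelySupported.{w} M)
    {X : HomotopyCategory (InjectiveObject C) (ComplexShape.up ℤ)} {n p : ℤ}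
    (hX : homotopyGE _ n X) (e : (kInjToD C).obj X ≅ (singleFunctor C p).obj M) :
    IsFinitelySupported.{w} X := by
  let P : CochainComplex C ℤ := (HomologicalComplex.single C (ComplexShape.up ℤ) p).obj M
  have hP : P.IsStrictlyGE p := inferInstanceAs
    (CochainComplex.IsStrictlyGE ((HomologicalComplex.single C (ComplexShape.up ℤ) p).obj M) p)
  let q := HomotopyCategory.quotient C (ComplexShape.up ℤ)
  let e' : Qh.obj (q.obj P) ≅ Qh.obj ((kInjToK C).obj X) :=
    ((singleFunctorIsoCompQ C p).app M).symm ≪≫ e.symm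
  obtain ⟨j, hj⟩ := (Qh_map_bijective_of_homotopyGE (q.obj P) hX).surjective e'.hom
  have : IsIso (Qh.map j) := by rw [hj]; infer_instance
  refine .of_exists fun I Y => ?_
  choose K hK using fun i => HomotopyCategory.quotient_obj_surjective (Y i)
  obtain rfl : (fun i => (HomotopyCategory.quotient _ _).obj (K i)) = Y := funext hK
  let s : Cofan K := Cofan.mk (∐ K) (Sigma.ι K)
  have hs : IsColimit s := coproductIsCoproduct K
  obtain ⟨hc⟩ := nonempty_isColimit_quotient hs
  refine ⟨_, hc, fun f => ?_⟩
  let F := (InjectiveObject.ι C).mapHomologicalComplex (ComplexShape.up ℤ)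
  obtain ⟨φ, hφ⟩ := q.map_surjective (Y := F.obj s.pt) (j ≫ (kInjToK C).map f)
  let ev : CochainComplex (InjectiveObject C) ℤ ⥤ C :=
    HomologicalComplex.eval _ _ p ⋙ InjectiveObject.ι C
  have hp : IsColimit (Cofan.mk (ev.obj s.pt) fun i => ev.map (s.inj i)) :=
    isColimitCofanMkObjOfIsColimit (InjectiveObject.ι C) _ _ (isColimitCofanX hs p)
  -- A chain map from `M` in degree `p` is determined by its component there. Finite support is thus
  -- a statement about one map in `C`, and holds for chain maps before passing to homotopy.
  obtain ⟨S, hS⟩ := hM I _ _ hp ((HomologicalComplex.singleObjXSelf _ p M).inv ≫ φ.f p)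
  refine ⟨S, ?_⟩
  have hS' : φ ≫ F.map (cofanTrunc hs S) = φ := by
    apply HomologicalComplex.from_single_hom_ext
    exact (cancel_epi (HomologicalComplex.singleObjXSelf (ComplexShape.up ℤ) p M).inv).1
      ((Category.assoc _ _ _).symm.trans
        ((congrArg (fun t => _ ≫ t) (map_cofanTrunc ev hs hp S)).trans hS))
  apply (precomp_bijective (homotopyGE_quotient P p) hX j _).injective
  have hct := map_cofanTrunc (HomotopyCategory.quotient (InjectiveObject C) (ComplexShape.up ℤ))
    hs hc S
  have h₁ : j ≫ (kInjToK C).map (f ≫ cofanTrunc hc S) = (j ≫ (kInjToK C).map f) ≫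
      (kInjToK C).map ((HomotopyCategory.quotient _ _).map (cofanTrunc hs S)) := by
    rw [← hct]
    exact (congrArg (fun t => j ≫ t) ((kInjToK C).map_comp _ _)).trans
      (Category.assoc _ _ _).symm
  exact h₁.trans ((congrArg (fun t => t ≫ _) hφ.symm).trans
    (((q.map_comp _ _).symm.trans (q.congr_map hS')).trans hφ))

/-- Induction on the cohomological amplitude: the truncation triangle splits off the lowest
cohomology object, and lifts to complexes of injectives. -/
lemma isFinitelySupported_of_isGE_of_isLE [EnoughInjectives C] (k : ℕ)
    (X : DerivedCategory C) (a : ℤ) (ha : X.IsGE a) (hb : X.IsLE (a + k))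
    (hX : ∀ n : ℤ, IsFinitelySupported.{w} ((homologyFunctor C n).obj X))
    {L : HomotopyCategory (InjectiveObject C) (ComplexShape.up ℤ)} {n : ℤ}
    (hL : homotopyGE _ n L) (e : (kInjToD C).obj L ≅ X) : IsFinitelySupported.{w} L := by
  induction k generalizing X a L n with
  | zero =>
    have : X.IsLE a := by simpa using hb
    obtain ⟨M, ⟨e'⟩⟩ := exists_iso_singleFunctor_obj_of_isGE_of_isLE X a
    refine isFinitelySupported_of_single ?_ hL (e ≪≫ e')
    refine (hX a).of_iso ((homologyFunctor C a).mapIso e' ≪≫ ?_)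
    exact (homologyFunctor C a).mapIso ((singleFunctorIsoCompQ C a).app M) ≪≫
      (homologyFunctorFactors C a).app _ ≪≫
      (HomologicalComplex.homologyFunctorSingleIso C (ComplexShape.up ℤ) a).app M
  | succ k ih =>
    obtain ⟨A, B, hA, hB, f, g, h, hT⟩ := TStructure.t.exists_triangle X a (a + 1) rfl
    have hA' : A.IsLE a := ⟨hA⟩
    have hB' : B.IsGE (a + 1) := ⟨hB⟩
    have hB₁ : TStructure.t.IsGE (B⟦(-1 : ℤ)⟧) a :=
      have := TStructure.t.isGE_shift B (a + 1) (-1) (a + 2)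
      TStructure.t.isGE_of_ge _ a (a + 2)
    have hA'' : A.IsGE a := TStructure.t.isGE₂ _ (inv_rot_of_distTriang _ hT) a hB₁ ha
    have hA₁ : TStructure.t.IsLE (A⟦(1 : ℤ)⟧) (a + (k + 1 : ℕ)) :=
      have := TStructure.t.isLE_shift A a 1 (a - 1)
      TStructure.t.isLE_of_le _ (a - 1) _ (by lia)
    have hB'' : B.IsLE (a + (k + 1 : ℕ)) :=
      TStructure.t.isLE₂ _ (rot_of_distTriang _ hT) _ hb hA₁
    have hXA (n : ℤ) : IsFinitelySupported.{w} ((homologyFunctor C n).obj A) := by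
      by_cases hn : n = a
      · subst hn
        have hm : Mono ((homologyFunctor C n).map f) :=
          (HomologySequence.mono_homologyMap_mor₁_iff _ hT (n - 1) n (by simp)).2
            ((isZero_of_isGE B (n + 1) (n - 1) (by lia)).eq_of_src _ _)
        have he : Epi ((homologyFunctor C n).map f) :=
          (HomologySequence.epi_homologyMap_mor₁_iff _ hT n).2
            ((isZero_of_isGE B (n + 1) n (by lia)).eq_of_tgt _ _)
        have := isIso_of_mono_of_epi ((homologyFunctor C n).map f)
        exact (hX n).of_iso (asIso ((homologyFunctor C n).map f)).symm
      · refine .of_isZero ?_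
        by_cases hn' : n < a
        · exact isZero_of_isGE A a n hn'
        · exact isZero_of_isLE A a n (by lia)
    have hXB (n : ℤ) : IsFinitelySupported.{w} ((homologyFunctor C n).obj B) := by
      by_cases hn : n < a + 1
      · exact .of_isZero (isZero_of_isGE B (a + 1) n hn)
      · have hm : Mono ((homologyFunctor C n).map g) :=
          (HomologySequence.mono_homologyMap_mor₂_iff _ hT n).2
            ((isZero_of_isLE A a n (by lia)).eq_of_src _ _)
        have he : Epi ((homologyFunctor C n).map g) :=
          (HomologySequence.epi_homologyMap_mor₂_iff _ hT n (n + 1) rfl).2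
            ((isZero_of_isLE A a (n + 1) (by lia)).eq_of_tgt _ _)
        have := isIso_of_mono_of_epi ((homologyFunctor C n).map g)
        exact (hX n).of_iso (asIso ((homologyFunctor C n).map g))
    obtain ⟨A', hA₂, ⟨eA⟩⟩ := exists_kInjToD_iso A a hA''
    obtain ⟨f', hf'⟩ := (kInjToD_map_bijective A' hL).surjective (eA.hom ≫ f ≫ e.inv)
    -- The cone of the lifted map is bounded below and resolves `B`, so no separate resolution of
    -- `B` is needed.
    obtain ⟨B', g', h', hT'⟩ := distinguished_cocone_triangle f'
    have hB₂ : homotopyGE _ (min n (a - 1)) B' := by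
      refine homotopyGE_of_distTriang _ (rot_of_distTriang _ hT')
        (homotopyGE_mono (min_le_left _ _) _ hL)
        (homotopyGE_mono (min_le_right _ _) _ (homotopyGE_shift hA₂ 1 (a - 1) (by simp)))
    have eB : (kInjToD C).obj B' ≅ B := Triangle.π₃.mapIso
      (isoTriangleOfIso₁₂ _ _ ((kInjToD C).map_distinguished _ hT') hT eA e (by
        change (kInjToD C).map f' ≫ e.hom = eA.hom ≫ f
        rw [hf']; simp))
    refine IsFinitelySupported.of_distTriang _ hT' ?_ ?_
    · refine ih A a hA'' ?_ hXA hA₂ eA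
      exact TStructure.t.isLE_of_le _ a _ (by lia)
    · exact ih B (a + 1) hB' (by
        have : a + 1 + (k : ℤ) = a + (k + 1 : ℕ) := by push_cast; ring
        rw [this]; exact hB'') hXB hB₂ eB

end

end CoApprox

/-! ### Approximation and the abstract co-approximability criterion -/

namespace CoApprox

section

open DerivedCategory

variable {C : Type v₁} [Category.{v₂} C] [Abelian C] [HasDerivedCategory.{u} C]
  [EnoughInjectives C]

/-- Objects of the homotopy category of complexes of injectives which are `≥ 0` can be
approximated by injective resolutions of objects of the abelian category. -/
lemma exists_approximation (F : HomotopyCategory (InjectiveObject C) (ComplexShape.up ℤ))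
    (hF : homotopyGE _ 0 F) :
    ∃ (E D : HomotopyCategory (InjectiveObject C) (ComplexShape.up ℤ)) (f : E ⟶ F) (g : F ⟶ D)
      (h : D ⟶ E⟦(1 : ℤ)⟧), Triangle.mk f g h ∈ distTriang _ ∧
        homotopyGE _ 0 (D⟦(1 : ℤ)⟧) ∧ homotopyGE _ 0 E ∧ ((kInjToD C).obj E).IsLE 0 := by
  have hF' := isGE_kInjToD_obj hF
  -- Truncation for the t-structure, not the brutal one, which would put the part in degrees `≥ 1`
  -- on the wrong side of the triangle.
  obtain ⟨A, B, hA, hB, f, g, h, hT⟩ :=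
    TStructure.t.exists_triangle ((kInjToD C).obj F) 0 1 (by simp)
  have hA' : TStructure.t.IsLE A 0 := ⟨hA⟩
  have hB' : B.IsGE 1 := ⟨hB⟩
  have hB₁ : TStructure.t.IsGE (B⟦(-1 : ℤ)⟧) 0 :=
    have := TStructure.t.isGE_shift B 1 (-1) 2
    TStructure.t.isGE_of_ge _ 0 2
  have hA'' : A.IsGE 0 := TStructure.t.isGE₂ _ (inv_rot_of_distTriang _ hT) 0 hB₁ hF'
  obtain ⟨E, hE, ⟨e⟩⟩ := exists_kInjToD_iso A 0 hA''
  obtain ⟨f', hf'⟩ := (kInjToD_map_bijective E hF).surjective (e.hom ≫ f)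
  obtain ⟨D, g', h', hT'⟩ := distinguished_cocone_triangle f'
  have hD : homotopyGE _ (-1) D := by
    refine homotopyGE_of_distTriang _ (rot_of_distTriang _ hT')
      (homotopyGE_mono (by simp) _ hF) (homotopyGE_shift hE 1 (-1) (by simp))
  have eD : (kInjToD C).obj D ≅ B := Triangle.π₃.mapIso
    (isoTriangleOfIso₁₂ _ _ ((kInjToD C).map_distinguished _ hT') hT e (Iso.refl _)
      ((Category.comp_id _).trans hf'))
  -- As a cone, `D` is only known to be `≥ -1`; the vanishing of its cohomology below degree `1`
  -- improves the bound.
  have hD' : homotopyGE _ 1 D :=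
    homotopyGE_of_isGE hD 1 (TStructure.t.isGE_of_iso eD.symm 1)
  exact ⟨E, D, f', g', h', hT', homotopyGE_shift hD' 1 0 (by simp), hE,
    TStructure.t.isLE_of_iso e.symm 0⟩

variable [HasCoproducts.{w} C] [∀ I : Type w, HasExactColimitsOfShape (Discrete I) C]
  [∀ I : Type w, (isInjective C).IsClosedUnderColimitsOfShape (Discrete I)]

/-- If the derived category of an abelian category is generated in finitely many steps by a
bounded complex with finitely supported cohomology, then the homotopy category of complexes of
injectives is co-approximable. -/
theorem isCoapproximableVia_of_bigGen_eq_top (G : DerivedCategory C) (a b : ℤ) (ha : G.IsGE a)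
    (hb : G.IsLE b) (hG : ∀ n : ℤ, IsFinitelySupported.{w} ((homologyFunctor C n).obj G))
    (N : ℕ) (hN : 0 < N) (hgen : bigGen.{w} G Set.univ N = ⊤) :
    IsCoapproximableVia.{w} (homotopyGE (InjectiveObject C) 0)
      (homotopyLE (InjectiveObject C) 0) := by
  have : HasCoproducts.{w} (DerivedCategory C) := hasCoproducts_derivedCategory C
  obtain ⟨H, hH, ⟨e⟩⟩ := exists_kInjToD_iso G a ha
  -- The interval `[l, k]` depends on the amplitude only, not on `M`.
  have key (m m' : ℤ) : ∃ l k : ℤ, ∀ M : HomotopyCategory (InjectiveObject C) (ComplexShape.up ℤ),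
      homotopyGE _ m M → ((kInjToD C).obj M).IsLE m' → bigGen.{w} H (Set.Icc l k) N M := by
    obtain ⟨l, k, hlk⟩ := exists_Icc_bigGen.{w} (coproductStableGE_derivedCategory C) ha hb hN m m'
    exact ⟨l, k, fun M hM hM' => bigGen_of_bigGen_kInjToD hH hM e (fun i hi => hi.1) hN
      (hlk _ (isGE_kInjToD_obj hM) hM' (by rw [hgen]; trivial))⟩
  obtain ⟨l, k, hlk⟩ := key 0 0
  -- Large enough for all conditions: `a + A ≥ 0`, `b - A < 0` (using `N > 0`), `[l, k] ⊆ [-A, A]`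
  -- and `N ≤ A`.
  let A : ℕ := N + a.natAbs + b.natAbs + l.natAbs + k.natAbs
  refine ⟨hasCoproducts_homotopyCategory, isCoTStructure_homotopyCategory, H, A, ⟨?_, ?_⟩,
    by lia, ?_, ?_, ?_⟩
  · refine (isFinitelySupported_of_isGE_of_isLE (b - a).natAbs G a ha ?_ hG hH e).isCompactObj
    exact TStructure.t.isLE_of_le _ b _ (by lia)
  · intro Y hY
    refine isZero_of_hom_eq_zero Y fun M n X hX eX f => ?_
    -- The interval may vary with `n` here: it is enough that each resolution is generated by `H`.
    obtain ⟨l, k, hlk⟩ := key n n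
    have hX' : ((kInjToD C).obj X).IsLE n :=
      have : ((singleFunctor C n).obj M).IsLE n := inferInstance
      TStructure.t.isLE_of_iso eX.symm n
    rw [← cancel_mono ((shiftFunctorZero _ ℤ).inv.app Y)]
    exact (hom_eq_zero_of_bigGen hY hN (hlk X hX hX') 0 _).trans zero_comp.symm
  · exact homotopyGE_mono (by lia) _ (homotopyGE_shift hH (-(A : ℤ)) (a + A) (by lia))
  · intro F f hF
    apply (kInjToD_map_bijective _ hF).injective
    have h₁ : TStructure.t.IsLE ((kInjToD C).obj (H⟦(A : ℤ)⟧)) (b - A) :=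
      have : TStructure.t.IsLE (G⟦(A : ℤ)⟧) (b - A) := TStructure.t.isLE_shift G b A (b - A)
      TStructure.t.isLE_of_iso
        (((kInjToD C).commShiftIso (A : ℤ)).app H ≪≫ (shiftFunctor _ (A : ℤ)).mapIso e).symm _
    have h₂ : TStructure.t.IsGE ((kInjToD C).obj F) 0 := isGE_kInjToD_obj hF
    rw [Functor.map_zero]
    exact TStructure.t.zero _ (b - A) 0 (by lia)
  · intro F hF
    obtain ⟨E, D, f, g, h, hT, hD, hE, hE'⟩ := exists_approximation F hF
    refine ⟨E, D, f, g, h, hT, hD, bigGen_mono H ?_ hN (by lia) _ (hlk E hE hE')⟩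
    exact Set.Icc_subset_Icc (by lia) (by lia)

end

end CoApprox

namespace CoApprox

/-! ### Coproducts of quasi-coherent sheaves -/

section

lemma nonempty_isColimit_of_iso {C : Type v₁} [Category.{v₂} C] {I : Type*} {Y Y' : I → C}
    {c : Cofan Y} (hc : IsColimit c) {c' : Cofan Y'} (e : ∀ i, Y' i ≅ Y i) (e' : c'.pt ≅ c.pt)
    (h : ∀ i, c'.inj i ≫ e'.hom = (e i).hom ≫ c.inj i) : Nonempty (IsColimit c') := by
  refine ⟨Cofan.IsColimit.mk _
    (fun t => e'.hom ≫ Cofan.IsColimit.desc hc fun i => (e i).inv ≫ t.inj i)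
    (fun t i => ?_) fun t m hm => ?_⟩
  · rw [reassoc_of% h i, Cofan.IsColimit.fac, Iso.hom_inv_id_assoc]
  · rw [← cancel_epi e'.inv, Iso.inv_hom_id_assoc]
    refine Cofan.IsColimit.hom_ext hc _ _ fun i => ?_
    rw [Cofan.IsColimit.fac, ← hm i, ← cancel_epi (e i).hom, ← reassoc_of% h i,
      Iso.hom_inv_id_assoc, Iso.hom_inv_id_assoc]

/-- A colimit of a functor from a discrete category, as a coproduct. -/
noncomputable def isColimitCofanMkApp {C : Type v₁} [Category.{v₂} C] {I : Type*}
    {F : Discrete I ⥤ C} {t : Cocone F} (ht : IsColimit t) :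
    IsColimit (Cofan.mk t.pt fun i => t.ι.app ⟨i⟩ : Cofan fun i => F.obj ⟨i⟩) :=
  Cofan.IsColimit.mk _ (fun s => ht.desc ⟨s.pt, Discrete.natTrans fun i => s.inj i.as⟩)
    (fun s j => ht.fac _ _) (fun s m hm => ht.hom_ext fun j => by
      rw [ht.fac]
      exact hm j.as)

/-- The elements of a coproduct of modules have finite support. -/
lemma exists_cofanTrunc_apply_eq_module {R : Type u} [CommRing R] {I : Type*}
    {Y : I → ModuleCat.{u} R} {c : Cofan Y} (hc : IsColimit c) (x : c.pt) :
    ∃ S : Finset I, cofanTrunc hc S x = x := by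
  classical
  -- The elements of finite support form a submodule containing every summand, so the quotient map
  -- by it vanishes.
  let P : Submodule R c.pt :=
    { carrier := {x | ∃ S : Finset I, cofanTrunc hc S x = x}
      zero_mem' := ⟨∅, map_zero _⟩
      add_mem' := by
        rintro x y ⟨S, hS⟩ ⟨S', hS'⟩
        refine ⟨S ∪ S', ?_⟩
        have hx := congr($(cofanTrunc_comp_of_subset hc (Finset.subset_union_left (s₁ := S) (s₂ := S'))) x)
        have hy := congr($(cofanTrunc_comp_of_subset hc (Finset.subset_union_right (s₁ := S) (s₂ := S'))) y)
        rw [ModuleCat.comp_apply, hS] at hx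
        rw [ModuleCat.comp_apply, hS'] at hy
        rw [map_add, hx, hy]
      smul_mem' := by
        rintro r x ⟨S, hS⟩
        exact ⟨S, by rw [map_smul, hS]⟩ }
  have h : ModuleCat.ofHom P.mkQ = 0 := by
    refine Cofan.IsColimit.hom_ext hc _ _ fun i => ?_
    ext y
    refine (Submodule.Quotient.mk_eq_zero P).2 ⟨{i}, ?_⟩
    exact congr($(inj_cofanTrunc_of_mem hc (Finset.mem_singleton_self i)) y)
  exact (Submodule.Quotient.mk_eq_zero P).1 congr($h x)

end

end CoApprox

namespace AlgebraicGeometry.Scheme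

open CoApprox

lemma isQCoh_colimit_Spec {R : CommRingCat.{u}} {I : Type u} {Y : I → (Spec R).Modules}
    {c : Cofan Y} (hc : IsColimit c) (hY : ∀ i, (Spec R).isQCoh (Y i)) : (Spec R).isQCoh c.pt := by
  choose A e using fun i => exists_iso_tilde (Y i) (hY i)
  have h := isColimitCofanMkObjOfIsColimit (tilde.functor R) _ _ (coproductIsCoproduct A)
  exact isQCoh.of_iso (IsColimit.coconePointsIsoOfNatIso h hc (Discrete.natIso fun i =>
    (e i.as).some)) (inferInstanceAs (tilde (∐ A)).IsQuasicoherent)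

instance (X : Scheme.{u}) (I : Type u) : (isQCoh X).IsClosedUnderColimitsOfShape (Discrete I) where
  colimitsOfShape_le := by
    rintro M ⟨p⟩
    refine isQCoh_of_restrict_fromSpec _ fun U hU => ?_
    exact isQCoh_colimit_Spec
      (isColimitCofanMkObjOfIsColimit (Modules.restrictFunctor hU.fromSpec) _ _
        (isColimitCofanMkApp p.isColimit))
      fun i => isQCoh_restrict _ (p.prop_diag_obj _)

instance (X : Scheme.{u}) : HasCoproducts.{u} X.QCoh := fun _ => inferInstance

/-- On quasi-coherent sheaves the map from the sheaf associated with the global sections is an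
isomorphism, and the tilde functor reflects coproducts. -/
lemma nonempty_isColimit_moduleSpecΓFunctor {R : CommRingCat.{u}} {I : Type u}
    {Y : I → (Spec R).Modules} {c : Cofan Y} (hc : IsColimit c)
    (hY : ∀ i, (Spec R).isQCoh (Y i)) :
    Nonempty (IsColimit (Cofan.mk (moduleSpecΓFunctor.obj c.pt)
      fun i => moduleSpecΓFunctor.map (c.inj i))) := by
  have hc' := isQCoh_colimit_Spec hc hY
  have hiso (M : (Spec R).Modules) (hM : (Spec R).isQCoh M) :
      IsIso (Modules.fromTildeΓNatTrans.app M) :=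
    (isQuasicoherent_iff_isIso_fromTildeΓ M).1 hM
  have := hiso _ hc'
  have := fun i => hiso _ (hY i)
  obtain ⟨h⟩ := nonempty_isColimit_of_iso hc
    (c' := Cofan.mk ((tilde.functor R).obj (moduleSpecΓFunctor.obj c.pt))
      fun i => (tilde.functor R).map (moduleSpecΓFunctor.map (c.inj i)))
    (fun i => asIso (Modules.fromTildeΓNatTrans.app (Y i)))
    (asIso (Modules.fromTildeΓNatTrans.app c.pt))
    (fun i => Modules.fromTildeΓNatTrans.naturality (c.inj i))
  exact ⟨isColimitOfIsColimitCofanMkObj (tilde.functor R) _ _ h⟩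

/-- The sections of a quasi-coherent sheaf over an affine open subset, as a functor. -/
noncomputable def affineSections {X : Scheme.{u}} {U : X.Opens} (hU : IsAffineOpen U) :
    X.QCoh ⥤ ModuleCat.{u} Γ(X, U) :=
  (isQCoh X).ι ⋙ Modules.restrictFunctor hU.fromSpec ⋙ moduleSpecΓFunctor

instance {X : Scheme.{u}} {U : X.Opens} (hU : IsAffineOpen U) : (affineSections hU).Additive where
  map_add := rfl

lemma nonempty_isColimit_affineSections {X : Scheme.{u}} {U : X.Opens} (hU : IsAffineOpen U)
    {I : Type u} {Y : I → X.QCoh} {c : Cofan Y} (hc : IsColimit c) :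
    Nonempty (IsColimit (Cofan.mk ((affineSections hU).obj c.pt)
      fun i => (affineSections hU).map (c.inj i))) := by
  have h := isColimitCofanMkObjOfIsColimit (Modules.restrictFunctor hU.fromSpec) _ _
    (isColimitCofanMkObjOfIsColimit (isQCoh X).ι _ c.inj
      (IsColimit.ofIsoColimit hc (Cofan.ext (Iso.refl _) (by simp))))
  exact nonempty_isColimit_moduleSpecΓFunctor h fun i => isQCoh_restrict _ (Y i).2

lemma exists_cofanTrunc_app_eq_of_isAffineOpen {X : Scheme.{u}} {U : X.Opens}
    (hU : IsAffineOpen U) {I : Type u} {Y : I → X.QCoh} {c : Cofan Y} (hc : IsColimit c)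
    (x : Γ(c.pt.obj, U)) :
    ∃ S : Finset I, (cofanTrunc hc S).hom.app U x = x := by
  obtain ⟨h⟩ := nonempty_isColimit_affineSections hU hc
  have key (V : X.Opens) (hV : hU.fromSpec ''ᵁ ⊤ = V) (x : Γ(c.pt.obj, V)) :
      ∃ S : Finset I, (cofanTrunc hc S).hom.app V x = x := by
    subst hV
    obtain ⟨S, hS⟩ := exists_cofanTrunc_apply_eq_module h x
    refine ⟨S, ?_⟩
    rw [← map_cofanTrunc (affineSections hU) hc h] at hS
    exact hS
  exact key U (by simp) x

end AlgebraicGeometry.Scheme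

namespace AlgebraicGeometry.Scheme

open CoApprox

/-! ### Sections of sheaves of modules -/

namespace Modules

variable {X : Scheme.{u}}

/-- The restriction of sections of a sheaf of modules to a smaller open subset. -/
noncomputable def res (M : X.Modules) {U V : X.Opens} (h : U ≤ V) : Γ(M, V) →+ Γ(M, U) :=
  (M.presheaf.map (homOfLE h).op).hom

lemma res_res (M : X.Modules) {U V W : X.Opens} (h : U ≤ V) (h' : V ≤ W) (x : Γ(M, W)) :
    M.res h (M.res h' x) = M.res (h.trans h') x :=
  congr($(M.presheaf.map_comp (homOfLE h').op (homOfLE h).op) x).symm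

lemma res_smul (M : X.Modules) {U V : X.Opens} (h : U ≤ V) (r : Γ(X, V)) (x : Γ(M, V)) :
    M.res h (r • x) = X.presheaf.map (homOfLE h).op r • M.res h x :=
  M.map_smul (homOfLE h) r x

lemma app_res {M N : X.Modules} (φ : M ⟶ N) {U V : X.Opens} (h : U ≤ V) (x : Γ(M, V)) :
    φ.app U (M.res h x) = N.res h (φ.app V x) :=
  congr($(φ.mapPresheaf.naturality (homOfLE h).op) x)

lemma eq_of_res_eq (M : X.Modules) {ι : Type*} {U : ι → X.Opens} {V : X.Opens}
    (hU : ∀ i, U i ≤ V) (hV : V ≤ ⨆ i, U i) {x y : Γ(M, V)}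
    (h : ∀ i, M.res (hU i) x = M.res (hU i) y) : x = y :=
  TopCat.Sheaf.eq_of_locally_eq' ⟨M.presheaf, M.isSheaf⟩ U V (fun i => homOfLE (hU i)) hV x y h

lemma exists_res_eq (M : X.Modules) {ι : Type*} {U : ι → X.Opens} {V : X.Opens}
    (hU : ∀ i, U i ≤ V) (hV : V ≤ ⨆ i, U i) (s : ∀ i, Γ(M, U i))
    (hs : ∀ i j, M.res inf_le_left (s i) = M.res (V := U j) inf_le_right (s j)) :
    ∃ x : Γ(M, V), ∀ i, M.res (hU i) x = s i :=
  (TopCat.Sheaf.existsUnique_gluing' ⟨M.presheaf, M.isSheaf⟩ U V (fun i => homOfLE (hU i)) hV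
    s hs).exists

/-- Every open subset of a noetherian scheme is a finite union of affine open subsets. -/
lemma exists_finite_affine_cover [AlgebraicGeometry.IsNoetherian X] (V : X.Opens) :
    ∃ (ι : Type u) (_ : Finite ι) (U : ι → X.Opens), (∀ i, IsAffineOpen (U i)) ∧
      (∀ i, U i ≤ V) ∧ V ≤ ⨆ i, U i := by
  obtain ⟨s, hs, h⟩ := (isCompact_and_isOpen_iff_finite_and_eq_biUnion_affineOpens (X := X)
    (U := V.1)).1 ⟨NoetherianSpace.isCompact _, V.2⟩
  refine ⟨s, hs, fun i => i.1.1, fun i => i.1.2, fun i x hx => ?_, fun x hx => ?_⟩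
  · change x ∈ V.1
    rw [h]
    exact Set.mem_biUnion i.2 hx
  · change x ∈ V.1 at hx
    rw [h] at hx
    obtain ⟨i, hi, hx⟩ := Set.mem_iUnion₂.1 hx
    exact Opens.mem_iSup.2 ⟨⟨i, hi⟩, hx⟩

lemma hom_ext_of_isAffineOpen {M N : X.Modules} {φ ψ : M ⟶ N}
    (h : ∀ U : X.Opens, IsAffineOpen U → ∀ x : Γ(M, U), φ.app U x = ψ.app U x) : φ = ψ := by
  refine hom_ext _ _ fun V => ?_
  ext x
  obtain ⟨ι, U, hU, hV⟩ : ∃ (ι : Type u) (U : ι → X.Opens), (∀ i, IsAffineOpen (U i)) ∧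
      V = ⨆ i, U i := by
    obtain ⟨s, hs, h⟩ := Opens.isBasis_iff_cover.1 X.isBasis_affineOpens V
    exact ⟨s, fun i => i.1, fun i => hs i.2, by rw [h, sSup_eq_iSup']⟩
  have hle (i : ι) : U i ≤ V := hV ▸ le_iSup U i
  refine N.eq_of_res_eq hle hV.le fun i => ?_
  rw [← app_res, ← app_res]
  exact h _ (hU i) _

end Modules

lemma QCoh.hom_ext_of_isAffineOpen {X : Scheme.{u}} {M N : X.QCoh} {φ ψ : M ⟶ N}
    (h : ∀ U : X.Opens, IsAffineOpen U → ∀ x : Γ(M.obj, U), φ.hom.app U x = ψ.hom.app U x) :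
    φ = ψ :=
  (isQCoh X).hom_ext (Modules.hom_ext_of_isAffineOpen h)

variable {X : Scheme.{u}} {I : Type u} {Y : I → X.QCoh} {c : Cofan Y}

lemma cofanTrunc_app_eq_of_subset (hc : IsColimit c) {S S' : Finset I} (h : S ⊆ S') {U : X.Opens}
    {x : Γ(c.pt.obj, U)} (hx : (cofanTrunc hc S).hom.app U x = x) :
    (cofanTrunc hc S').hom.app U x = x := by
  have := congr(($(cofanTrunc_comp_of_subset hc h)).hom.app U x)
  change (cofanTrunc hc S').hom.app U ((cofanTrunc hc S).hom.app U x) = _ at this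
  rwa [hx] at this

/-- A section of a coproduct of quasi-coherent sheaves on a noetherian scheme has
finite support. -/
lemma exists_cofanTrunc_app_eq [AlgebraicGeometry.IsNoetherian X] (hc : IsColimit c)
    {V : X.Opens} (x : Γ(c.pt.obj, V)) :
    ∃ S : Finset I, (cofanTrunc hc S).hom.app V x = x := by
  classical
  obtain ⟨ι, _, U, hU, hle, hV⟩ := Modules.exists_finite_affine_cover V
  have := Fintype.ofFinite ι
  choose S hS using fun i =>
    exists_cofanTrunc_app_eq_of_isAffineOpen (hU i) hc (c.pt.obj.res (hle i) x)
  refine ⟨Finset.univ.biUnion S, c.pt.obj.eq_of_res_eq hle hV fun i => ?_⟩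
  rw [← Modules.app_res]
  exact cofanTrunc_app_eq_of_subset hc (Finset.subset_biUnion_of_mem S (Finset.mem_univ i)) (hS i)

/-- The projections from a coproduct of quasi-coherent sheaves are jointly monic. -/
lemma eq_zero_of_comp_cofanProj_eq_zero (hc : IsColimit c) {P : X.QCoh} (f : P ⟶ c.pt)
    (hf : ∀ k, f ≫ cofanProj hc k = 0) : f = 0 := by
  refine QCoh.hom_ext_of_isAffineOpen fun U hU x => ?_
  -- A section of finite support is recovered from its projections, so it vanishes when they do.
  obtain ⟨S, hS⟩ := exists_cofanTrunc_app_eq_of_isAffineOpen hU hc (f.hom.app U x)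
  have h : f ≫ cofanTrunc hc S = 0 := by
    rw [cofanTrunc, Preadditive.comp_sum]
    exact Finset.sum_eq_zero fun k _ => by rw [reassoc_of% hf k, zero_comp]
  rw [← hS]
  exact congr(($h).hom.app U x)

/-- It suffices that coproducts preserve monomorphisms, which can be checked after the jointly monic
projections. -/
instance (X : Scheme.{u}) (I : Type u) : HasExactColimitsOfShape (Discrete I) X.QCoh := by
  have : Functor.PreservesMonomorphisms (colim (J := Discrete I) (C := X.QCoh)) := by
    refine ⟨fun {F G} f hf => ?_⟩
    let cF : Cofan fun i => F.obj ⟨i⟩ := Cofan.mk (colimit F) fun i => colimit.ι F ⟨i⟩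
    let cG : Cofan fun i => G.obj ⟨i⟩ := Cofan.mk (colimit G) fun i => colimit.ι G ⟨i⟩
    have hcF : IsColimit cF := isColimitCofanMkApp (colimit.isColimit F)
    have hcG : IsColimit cG := isColimitCofanMkApp (colimit.isColimit G)
    have hfi (i : I) : cF.inj i ≫ colim.map f = f.app ⟨i⟩ ≫ cG.inj i := ι_colimMap _ _
    have hcomm (k : I) : colim.map f ≫ cofanProj hcG k = cofanProj hcF k ≫ f.app ⟨k⟩ := by
      classical
      refine Cofan.IsColimit.hom_ext hcF _ _ fun i => ?_
      rw [reassoc_of% hfi i]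
      by_cases hik : i = k
      · subst hik
        rw [inj_cofanProj, reassoc_of% (inj_cofanProj hcF i), Category.comp_id]
      · rw [inj_cofanProj_of_ne hcG hik, reassoc_of% (inj_cofanProj_of_ne hcF hik), comp_zero, zero_comp]
    rw [Preadditive.mono_iff_cancel_zero]
    intro P g hg
    refine eq_zero_of_comp_cofanProj_eq_zero hcF g fun k => ?_
    rw [← cancel_mono (f.app ⟨k⟩), Category.assoc, ← hcomm, reassoc_of% hg, zero_comp, zero_comp]
  exact hasExactColimitsOfShape_of_preservesMono _ _

end AlgebraicGeometry.Scheme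

namespace AlgebraicGeometry.Scheme

open CoApprox

/-! ### Direct images of quasi-coherent sheaves -/

/-- The restriction of functions to a smaller open subset. -/
noncomputable def secRes {X : Scheme.{u}} {U V : X.Opens} (h : U ≤ V) : Γ(X, V) →+* Γ(X, U) :=
  (X.presheaf.map (homOfLE h).op).hom

lemma secRes_secRes {X : Scheme.{u}} {U V W : X.Opens} (h : U ≤ V) (h' : V ≤ W) (x : Γ(X, W)) :
    secRes h (secRes h' x) = secRes (h.trans h') x :=
  congr($(X.presheaf.map_comp (homOfLE h').op (homOfLE h).op) x).symm

lemma secRes_self {X : Scheme.{u}} {U : X.Opens} (x : Γ(X, U)) : secRes le_rfl x = x :=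
  congr($(X.presheaf.map_id (op U)) x)

lemma basicOpen_secRes {X : Scheme.{u}} {U V : X.Opens} (h : U ≤ V) (s : Γ(X, V)) :
    X.basicOpen (secRes h s) = U ⊓ X.basicOpen s :=
  X.basicOpen_res _ _

namespace Modules

variable {X : Scheme.{u}}

lemma res_smul_secRes (M : X.Modules) {U V : X.Opens} (h : U ≤ V) (r : Γ(X, V)) (x : Γ(M, V)) :
    M.res h (r • x) = secRes h r • M.res h x :=
  M.res_smul h r x

/-- The restriction of sections of `M` to the locus where the function `s` is invertible is a
localization map. -/
def IsLocalizingAt (M : X.Modules) {V : X.Opens} (s : Γ(X, V)) : Prop :=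
  ∀ (W : X.Opens) (h : W ≤ V), W = X.basicOpen s →
    (∀ x : Γ(M, W), ∃ (n : ℕ) (y : Γ(M, V)), M.res h y = secRes h (s ^ n) • x) ∧
    ∀ y : Γ(M, V), M.res h y = 0 → ∃ n : ℕ, s ^ n • y = 0

lemma isLocalizingAt_secRes_iff (M : X.Modules) {V V' : X.Opens} (e : V' = V) (s : Γ(X, V)) :
    M.IsLocalizingAt (secRes e.le s) ↔ M.IsLocalizingAt s := by
  subst e
  rw [secRes_self]

lemma smul_restrict_fromSpec (M : X.Modules) {U : X.Opens} (hU : IsAffineOpen U)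
    (U' : (Spec Γ(X, U)).Opens) (h : hU.fromSpec ''ᵁ U' ≤ U) (r : Γ(X, U))
    (x : Γ(M, hU.fromSpec ''ᵁ U')) :
    (show Γ(M, hU.fromSpec ''ᵁ U') from
      (r • (show Γ(M.restrict hU.fromSpec, U') from x) : Γ(M.restrict hU.fromSpec, U'))) =
      secRes h r • x := by
  have hle : U' ≤ hU.fromSpec ⁻¹ᵁ U := by rw [hU.fromSpec_preimage_self]; exact le_top
  have h1 : (Scheme.ΓSpecIso Γ(X, U)).inv ≫ (Spec Γ(X, U)).presheaf.map U'.leTop.op ≫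
      (hU.fromSpec.appIso U').inv = X.presheaf.map (homOfLE h).op := by
    refine Eq.trans ?_ (hU.fromSpec.appLE_appIso_inv hle)
    rw [Scheme.Hom.appLE, hU.fromSpec_app_self, Category.assoc, Category.assoc,
      ← Functor.map_comp_assoc]
    rfl
  have h2 := congr($h1 r)
  change (hU.fromSpec.appIso U').inv ((Spec Γ(X, U)).presheaf.map U'.leTop.op
    ((Scheme.ΓSpecIso Γ(X, U)).inv r)) = secRes h r at h2
  rw [← h2]
  rfl

/-- This is the criterion on affine schemes, transported along `fromSpec`; it involves only sections
over opens of `X`, so it is convenient for direct images. -/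
lemma isQCoh_iff_isLocalizingAt (M : X.Modules) :
    X.isQCoh M ↔ ∀ U : X.Opens, IsAffineOpen U → ∀ s : Γ(X, U), M.IsLocalizingAt s := by
  have key (U : X.Opens) (hU : IsAffineOpen U) :
      (Spec Γ(X, U)).isQCoh ((Modules.restrictFunctor hU.fromSpec).obj M) ↔
        ∀ s : Γ(X, U), M.IsLocalizingAt s := by
    have hle : hU.fromSpec ''ᵁ ⊤ = U := by simp
    rw [isQCoh_Spec_iff]
    refine forall_congr' fun s => ?_
    rw [← isLocalizingAt_secRes_iff M hle s]
    have hW : hU.fromSpec ''ᵁ PrimeSpectrum.basicOpen s = X.basicOpen (secRes hle.le s) := by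
      rw [hU.fromSpec_image_basicOpen, basicOpen_secRes, hle, inf_eq_right.2 (X.basicOpen_le s)]
    have hW' : hU.fromSpec ''ᵁ PrimeSpectrum.basicOpen s ≤ hU.fromSpec ''ᵁ ⊤ :=
      Scheme.Hom.image_mono _ le_top
    have hsmul (U' : (Spec Γ(X, U)).Opens) (h : hU.fromSpec ''ᵁ U' ≤ hU.fromSpec ''ᵁ ⊤) (n : ℕ)
        (x : Γ(M, hU.fromSpec ''ᵁ U')) : secRes h (secRes hle.le s ^ n) • x =
        (s ^ n • (show Γ(M.restrict hU.fromSpec, U') from x) :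
          Γ(M.restrict hU.fromSpec, U')) := by
      rw [← map_pow, secRes_secRes]
      exact (smul_restrict_fromSpec M hU U' (h.trans hle.le) (s ^ n) x).symm
    have hsmul' (n : ℕ) (x : Γ(M, hU.fromSpec ''ᵁ ⊤)) : secRes hle.le s ^ n • x =
        (s ^ n • (show Γ(M.restrict hU.fromSpec, ⊤) from x) :
          Γ(M.restrict hU.fromSpec, ⊤)) := by
      rw [← hsmul ⊤ le_rfl, secRes_self]
    constructor
    · intro h W hWle hWs
      obtain rfl : W = hU.fromSpec ''ᵁ PrimeSpectrum.basicOpen s := hWs.trans hW.symm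
      obtain ⟨h1, h2⟩ := h (PrimeSpectrum.basicOpen s) rfl
      refine ⟨fun x => ?_, fun y hy => ?_⟩
      · obtain ⟨n, y, hy⟩ := h1 x
        exact ⟨n, y, hy.symm.trans (hsmul _ _ n x).symm⟩
      · obtain ⟨n, hn⟩ := h2 y hy
        exact ⟨n, (hsmul' n y).trans hn⟩
    · rintro h W' rfl
      obtain ⟨h1, h2⟩ := h _ hW' hW
      refine ⟨fun x => ?_, fun y hy => ?_⟩
      · obtain ⟨n, y, hy⟩ := h1 x
        exact ⟨n, y, (hsmul _ _ n x).symm.trans hy.symm⟩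
      · obtain ⟨n, hn⟩ := h2 y hy
        exact ⟨n, (hsmul' n y).symm.trans hn⟩
  constructor
  · intro hM U hU
    exact (key U hU).1 (isQCoh_restrict _ hM)
  · intro h
    exact isQCoh_of_restrict_fromSpec M fun U hU => (key U hU).2 (h U hU)

/-- On a noetherian scheme, the sections of a quasi-coherent sheaf over a basic open subset are
obtained by localization. -/
lemma isLocalizingAt_of_isQCoh [AlgebraicGeometry.IsNoetherian X] {M : X.Modules}
    (hM : X.isQCoh M) {V : X.Opens} (s : Γ(X, V)) : M.IsLocalizingAt s := by
  rw [isQCoh_iff_isLocalizingAt] at hM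
  -- The second half is proved first, for an arbitrary open `V`, since it is applied to
  -- intersections of affines, which need not be affine. All large exponents are allowed so that
  -- finitely many can be made equal.
  have hinj {V : X.Opens} (s : Γ(X, V)) (W : X.Opens) (h : W ≤ V) (hW : W = X.basicOpen s)
      (y : Γ(M, V)) (hy : M.res h y = 0) : ∃ n : ℕ, ∀ m, n ≤ m → s ^ m • y = 0 := by
    obtain ⟨ι, _, U, hU, hle, hV⟩ := exists_finite_affine_cover V
    have := Fintype.ofFinite ι
    choose n hn using fun i => (hM (U i) (hU i) (secRes (hle i) s) (U i ⊓ W) inf_le_left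
      (by rw [basicOpen_secRes, hW])).2 (M.res (hle i) y)
        (by rw [res_res, ← res_res M inf_le_right h, hy, map_zero])
    refine ⟨Finset.univ.sup n, fun m hm => M.eq_of_res_eq hle hV fun i => ?_⟩
    obtain ⟨k, rfl⟩ := Nat.exists_eq_add_of_le
      ((Finset.le_sup (f := n) (Finset.mem_univ i)).trans hm)
    rw [map_zero, res_smul_secRes, map_pow, add_comm, pow_add, mul_smul, hn, smul_zero]
  intro W h hW
  refine ⟨fun x => ?_, fun y hy => (hinj s W h hW y hy).imp fun n hn => hn n le_rfl⟩
  obtain ⟨ι, _, U, hU, hle, hV⟩ := exists_finite_affine_cover V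
  have := Fintype.ofFinite ι
  obtain ⟨W', hW'⟩ : ∃ W' : ι → X.Opens, ∀ i, W' i = U i ⊓ W := ⟨_, fun _ => rfl⟩
  have hWU (i : ι) : W' i ≤ U i := (hW' i).le.trans inf_le_left
  have hWW (i : ι) : W' i ≤ W := (hW' i).le.trans inf_le_right
  obtain ⟨n, y, hy⟩ : ∃ (n : ℕ) (y : ∀ i, Γ(M, U i)), ∀ i,
      M.res (hWU i) (y i) = secRes ((hWW i).trans h) (s ^ n) • M.res (hWW i) x := by
    choose n y hy using fun i => (hM (U i) (hU i) (secRes (hle i) s) (W' i) (hWU i)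
      (by rw [basicOpen_secRes, hW' i, hW])).1 (M.res (hWW i) x)
    refine ⟨Finset.univ.sup n, fun i => secRes (hle i) s ^ (Finset.univ.sup n - n i) • y i,
      fun i => ?_⟩
    rw [res_smul_secRes, hy, smul_smul, ← map_mul, ← pow_add,
      Nat.sub_add_cancel (Finset.le_sup (Finset.mem_univ i)), ← map_pow, secRes_secRes]
  have hd (i j : ι) : ∃ m : ℕ, ∀ k, m ≤ k →
      (secRes ((inf_le_left : U i ⊓ U j ≤ U i).trans (hle i)) s ^ k : Γ(X, U i ⊓ U j)) •
        (M.res (inf_le_left : U i ⊓ U j ≤ U i) (y i) - M.res (inf_le_right : U i ⊓ U j ≤ U j) (y j)) = 0 := by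
    obtain ⟨W'', hW''⟩ : ∃ W'' : X.Opens, W'' = U i ⊓ U j ⊓ W := ⟨_, rfl⟩
    have hi : W'' ≤ W' i := by rw [hW'', hW']; exact inf_le_inf_right W inf_le_left
    have hj : W'' ≤ W' j := by rw [hW'', hW']; exact inf_le_inf_right W inf_le_right
    refine hinj (secRes (inf_le_left.trans (hle i)) s) W'' (hW''.le.trans inf_le_left)
      (by rw [basicOpen_secRes, hW'', hW]) _ ?_
    rw [map_sub, res_res, res_res, sub_eq_zero]
    have hi' := congr(M.res hi $(hy i))
    have hj' := congr(M.res hj $(hy j))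
    rw [res_smul_secRes, res_res, res_res, secRes_secRes] at hi' hj'
    exact hi'.trans hj'.symm
  choose m hm using hd
  let k := Finset.univ.sup fun p : ι × ι => m p.1 p.2
  have hk (i j : ι) : m i j ≤ k :=
    Finset.le_sup (f := fun p : ι × ι => m p.1 p.2) (Finset.mem_univ (i, j))
  -- The local lifts agree on overlaps only up to a power of `s`; after multiplication by `s ^ k`
  -- they glue.
  obtain ⟨z, hz⟩ := M.exists_res_eq hle hV (fun i => secRes (hle i) (s ^ k) • y i) fun i j => by
    have := hm i j k (hk i j)
    rw [smul_sub, sub_eq_zero] at this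
    rw [res_smul_secRes, res_smul_secRes, secRes_secRes, secRes_secRes, map_pow]
    exact this
  refine ⟨k + n, z, M.eq_of_res_eq hWW
    (by simp_rw [hW', ← iSup_inf_eq]; exact le_inf (h.trans hV) le_rfl) fun i => ?_⟩
  rw [res_res, ← res_res M (hWU i) (hle i), hz, res_smul_secRes, hy, res_smul_secRes,
    secRes_secRes, secRes_secRes, smul_smul, ← map_mul, pow_add]

/-- Sections of the direct image over `U` are sections over `f ⁻¹ᵁ U`, and the preimage of a basic
open is the basic open of the pulled back function. So localization over arbitrary opens of `Y` is
what is needed. -/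
lemma isQCoh_pushforward {Y : Scheme.{u}} [AlgebraicGeometry.IsNoetherian Y] (f : Y ⟶ X)
    {M : Y.Modules} (hM : Y.isQCoh M) : X.isQCoh ((pushforward f).obj M) := by
  rw [isQCoh_iff_isLocalizingAt]
  rintro U hU s W h rfl
  have hnat (n : ℕ) : secRes (Scheme.Hom.preimage_mono f h) (f.app U s ^ n) =
      f.app (X.basicOpen s) (secRes h (s ^ n)) := by
    rw [← map_pow]
    exact congr($(f.naturality (homOfLE h).op) (s ^ n)).symm
  obtain ⟨h1, h2⟩ := isLocalizingAt_of_isQCoh hM (f.app U s) (f ⁻¹ᵁ X.basicOpen s)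
    (Scheme.Hom.preimage_mono f h) (Scheme.preimage_basicOpen f s)
  refine ⟨fun x => ?_, fun y hy => ?_⟩
  · obtain ⟨n, y, hy⟩ := h1 x
    refine ⟨n, y, hy.trans ?_⟩
    rw [hnat]
    rfl
  · obtain ⟨n, hn⟩ := h2 y hy
    refine ⟨n, Eq.trans ?_ hn⟩
    rw [← map_pow]
    rfl

end Modules

end AlgebraicGeometry.Scheme

namespace AlgebraicGeometry.Scheme

open CoApprox

/-! ### Injective quasi-coherent sheaves -/

namespace QCoh

variable {X Y : Scheme.{u}}

/-- The direct image of quasi-coherent sheaves along a morphism from a noetherian scheme. -/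
noncomputable def pushforward [AlgebraicGeometry.IsNoetherian Y] (f : Y ⟶ X) : Y.QCoh ⥤ X.QCoh :=
  (isQCoh X).lift ((isQCoh Y).ι ⋙ Modules.pushforward f)
    fun M => Modules.isQCoh_pushforward f M.2

/-- The restriction of quasi-coherent sheaves along an open immersion. -/
noncomputable def restrictFunctor (f : Y ⟶ X) [IsOpenImmersion f] : X.QCoh ⥤ Y.QCoh :=
  (isQCoh Y).lift ((isQCoh X).ι ⋙ Modules.restrictFunctor f) fun M => isQCoh_restrict f M.2

/-- Restriction of quasi-coherent sheaves is left adjoint to the direct image. -/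
noncomputable def restrictAdjunction [AlgebraicGeometry.IsNoetherian Y] (f : Y ⟶ X)
    [IsOpenImmersion f] : restrictFunctor f ⊣ pushforward f :=
  (Modules.restrictAdjunction f).restrictFullyFaithful (isQCoh X).fullyFaithfulι
    (isQCoh Y).fullyFaithfulι (Iso.refl _) (Iso.refl _)

instance (f : Y ⟶ X) [IsOpenImmersion f] : (restrictFunctor f).PreservesMonomorphisms where
  preserves g hg := by
    have := (isQCoh X).preservesMonomorphisms_ι_of_isNormalEpiCategory
    have h1 : Mono ((Modules.restrictFunctor f).map ((isQCoh X).ι.map g)) :=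
      preserves_mono_of_preservesLimit _ _
    exact (isQCoh Y).ι.mono_of_mono_map h1

lemma isNoetherian_Spec [IsLocallyNoetherian X] {U : X.Opens} (hU : IsAffineOpen U) :
    AlgebraicGeometry.IsNoetherian (Spec Γ(X, U)) := by
  have := IsLocallyNoetherian.component_noetherian (X := X) ⟨U, hU⟩
  infer_instance

/-- The quasi-coherent sheaf on an affine scheme associated with a module. -/
noncomputable def tildeFunctor (R : CommRingCat.{u}) : ModuleCat.{u} R ⥤ (Spec R).QCoh :=
  (isQCoh (Spec R)).lift (tilde.functor R) fun M =>
    inferInstanceAs (tilde M).IsQuasicoherent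

instance (R : CommRingCat.{u}) : (tildeFunctor R).Faithful :=
  Functor.Faithful.of_comp_iso (H := tilde.functor R) (Iso.refl (tildeFunctor R ⋙ (isQCoh _).ι))

instance (R : CommRingCat.{u}) : (tildeFunctor R).Full :=
  Functor.Full.of_comp_faithful_iso (H := tilde.functor R)
    (Iso.refl (tildeFunctor R ⋙ (isQCoh _).ι))

instance (R : CommRingCat.{u}) : (tildeFunctor R).EssSurj where
  mem_essImage M := by
    obtain ⟨A, ⟨e⟩⟩ := exists_iso_tilde M.obj M.2
    exact ⟨A, ⟨(isQCoh (Spec R)).isoMk e⟩⟩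

instance (R : CommRingCat.{u}) : (tildeFunctor R).IsEquivalence where

instance (R : CommRingCat.{u}) : (tildeFunctor R).Additive where
  map_add := (isQCoh (Spec R)).hom_ext (Functor.map_add (tilde.functor R))

instance [AlgebraicGeometry.IsNoetherian Y] (f : Y ⟶ X) : (pushforward f).Additive where
  map_add := rfl

/-- The direct image of the quasi-coherent sheaf associated with a module over the ring of
functions of an affine open subset. -/
noncomputable def pushforwardTilde [IsLocallyNoetherian X] {U : X.Opens} (hU : IsAffineOpen U) :
    ModuleCat.{u} Γ(X, U) ⥤ X.QCoh :=
  have := isNoetherian_Spec hU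
  tildeFunctor Γ(X, U) ⋙ pushforward hU.fromSpec

instance [IsLocallyNoetherian X] {U : X.Opens} (hU : IsAffineOpen U) :
    (pushforwardTilde hU).Additive :=
  have := isNoetherian_Spec hU
  inferInstanceAs (tildeFunctor Γ(X, U) ⋙ pushforward hU.fromSpec).Additive

/-- The module of sections of a quasi-coherent sheaf over an affine open subset. -/
noncomputable def sections {U : X.Opens} (hU : IsAffineOpen U) :
    X.QCoh ⥤ ModuleCat.{u} Γ(X, U) :=
  restrictFunctor hU.fromSpec ⋙ (tildeFunctor Γ(X, U)).inv

/-- The sections over an affine open subset are left adjoint to the direct image. -/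
noncomputable def sectionsAdjunction [IsLocallyNoetherian X] {U : X.Opens} (hU : IsAffineOpen U) :
    sections hU ⊣ pushforwardTilde hU :=
  have := isNoetherian_Spec hU
  (restrictAdjunction hU.fromSpec).comp (tildeFunctor Γ(X, U)).asEquivalence.symm.toAdjunction

instance {U : X.Opens} (hU : IsAffineOpen U) : (sections hU).PreservesMonomorphisms :=
  inferInstanceAs (_ ⋙ _ : X.QCoh ⥤ _).PreservesMonomorphisms

/-- A right adjoint of a functor preserving monomorphisms preserves injectives. -/
instance [IsLocallyNoetherian X] {U : X.Opens} (hU : IsAffineOpen U) (J : ModuleCat.{u} Γ(X, U))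
    [Injective J] : Injective ((pushforwardTilde hU).obj J) :=
  (sectionsAdjunction hU).map_injective _ inferInstance

instance {U : X.Opens} (hU : IsAffineOpen U) : (sections hU).PreservesZeroMorphisms where
  map_zero M N := by
    have : (restrictFunctor hU.fromSpec).map (0 : M ⟶ N) = 0 := rfl
    rw [sections, Functor.comp_map, this]
    simp

/-- A morphism of quasi-coherent sheaves which vanishes on an affine cover is zero. -/
lemma eq_zero_of_sections_map_eq_zero {M N : X.QCoh} (φ : M ⟶ N) {ι : Type*} {U : ι → X.Opens}
    (hU : ∀ i, IsAffineOpen (U i)) (hcov : ⊤ ≤ ⨆ i, U i)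
    (h : ∀ i, (sections (hU i)).map φ = 0) : φ = 0 := by
  have h1 (i : ι) : (restrictFunctor (hU i).fromSpec).map φ = 0 :=
    (tildeFunctor Γ(X, U i)).inv.map_injective ((h i).trans (Functor.map_zero _ _ _).symm)
  refine (isQCoh X).hom_ext (Modules.hom_ext _ _ fun V => ?_)
  ext x
  refine N.obj.eq_of_res_eq (U := fun i => V ⊓ U i) (fun i => inf_le_left)
    (by rw [← inf_iSup_eq]; exact le_inf le_rfl (le_top.trans hcov)) fun i => ?_
  rw [← Modules.app_res, ← Modules.app_res]
  have key (W : X.Opens) (W' : (Spec Γ(X, U i)).Opens) (hW : (hU i).fromSpec ''ᵁ W' = W)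
      (x : Γ(M.obj, W)) : φ.hom.app W x = 0 := by
    subst hW
    exact congr(($(h1 i)).hom.app W' x)
  refine key _ ((hU i).fromSpec ⁻¹ᵁ (V ⊓ U i)) ?_ _
  rw [Scheme.Hom.image_preimage_eq_opensRange_inf, (hU i).opensRange_fromSpec]
  exact inf_eq_right.2 inf_le_right

section

variable [AlgebraicGeometry.IsNoetherian X]

/-- The morphism from a quasi-coherent sheaf to the direct image of an injective module over the
functions of an affine open subset. -/
noncomputable def toPushforwardUnder (M : X.QCoh) {U : X.Opens} (hU : IsAffineOpen U) :
    M ⟶ (pushforwardTilde hU).obj (Injective.under ((sections hU).obj M)) :=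
  (sectionsAdjunction hU).homEquiv _ _ (Injective.ι _)

/-- By adjunction the hypothesis says that `g` on sections, followed by a monomorphism into an
injective module, is zero. -/
lemma sections_map_eq_zero {M P : X.QCoh} (g : P ⟶ M) {U : X.Opens} (hU : IsAffineOpen U)
    (h : g ≫ M.toPushforwardUnder hU = 0) : (sections hU).map g = 0 := by
  rw [← cancel_mono (Injective.ι ((sections hU).obj M)), zero_comp]
  apply ((sectionsAdjunction hU).homEquiv _ _).injective
  rw [Adjunction.homEquiv_naturality_left]
  refine h.trans ?_
  rw [Adjunction.homEquiv_unit, Functor.map_zero, comp_zero]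

attribute [local instance] Abelian.hasFiniteBiproducts

lemma mono_lift_toPushforwardUnder (M : X.QCoh) {ι : Type*} [Finite ι] {U : ι → X.Opens}
    (hU : ∀ i, IsAffineOpen (U i)) (hcov : ⊤ ≤ ⨆ i, U i) :
    Mono (biproduct.lift fun i => M.toPushforwardUnder (hU i)) := by
  rw [Preadditive.mono_iff_cancel_zero]
  intro P g hg
  refine eq_zero_of_sections_map_eq_zero g hU hcov fun i => sections_map_eq_zero g (hU i) ?_
  rw [← biproduct.lift_π (fun i => M.toPushforwardUnder (hU i)) i, reassoc_of% hg, zero_comp]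

/-- Over a finite affine cover, a sheaf embeds into the finite sum of the direct images of injective
modules containing its sections. -/
instance : EnoughInjectives X.QCoh where
  presentation M := by
    obtain ⟨ι, _, U, hU, -, hcov⟩ := Modules.exists_finite_affine_cover (⊤ : X.Opens)
    have := mono_lift_toPushforwardUnder M hU hcov
    exact ⟨⟨_, inferInstance, _, this⟩⟩

end

end QCoh

end AlgebraicGeometry.Scheme

/-! ### Coproducts of injective modules over a noetherian ring -/

namespace CoApprox

/-- A coproduct of injective modules over a noetherian ring is injective. -/
lemma injective_of_isColimit_cofan {R : Type u} [CommRing R] [IsNoetherianRing R] {I : Type*}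
    {Y : I → ModuleCat.{u} R} (hY : ∀ i, Injective (Y i)) {c : Cofan Y} (hc : IsColimit c) :
    Injective c.pt := by
  classical
  have hY' (i : I) : Module.Injective R (Y i) :=
    Module.injective_module_of_injective_object (inj := hY i)
  -- Baer's criterion: ideals are finitely generated, so a map from one lands in finitely many
  -- summands, over each of which it extends.
  have hB : Module.Baer R c.pt := by
    intro J g
    obtain ⟨T, hT⟩ := (isNoetherianRing_iff_ideal_fg R).1 inferInstance J
    have hTJ (t : T) : (t : R) ∈ J := hT ▸ Ideal.subset_span t.2
    choose S hS using fun t : T => exists_cofanTrunc_apply_eq_module hc (g ⟨t, hTJ t⟩)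
    let S' := Finset.univ.biUnion S
    have hS' : (cofanTrunc hc S').hom ∘ₗ g = g := by
      have key : ∀ (x : R) (hx : x ∈ Ideal.span (T : Set R)),
          cofanTrunc hc S' (g ⟨x, hT ▸ hx⟩) = g ⟨x, hT ▸ hx⟩ := by
        intro x hx
        induction hx using Submodule.span_induction with
        | mem x hx =>
          have h := congr($(cofanTrunc_comp_of_subset hc
            (Finset.subset_biUnion_of_mem S (Finset.mem_univ ⟨x, hx⟩))) (g ⟨x, hTJ ⟨x, hx⟩⟩))
          rw [ModuleCat.comp_apply, hS ⟨x, hx⟩] at h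
          exact h
        | zero =>
          have : (⟨0, J.zero_mem⟩ : J) = 0 := rfl
          rw [this, map_zero, map_zero]
        | add x y hx hy h1 h2 =>
          have := congr($h1 + $h2)
          rwa [← map_add, ← map_add] at this
        | smul r x hx h1 =>
          have := congr(r • $h1)
          rwa [← map_smul, ← map_smul] at this
      ext x
      exact key x.1 (hT ▸ x.2)
    choose e he using fun k => Module.Baer.of_injective (hY' k) J ((cofanProj hc k).hom ∘ₗ g)
    refine ⟨∑ k ∈ S', (c.inj k).hom ∘ₗ e k, fun x hx => ?_⟩
    conv_rhs => rw [← hS']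
    rw [cofanTrunc]
    simp only [LinearMap.sum_apply, LinearMap.comp_apply, ModuleCat.hom_sum, ModuleCat.hom_comp]
    exact Finset.sum_congr rfl fun k _ => congrArg _ (he k x hx)
  have := hB.injective
  exact Module.injective_object_of_injective_module (R := R) (M := c.pt)

end CoApprox

/-! ### Coproducts, direct images and injective quasi-coherent sheaves -/

namespace AlgebraicGeometry.Scheme.QCoh

open CoApprox

/-- The direct image along a morphism from a noetherian scheme commutes with coproducts. -/
lemma nonempty_isColimit_pushforward {X Y : Scheme.{u}} [AlgebraicGeometry.IsNoetherian Y]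
    (f : Y ⟶ X) {I : Type u} {Z : I → Y.QCoh} {c : Cofan Z} (hc : IsColimit c) :
    Nonempty (IsColimit (Cofan.mk ((pushforward f).obj c.pt)
      fun i => (pushforward f).map (c.inj i))) := by
  classical
  let Z' (i : I) : X.QCoh := (pushforward f).obj (Z i)
  have hc' := coproductIsCoproduct Z'
  let c' : Cofan Z' := Cofan.mk (∐ Z') (Sigma.ι Z')
  change IsColimit c' at hc'
  -- The comparison map is monic because it respects the jointly monic projections, and epic because
  -- sections over any open of the noetherian scheme `Y` have finite support.
  let φ : c'.pt ⟶ (pushforward f).obj c.pt :=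
    Cofan.IsColimit.desc hc' fun i => (pushforward f).map (c.inj i)
  have hφ (i : I) : c'.inj i ≫ φ = (pushforward f).map (c.inj i) :=
    Cofan.IsColimit.fac hc' _ i
  have hproj (k : I) : φ ≫ (pushforward f).map (cofanProj hc k) = cofanProj hc' k := by
    refine Cofan.IsColimit.hom_ext hc' _ _ fun i => ?_
    rw [reassoc_of% hφ i, ← Functor.map_comp]
    by_cases hik : i = k
    · subst hik
      rw [inj_cofanProj, inj_cofanProj]
      exact (pushforward f).map_id _
    · rw [inj_cofanProj_of_ne hc hik, inj_cofanProj_of_ne hc' hik, Functor.map_zero]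
  have : Mono φ := by
    rw [Preadditive.mono_iff_cancel_zero]
    intro P g hg
    refine eq_zero_of_comp_cofanProj_eq_zero hc' g fun k => ?_
    rw [← hproj, reassoc_of% hg, zero_comp]
  have : Epi φ := by
    rw [Preadditive.epi_iff_cancel_zero]
    intro Q g hg
    refine QCoh.hom_ext_of_isAffineOpen fun U _ x => ?_
    obtain ⟨S, hS⟩ := exists_cofanTrunc_app_eq hc (V := f ⁻¹ᵁ U) x
    have h : (pushforward f).map (cofanTrunc hc S) ≫ g = 0 := by
      rw [cofanTrunc, Functor.map_sum, Preadditive.sum_comp]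
      refine Finset.sum_eq_zero fun k _ => ?_
      rw [Functor.map_comp, ← hφ, Category.assoc, Category.assoc, hg, comp_zero, comp_zero]
    have h' := congr(($h).hom.app U x)
    change g.hom.app U ((cofanTrunc hc S).hom.app (f ⁻¹ᵁ U) x) = 0 at h'
    rw [hS] at h'
    exact h'
  have := isIso_of_mono_of_epi φ
  refine nonempty_isColimit_of_iso hc' (fun i => Iso.refl _) (asIso φ).symm fun i => ?_
  rw [Iso.symm_hom, asIso_inv, Iso.refl_hom, Category.id_comp, IsIso.comp_inv_eq, hφ]
  rfl

lemma nonempty_isColimit_pushforwardTilde {X : Scheme.{u}} [IsLocallyNoetherian X] {U : X.Opens}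
    (hU : IsAffineOpen U) {I : Type u} {A : I → ModuleCat.{u} Γ(X, U)} {c : Cofan A}
    (hc : IsColimit c) :
    Nonempty (IsColimit (Cofan.mk ((pushforwardTilde hU).obj c.pt)
      fun i => (pushforwardTilde hU).map (c.inj i))) :=
  have := isNoetherian_Spec hU
  nonempty_isColimit_pushforward hU.fromSpec
    (isColimitCofanMkObjOfIsColimit (tildeFunctor Γ(X, U)) _ c.inj
      (IsColimit.ofIsoColimit hc (Cofan.ext (Iso.refl _) (by simp))))

attribute [local instance] Abelian.hasFiniteBiproducts

/-- Each injective `J k` is a retract of a finite sum over the cover of direct images of injective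
modules `A i k`. Direct images commute with coproducts and `∐ A i` is injective, so the coproduct of
the `J k` is a retract of the injective sheaf `⨁ D`. -/
instance {X : Scheme.{u}} [AlgebraicGeometry.IsNoetherian X] (I : Type u) :
    (isInjective X.QCoh).IsClosedUnderColimitsOfShape (Discrete I) where
  colimitsOfShape_le := by
    rintro M ⟨p⟩
    obtain ⟨ι, _, U, hU, -, hcov⟩ := Modules.exists_finite_affine_cover (⊤ : X.Opens)
    have hc := isColimitCofanMkApp p.isColimit
    let J (k : I) : X.QCoh := p.diag.obj ⟨k⟩
    let c : Cofan J := Cofan.mk M fun k => p.ι.app ⟨k⟩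
    change IsColimit c at hc
    have hJ (k : I) : Injective (J k) := p.prop_diag_obj ⟨k⟩
    let A (i : ι) (k : I) : ModuleCat.{u} Γ(X, U i) := Injective.under ((sections (hU i)).obj (J k))
    let D (i : ι) : X.QCoh := (pushforwardTilde (hU i)).obj (∐ A i)
    have hD (i : ι) : Injective (D i) := by
      have := IsLocallyNoetherian.component_noetherian (X := X) ⟨U i, hU i⟩
      exact (sectionsAdjunction (hU i)).map_injective _
        (injective_of_isColimit_cofan (fun k => inferInstanceAs (Injective (Injective.under _)))
          (coproductIsCoproduct (A i)))
    have hcD (i : ι) := (nonempty_isColimit_pushforwardTilde (hU i)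
      (coproductIsCoproduct (A i))).some
    let E (k : I) : X.QCoh := ⨁ fun i => (pushforwardTilde (hU i)).obj (A i k)
    let d (k : I) : E k ⟶ ⨁ D :=
      biproduct.map fun i => (pushforwardTilde (hU i)).map (Sigma.ι (A i) k)
    let s (k : I) : J k ⟶ E k := biproduct.lift fun i => (J k).toPushforwardUnder (hU i)
    have hs (k : I) : Mono (s k) := mono_lift_toPushforwardUnder (J k) hU hcov
    let r (k : I) : E k ⟶ J k := Injective.factorThru (𝟙 _) (s k)
    have hsr (k : I) : s k ≫ r k = 𝟙 _ := Injective.comp_factorThru _ _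
    let σ : M ⟶ ⨁ D := Cofan.IsColimit.desc hc fun k => s k ≫ d k
    let ρ : ⨁ D ⟶ M := biproduct.desc fun i => Cofan.IsColimit.desc (hcD i)
      fun k => biproduct.ι (fun i => (pushforwardTilde (hU i)).obj (A i k)) i ≫ r k ≫ c.inj k
    have hdρ (k : I) : d k ≫ ρ = r k ≫ c.inj k := by
      refine biproduct.hom_ext' _ _ fun i => ?_
      rw [biproduct.ι_map_assoc, biproduct.ι_desc]
      exact Cofan.IsColimit.fac (hcD i) _ k
    have h : σ ≫ ρ = 𝟙 M := by
      refine Cofan.IsColimit.hom_ext hc _ _ fun k => ?_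
      rw [reassoc_of% (Cofan.IsColimit.fac hc (fun k => s k ≫ d k) k), hdρ, reassoc_of% hsr k]
      exact (Category.comp_id _).symm
    exact (Retract.mk σ ρ h).injective

end AlgebraicGeometry.Scheme.QCoh

namespace AlgebraicGeometry.Scheme

open CoApprox

/-! ### Coherent sheaves -/

/-- The section over `U` given by a global section of the restriction to `U`. -/
def Modules.sectionOver {X : Scheme.{u}} (M : X.Modules) {U : X.Opens}
    (s : (SheafOfModules.over M U).sections) : Γ(M, U) :=
  s.1 (op (Over.mk (𝟙 U)))

/-- Morphisms which agree on generating sections over an open subset `U` agree on `U`. -/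
lemma Modules.app_eq_of_generatingSections {X : Scheme.{u}} {M N : X.Modules} {U : X.Opens}
    (σ : SheafOfModules.GeneratingSections (SheafOfModules.over M U)) (φ ψ : M ⟶ N)
    (h : ∀ j, φ.app U (M.sectionOver (σ.s j)) = ψ.app U (M.sectionOver (σ.s j)))
    {V : X.Opens} (hV : V ≤ U) (x : Γ(M, V)) : φ.app V x = ψ.app V x := by
  have hφ : SheafOfModules.Hom.over φ U = SheafOfModules.Hom.over ψ U := by
    -- Generation is an epimorphism from a free sheaf, so the two maps need only be compared on the
    -- generators.
    rw [← cancel_epi σ.π, SheafOfModules.freeHomEquiv_symm_comp,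
      SheafOfModules.freeHomEquiv_symm_comp]
    congr 1
    funext j
    refine PresheafOfModules.sections_ext _ _ fun Y => ?_
    have hY : (σ.s j).1 Y = M.res (leOfHom Y.unop.hom) (M.sectionOver (σ.s j)) :=
      (PresheafOfModules.sections_property (σ.s j)
        (Over.homMk Y.unop.hom : Y.unop ⟶ Over.mk (𝟙 U)).op).symm
    change φ.app Y.unop.left ((σ.s j).1 Y) = ψ.app Y.unop.left ((σ.s j).1 Y)
    rw [hY, app_res, app_res, h]
  exact congr(($hφ).val.app (op (Over.mk (homOfLE hV))) x)

/-- A quasi-coherent sheaf of finite type on a noetherian scheme only maps to finite parts of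
coproducts. -/
lemma isFinitelySupported_of_isFiniteType {X : Scheme.{u}} [AlgebraicGeometry.IsNoetherian X]
    (M : X.QCoh) (hM : M.obj.IsFiniteType) : IsFinitelySupported.{u} M := by
  classical
  intro I Y c hc f
  obtain ⟨σ, hσ⟩ := hM.exists_localGeneratorsData
  have hcov : ⨆ i, σ.X i = ⊤ := (Opens.coversTop_iff _ _).1 σ.coversTop
  obtain ⟨T, hT⟩ := (CompactSpace.isCompact_univ (X := X)).elim_finite_subcover
    (fun i => (σ.X i : Set X)) (fun i => (σ.X i).2) (by
      rw [← Opens.coe_iSup, hcov]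
      exact subset_rfl)
  have (i : σ.I) : Finite (σ.generators i).I := (hσ.isFiniteType i).finite
  have (i : σ.I) := Fintype.ofFinite (σ.generators i).I
  choose S hS using fun (i : σ.I) (j : (σ.generators i).I) =>
    exists_cofanTrunc_app_eq hc (f.hom.app (σ.X i) (M.obj.sectionOver ((σ.generators i).s j)))
  -- Finitely many opens cover `X`, each with finitely many generators, and the image of each
  -- generator has finite support.
  let S' := T.biUnion fun i => Finset.univ.biUnion (S i)
  refine ⟨S', (isQCoh X).hom_ext (Modules.hom_ext _ _ fun V => ?_)⟩
  ext x
  refine c.pt.obj.eq_of_res_eq (U := fun i : T => V ⊓ σ.X i) (fun i => inf_le_left)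
    (fun y hy => ?_) fun i => ?_
  · obtain ⟨i, hi, hyi⟩ := Set.mem_iUnion₂.1 (hT (Set.mem_univ y))
    exact Opens.mem_iSup.2 ⟨⟨i, hi⟩, hy, hyi⟩
  · refine (Modules.app_res (f ≫ cofanTrunc hc S').hom inf_le_left x).symm.trans
      (Eq.trans ?_ (Modules.app_res f.hom inf_le_left x))
    refine Modules.app_eq_of_generatingSections (σ.generators i.1) (f ≫ cofanTrunc hc S').hom f.hom
      (fun j => ?_) inf_le_right _
    refine cofanTrunc_app_eq_of_subset hc ?_ (hS i j)
    exact (Finset.subset_biUnion_of_mem (S i.1) (Finset.mem_univ j)).trans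
      (Finset.subset_biUnion_of_mem (fun i => Finset.univ.biUnion (S i)) i.2)

end AlgebraicGeometry.Scheme

theorem mainTheorem7 (X : Scheme.{u}) [AlgebraicGeometry.IsNoetherian X]
    [HasDerivedCategory.{w} X.QCoh]
    (G : DerivedCategory X.QCoh) (hG : Scheme.IsBoundedCoherent G)
    (N : ℕ) (hN : 0 < N) (hgen : CoApprox.bigGen.{u} G Set.univ N = ⊤) :
    CoApprox.IsCoapproximable.{u} X.KInj ∧
      CoApprox.IsCoapproximableVia.{u} X.kInjGE X.kInjLE := by
  obtain ⟨⟨a, b, ha, hb⟩, hcoh⟩ := hG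
  -- `kInjGE` and `kInjLE` unfold to `homotopyGE` and `homotopyLE` at `0`. Coherence of the
  -- cohomology of `G` serves only to provide finite support.
  have h : CoApprox.IsCoapproximableVia.{u} X.kInjGE X.kInjLE :=
    CoApprox.isCoapproximableVia_of_bigGen_eq_top G a b ha hb
      (fun n => Scheme.isFinitelySupported_of_isFiniteType _ (hcoh n)) N hN hgen
  exact ⟨⟨_, _, h⟩, h⟩
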